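/- **Theorem 2.2.** Every lean fork-graph $G$ has a directed cycle double cover, i.e. a finite family of directed cycles of $G$ such that each edge of $G$ lies on exactly two of them and these two traverse it in opposite directions. Here all graphs are finite and simple, and lean fork-graphs are defined as follows. *Fork-collection.* It consists of the following graphs. - The dot: a single vertex. The subfork: two vertices joined by an edge. The star fork: $K_{1,3}$. - The fork: vertices $z,x,y,b,a$, edges $zx,zy,zb,ba$. - The p-fork: vertices $0,\dots,7$, edges $01,12,23,34,45,50,62,65,67$ (the Petersen graph minus two non-adjacent vertices, one adjacent to $7,0,3$ and the other to $7,1,4$). - The $j$-big-forks $B$ ($j\ge 1$), with connecting sets $C(B)$. Call the fork, with $C=\{x,y,a\}$, the $0$-big-fork for this recursion only. A $j$-big-fork $B$ arises from a $(j-1)$-big-fork $B'$ and a disjoint star fork by joining two of its leaves, by one edge each, to two distinct vertices of $B'$ of degree at most two in $B'$, where a vertex of degree two may be used only if it is not in $C(B')$; and $C(B)=C(B')\cup\{v\}$, where $v$ is the third leaf of the star fork. *Bold members.* A bold dot is the dot with two or three half-edges. A bold subfork, star fork or fork has exactly one half-edge at each leaf and no others. A bold p-fork has exactly one half-edge at each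 of $7,0,3$ and no others. A bold $j$-big-fork $B$ has a half-edge at each vertex of $C(B)$ and possibly additional edges and half-edges, such that all degrees are at most three (and the graph stays simple). *Building sequences.* A building sequence of a cubic graph $G$ is a sequence $G_0,\dots,G_n=G$ of 2-connected graphs such that $G_0$ is a triangle and, for $1\le i\le n$, $G_i$ is obtained from $G_{i-1}$ by adding a disjoint bold member $L_i$ of the fork-collection and connecting its half-edges to pairwise distinct vertices of $G_{i-1}$ that have degree two in $G_{i-1}$; moreover $L_i$ is the fork for at most one $i$. The sequence is lean if, for all $i,j\ge 1$ such that $L_i$ is a $j$-big-fork, there are at most $j+3$ pairwise vertex-disjoint paths from $V(L_i)$ to $V(G_{i-1})$ that use only edges of $E(G)\setminus E(G_i)$. *Lean fork-graphs* are the cubic graphs that have a lean building sequence, and all cubic graphs obtained from these by finitely many Y–$\Delta$ and $\Delta$–Y transformations (replacing a vertex by a triangle whose three vertices inherit one each of its three edges, and vice versa). -/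

import Mathlib

universe u

namespace ForkGraph

open SimpleGraph

/-! Directed cycle double covers -/

/-- A directed cycle double cover of a simple graph: a finite family of directed cycles such that
every orientation (dart) of every edge is traversed by exactly one of the cycles. As a cycle uses
each of its edges only once, every edge then lies on exactly two of the cycles, and these two
traverse it in opposite directions. -/
def HasDirectedCycleDoubleCover {V : Type u} (G : SimpleGraph V) : Prop :=
  ∃ (k : ℕ) (base : Fin k → V) (cyc : ∀ i, G.Walk (base i) (base i)),
    (∀ i, (cyc i).IsCycle) ∧ ∀ d : G.Dart, ∃! i, d ∈ (cyc i).darts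

/-! Basic graph notions -/

/-- The number of neighbours of `v` inside the vertex set `S`. -/
noncomputable def degIn {V : Type u} (G : SimpleGraph V) (S : Set V) (v : V) : ℕ :=
  (G.neighborSet v ∩ S).ncard

/-- Every vertex has exactly three neighbours. -/
def IsCubic {V : Type u} (G : SimpleGraph V) : Prop :=
  ∀ v, (G.neighborSet v).ncard = 3

/-- The subgraph induced by `S`, regarded as a graph on the whole vertex type. -/
def within {V : Type u} (G : SimpleGraph V) (S : Set V) : SimpleGraph V where
  Adj a b := G.Adj a b ∧ a ∈ S ∧ b ∈ S
  symm := ⟨fun _ _ h => ⟨h.1.symm, h.2.2, h.2.1⟩⟩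
  loopless := ⟨fun _ h => h.1.ne rfl⟩

/-- Connected, with at least three vertices, and without cut vertices. -/
def IsTwoConnected {V : Type u} (G : SimpleGraph V) : Prop :=
  G.Connected ∧ 3 ≤ Nat.card V ∧ ∀ v : V, (G.induce {v}ᶜ).Connected

/-- `T` is the vertex set of a triangle of `G`. -/
def IsTriangle {V : Type u} (G : SimpleGraph V) (T : Set V) : Prop :=
  ∃ p q r : V, G.Adj p q ∧ G.Adj q r ∧ G.Adj r p ∧ T = {p, q, r}

/-- There are `k` pairwise vertex-disjoint paths of `H` from `A` to `B`. -/
def HasDisjointPaths {V : Type u} (H : SimpleGraph V) (A B : Set V) (k : ℕ) : Prop :=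
  ∃ (a b : Fin k → V) (p : ∀ i, H.Walk (a i) (b i)),
    (∀ i, a i ∈ A ∧ b i ∈ B ∧ (p i).IsPath) ∧
    ∀ i j, i ≠ j → List.Disjoint (p i).support (p j).support

/-! The fork-collection -/

/-- The dot: an isolated vertex. -/
def dotGraph : SimpleGraph (Fin 1) := ⊥

/-- The subfork: two vertices joined by an edge. -/
def subforkGraph : SimpleGraph (Fin 2) := fromEdgeSet {s(0, 1)}

/-- The star fork: centre `0` and leaves `1, 2, 3`. -/
def starForkGraph : SimpleGraph (Fin 4) := fromEdgeSet {s(0, 1), s(0, 2), s(0, 3)}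

/-- The fork: the star with centre `0` and leaves `1, 2, 4` whose edge from `0` to `4` is subdivided
by the vertex `3`. -/
def forkGraph : SimpleGraph (Fin 5) := fromEdgeSet {s(0, 1), s(0, 2), s(0, 3), s(3, 4)}

/-- The p-fork, which is the Petersen graph minus two non-adjacent vertices: the 6-cycle
`0 1 2 3 4 5`, the vertex `6` adjacent to `2`, `5` and `7`, and the leaf `7`. One of the two missing
vertices of the Petersen graph is adjacent to `7, 0, 3`, the other one to `7, 1, 4`. -/
def pForkGraph : SimpleGraph (Fin 8) :=
  fromEdgeSet {s(0, 1), s(1, 2), s(2, 3), s(3, 4), s(4, 5), s(5, 0), s(6, 2), s(6, 5), s(6, 7)}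

/-- `IsForkTower j L W C`: for `j ≥ 1`, `L` (a graph with vertex set `W` inside `V`) is a
`j`-big-fork with connecting set `C`. The value `j = 0` is the fork with its three leaves as
connecting set, and level `j + 1` arises from level `j` and a new star fork by joining two leaves
of the star fork to two distinct vertices `p`, `q` of degree at most two, where a vertex of degree
two may be used only if it is not in the connecting set. The third leaf of the star fork is added
to the connecting set. -/
inductive IsForkTower {V : Type u} : ℕ → SimpleGraph V → Set V → Set V → Prop
  | fork (f : Fin 5 ↪ V) :
      IsForkTower 0 (forkGraph.map f) (Set.range f) {f 1, f 2, f 4}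
  | addStar {j : ℕ} {L : SimpleGraph V} {W C : Set V} (h : IsForkTower j L W C)
      (t : Fin 4 ↪ V) (ht : Disjoint (Set.range t) W) (p q : V) (hp : p ∈ W) (hq : q ∈ W)
      (hpq : p ≠ q)
      (hp2 : (L.neighborSet p).ncard ≤ 2) (hpC : (L.neighborSet p).ncard = 2 → p ∉ C)
      (hq2 : (L.neighborSet q).ncard ≤ 2) (hqC : (L.neighborSet q).ncard = 2 → q ∉ C) :
      IsForkTower (j + 1) (L ⊔ starForkGraph.map t ⊔ edge (t 1) p ⊔ edge (t 2) q)
        (W ∪ Set.range t) (insert (t 3) C)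

/-- The members of the fork-collection. -/
inductive ForkType
  | dot
  | subfork
  | starFork
  | fork
  | pFork
  | bigFork (j : ℕ)

/-! Building sequences -/

/-- The graph induced by `G` on `W` is a copy of the pattern `P`, and the copy of the pattern
vertex `a` has exactly `h a` half-edges, that is, edges to `S`. -/
def IsBoldCopy {V : Type u} {k : ℕ} (G : SimpleGraph V) (S W : Set V) (P : SimpleGraph (Fin k))
    (h : Fin k → ℕ) : Prop :=
  ∃ f : Fin k ↪ V, Set.range f = W ∧ (∀ a b, G.Adj (f a) (f b) ↔ P.Adj a b) ∧
    ∀ a, degIn G S (f a) = h a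

/-- The graph induced by `G` on `W`, with its half-edges to `S`, is a bold member of the
fork-collection of the given type. For a big-fork, every vertex of the connecting set gets a
half-edge, and further edges and half-edges may be added as long as no degree exceeds three (since
all degrees are at least two before, at most one of them is added at each vertex). -/
def IsBold {V : Type u} (G : SimpleGraph V) (S W : Set V) : ForkType → Prop
  | .dot => IsBoldCopy G S W dotGraph ![2] ∨ IsBoldCopy G S W dotGraph ![3]
  | .subfork => IsBoldCopy G S W subforkGraph ![1, 1]
  | .starFork => IsBoldCopy G S W starForkGraph ![0, 1, 1, 1]
  | .fork => IsBoldCopy G S W forkGraph ![0, 1, 1, 0, 1]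
  | .pFork => IsBoldCopy G S W pForkGraph ![1, 0, 0, 1, 0, 0, 0, 1]
  | .bigFork j => 1 ≤ j ∧ ∃ (L : SimpleGraph V) (C : Set V), IsForkTower j L W C ∧
      L ≤ within G W ∧ (∀ c ∈ C, 1 ≤ degIn G S c) ∧ ∀ w ∈ W, degIn G (S ∪ W) w ≤ 3

/-- The graph induced by `G` on `S ∪ W` arises from the graph induced on `S` by addition of a bold
member of the fork-collection with vertex set `W`: the half-edges are connected to pairwise
distinct vertices that have degree two in the graph induced on `S`. -/
def IsAddition {V : Type u} (G : SimpleGraph V) (S W : Set V) (t : ForkType) : Prop :=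
  Disjoint S W ∧ IsBold G S W t ∧
    ∀ v ∈ S, (∃ w ∈ W, G.Adj v w) → degIn G S v = 2 ∧ degIn G W v = 1

/-- A building sequence `G₀, …, Gₙ = G`. An addition never changes the graph on the old vertices, so
`Gᵢ` is the subgraph of `G` induced by its vertex set `verts i`. The member of the fork-collection
added to `Gᵢ` to obtain `Gᵢ₊₁` has the type `type i` and the vertex set
`verts (i + 1) \ verts i`. -/
structure BuildingSequence {V : Type u} (G : SimpleGraph V) where
  n : ℕ
  verts : ℕ → Set V
  type : ℕ → ForkType
  start : IsTriangle G (verts 0)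
  finish : verts n = Set.univ
  mono : ∀ i < n, verts i ⊆ verts (i + 1)
  addition : ∀ i < n, IsAddition G (verts i) (verts (i + 1) \ verts i) (type i)
  fork_once : ∀ i < n, ∀ k < n, type i = .fork → type k = .fork → i = k
  twoConnected : ∀ i ≤ n, IsTwoConnected (G.induce (verts i))

/-- Whenever a bold `j`-big-fork is added to `Gᵢ`, there are at most `j + 3` vertex-disjoint paths
from its vertex set to `V(Gᵢ)` that use only edges of `E(G) \ E(Gᵢ₊₁)`. -/
def BuildingSequence.IsLeanSequence {V : Type u} {G : SimpleGraph V} (s : BuildingSequence G) : Prop :=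
  ∀ i < s.n, ∀ j, s.type i = .bigFork j → ∀ k,
    HasDisjointPaths (G.deleteEdges (within G (s.verts (i + 1))).edgeSet)
      (s.verts (i + 1) \ s.verts i) (s.verts i) k → k ≤ j + 3

/-- `H` arises from `G` by a Δ–Y transformation, and `G` from `H` by a Y–Δ transformation: `H` is
obtained by contracting a triangle of `G` to a single vertex (both graphs being cubic and simple,
each of the three edges at this vertex comes from a different vertex of the triangle). -/
def IsTriangleContraction {V W : Type u} (G : SimpleGraph V) (H : SimpleGraph W) : Prop :=
  IsCubic G ∧ IsCubic H ∧ ∃ (T : Set V) (f : V → W) (t : W), IsTriangle G T ∧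
    Function.Surjective f ∧ (∀ v, f v = t ↔ v ∈ T) ∧ Set.InjOn f Tᶜ ∧
    ∀ x y, H.Adj x y ↔ x ≠ y ∧ ∃ a b, f a = x ∧ f b = y ∧ G.Adj a b

/-- The lean fork-graphs: the cubic graphs with a lean building sequence, and all graphs obtained from
these by Y–Δ and Δ–Y transformations. -/
inductive IsLeanForkGraph : {V : Type u} → SimpleGraph V → Prop
  | build {V : Type u} [Finite V] {G : SimpleGraph V} (hG : IsCubic G) (s : BuildingSequence G)
      (hs : s.IsLeanSequence) : IsLeanForkGraph G
  | deltaY {V W : Type u} {G : SimpleGraph V} {H : SimpleGraph W} (hG : IsLeanForkGraph G)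
      (h : IsTriangleContraction G H) : IsLeanForkGraph H
  | yDelta {V W : Type u} {G : SimpleGraph V} {H : SimpleGraph W} (hG : IsLeanForkGraph G)
      (h : IsTriangleContraction H G) : IsLeanForkGraph H

end ForkGraph

/-!
A directed cycle double cover of a cubic graph is found as a colouring of its darts. If at each
vertex the colours pass from the entering darts to the leaving darts by a cyclic rotation, and the
two directions of an edge never have the same colour, then following the darts of one colour gives
directed cycles, each edge lies on two of them, and these traverse it in opposite directions
(`IsFaceColoring.hasDirectedCycleDoubleCover`). A vertex of degree three has two rotations only,
and the task is to choose one at each vertex.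

The choices are made along the building sequence, from its end. A state (`IsState`) colours the
edges outside the remaining set `S` of vertices, such that all darts leaving `S` along these edges
have distinct colours, and likewise all darts entering it. When a bold member of the fork-collection
is split off from `S`, rotations at its vertices have to be found such that the colours at the
boundary are distinct again. For this, only the pattern of agreements between outgoing and incoming
colours of the member matters.

* For the dot, subfork, star fork and p-fork there are suitable rotations for every pattern. This
  is a finite search, evaluated by the kernel (the lemmas ending in `_search`).
* The four half-edges that are left at the fork allow suitable rotations whenever some outgoing
  colour is an incoming one, except for directed 3-cycles of agreements (`fork_search`). The
  triangle offers three half-edges, no small member increases their number, and big-forks need more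
  than three, so there are at most three of them before the fork is added
  (`ncard_boundary_le_three`). The fork uses them up. As the same colours leave and enter `S`
  (`IsFaceColoring.balance`), each colour leaving the fork then returns to it, and this excludes
  3-cycles (`exists_state_of_fork`).
* A `j`-big-fork is a fork with `j` star forks on top of it, which are coloured from the top
  downwards, such that a favourable situation (`HasGoodArc` or `HasGoodPair`) is kept
  (`IsStar.exists_state`) until it serves the fork at the bottom (`IsForkTower.exists_state`).
  Without an agreement of colours or an additional edge to begin with, the trails of `j + 4` colours
  leaving the big-fork never return to it. They contain `j + 4` disjoint paths
  (`IsState.hasDisjointPaths`), and leanness forbids these (`exists_state_of_bigFork`).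

At the initial triangle, rotations exist by the balance of outgoing and incoming colours
(`exists_coloring_of_triangle`). Finally, colourings are carried over in both directions between a
cubic graph and the graph with a triangle contracted to a vertex (`IsContraction`).
-/

namespace ForkGraph

open SimpleGraph

/-! ### Pieces and their rotations -/

/-- What a port of a vertex of a piece leads to: the port `q` of the vertex `b` of the same piece,
the outside (`up x`, where `x` numbers the edges of the piece to the outside), or the part of the
graph that is still to be coloured (`down`). -/
inductive Link (k n : ℕ)
  | inner (b : Fin k) (q : Fin 3)
  | up (x : Fin n)
  | down

/-- A rotation at a cubic vertex is one of the two cyclic orders of its ports. A face that leaves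
through the port `p` has entered through the port `prevPort r p`. -/
def prevPort (r : Bool) (p : Fin 3) : Fin 3 :=
  bif r then ![1, 2, 0] p else ![2, 0, 1] p

/-- A face that enters through the port `p` leaves through the port `nextPort r p`. -/
def nextPort (r : Bool) (p : Fin 3) : Fin 3 :=
  bif r then ![2, 0, 1] p else ![1, 2, 0] p

/-- `I a p` is the colour of the dart that enters the vertex `a` through the port `p`, and `I a
(prevPort (r a) p)` the colour of the dart that leaves `a` through `p`. With the colours `x` for the
dart that leaves through `up x` and `e x` for the dart that enters through it, the colouring has to
be consistent and has to give the two darts of each edge different colours. A dart that enters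
through a `down` port has a new colour (a number that is at least `2 * n`) or the colour of a dart
that leaves through some `up x` with `okOut x`; similarly for a dart that leaves through a `down`
port, with `okIn`. The colours of the darts through the `down` ports are pairwise distinct, in
either direction. -/
def Valid {k n : ℕ} (link : Fin k → Fin 3 → Link k n) (okOut okIn : Fin n → Bool)
    (e : Fin n → ℕ) (r : Fin k → Bool) (I : Fin k → Fin 3 → ℕ) : Bool :=
  (List.finRange k).all fun a => (List.finRange 3).all fun p =>
    !(Nat.beq (I a p) (I a (prevPort (r a) p))) &&
    match link a p with
    | .inner b q => Nat.beq (I b q) (I a (prevPort (r a) p))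
    | .up x => Nat.beq (I a p) (e x) && Nat.beq (I a (prevPort (r a) p)) x
    | .down =>
      (Nat.ble (2 * n) (I a p) ||
        (List.finRange n).any fun x => okOut x && Nat.beq (I a p) x) &&
      (Nat.ble (2 * n) (I a (prevPort (r a) p)) ||
        (List.finRange n).any fun x => okIn x && Nat.beq (I a (prevPort (r a) p)) (e x)) &&
      (List.finRange k).all fun b => (List.finRange 3).all fun q =>
        match link b q with
        | .down => (Nat.beq a b && Nat.beq p q) ||
            (!(Nat.beq (I a p) (I b q)) &&
              !(Nat.beq (I a (prevPort (r a) p)) (I b (prevPort (r b) q))))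
        | _ => true

/-- Follows a face backwards from the port `p` of `a` to where it enters the piece: the colour of
the dart if it enters through an `up` port, and the port if it is a `down` port. -/
def traceBack {k n : ℕ} (link : Fin k → Fin 3 → Link k n) (e : Fin n → ℕ) (r : Fin k → Bool) :
    ℕ → Fin k → Fin 3 → Option (ℕ ⊕ (Fin k × Fin 3))
  | 0, _, _ => none
  | f + 1, a, p =>
    match link a p with
    | .up x => some (.inl (e x))
    | .down => some (.inr (a, p))
    | .inner b q => traceBack link e r f b (prevPort (r b) q)

/-- Follows a face forwards to where it leaves the piece: the colour `x` if this is through `up x`,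
and a default colour otherwise. -/
def traceFwd {k n : ℕ} (link : Fin k → Fin 3 → Link k n) (r : Fin k → Bool) (dflt : ℕ) :
    ℕ → Fin k → Fin 3 → ℕ
  | 0, _, _ => dflt
  | f + 1, a, p =>
    match link a (nextPort (r a) p) with
    | .up x => x
    | .down => dflt
    | .inner b q => traceFwd link r dflt f b q

/-- The colouring of the darts of a piece that belongs to the rotations `r`. -/
def faceColor {k n : ℕ} (link : Fin k → Fin 3 → Link k n) (e : Fin n → ℕ) (r : Fin k → Bool)
    (a : Fin k) (p : Fin 3) : ℕ :=
  match traceBack link e r (3 * k + 1) a p with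
  | none => 5 * n + 3 * k
  | some (.inl c) => c
  | some (.inr (b, q)) => traceFwd link r (2 * n + 3 * b + q) (3 * k + 1) a p

/-- The rotations of the vertices of a piece, as the binary digits of a number. -/
def bits (k N : ℕ) (a : Fin k) : Bool := N.testBit a

/-- Which outgoing colour, if any, agrees with which incoming one: `e x` is the number of the `up`
port whose outgoing dart has the colour of the dart that enters through `up x`, or `n + x`. -/
def IsPattern (n : ℕ) (e : Fin n → ℕ) : Prop :=
  Function.Injective e ∧ ∀ x, e x ≠ x ∧ (e x < n ∨ e x = n + x)

/-- The possible values of a pattern at `x`. -/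
def patternValues (n : ℕ) (x : Fin n) : List ℕ :=
  (n + x) :: (List.range n).filter (fun y => !(Nat.beq y x))

/-- Evaluates `P` at all functions with values in the given lists. -/
def allFun : (n : ℕ) → (opts : Fin n → List ℕ) → ((Fin n → ℕ) → Bool) → Bool
  | 0, _, P => P ![]
  | n + 1, opts, P => (opts 0).all fun a =>
      allFun n (fun x => opts x.succ) fun f => P (Fin.cons a f)

theorem allFun_spec : ∀ (n : ℕ) (opts : Fin n → List ℕ) (P : (Fin n → ℕ) → Bool),
    allFun n opts P = true → ∀ e, (∀ x, e x ∈ opts x) → P e = true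
  | 0, _, P, h, e, _ => by
    rw [Subsingleton.elim e ![]]
    exact h
  | n + 1, opts, P, h, e, he => by
    have h1 := List.all_eq_true.1 h (e 0) (he 0)
    have h2 := allFun_spec n _ _ h1 (fun x => e x.succ) (fun x => he x.succ)
    have h3 : (Fin.cons (e 0) fun x => e x.succ : Fin (n + 1) → ℕ) = e := Fin.cons_self_tail e
    simpa only [h3] using h2

/-- Decidable form of the injectivity of `e`. -/
def isInj (n : ℕ) (e : Fin n → ℕ) : Bool :=
  (List.finRange n).all fun x => (List.finRange n).all fun y =>
    Nat.beq x y || !(Nat.beq (e x) (e y))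

/-- For every pattern that satisfies `hyp`, one of the rotations in `L` passes `test`. -/
def search (n : ℕ) (L : List ℕ) (hyp : (Fin n → ℕ) → Bool) (test : (Fin n → ℕ) → ℕ → Bool) :
    Bool :=
  allFun n (patternValues n) fun e => !(isInj n e) || !(hyp e) || L.any (test e)

theorem exists_of_search {n : ℕ} {L : List ℕ} {hyp : (Fin n → ℕ) → Bool}
    {test : (Fin n → ℕ) → ℕ → Bool} (h : search n L hyp test = true) {e : Fin n → ℕ}
    (he : IsPattern n e) (hh : hyp e = true) : ∃ N, test e N = true := by
  have h1 := allFun_spec _ _ _ h e (fun x => by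
    rcases (he.2 x).2 with h | h
    · have := (he.2 x).1
      simp [patternValues, h, ← Bool.not_eq_true, this]
    · simp [patternValues, h])
  have h2 : isInj n e = true := by
    simp only [isInj, List.all_eq_true, Bool.or_eq_true, Bool.not_eq_true', List.mem_finRange,
      true_implies, Nat.beq_eq, ← Bool.not_eq_true]
    intro x y
    by_cases hxy : x = y
    · exact Or.inl (by rw [hxy])
    · exact Or.inr fun h => hxy (he.1 h)
  simp only [h2, hh, Bool.not_true, Bool.false_or, List.any_eq_true] at h1
  exact h1.imp fun _ h => h.2

/-! ### The members of the fork-collection -/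

/-- The dot with two half-edges. -/
def dotTwoLink : Fin 1 → Fin 3 → Link 1 1 := ![![.down, .down, .up 0]]

/-- The dot with three half-edges. -/
def dotThreeLink : Fin 1 → Fin 3 → Link 1 0 := ![![.down, .down, .down]]

/-- The triangle, without half-edges. -/
def triangleLink : Fin 3 → Fin 3 → Link 3 3 :=
  ![![.inner 1 1, .inner 2 0, .up 0], ![.inner 2 1, .inner 0 0, .up 1],
    ![.inner 0 1, .inner 1 0, .up 2]]

/-- The subfork. -/
def subforkLink : Fin 2 → Fin 3 → Link 2 2 :=
  ![![.inner 1 0, .down, .up 0], ![.inner 0 0, .down, .up 1]]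

/-- The star fork; its `up` ports have the numbers `x 0`, `x 1`, `x 2`. -/
def starLink {n : ℕ} (x : Fin 3 → Fin n) : Fin 4 → Fin 3 → Link 4 n :=
  ![![.inner 1 0, .inner 2 0, .inner 3 0], ![.inner 0 0, .down, .up (x 0)],
    ![.inner 0 1, .down, .up (x 1)], ![.inner 0 2, .down, .up (x 2)]]

/-- The fork. -/
def forkLink : Fin 5 → Fin 3 → Link 5 4 :=
  ![![.inner 1 0, .inner 2 0, .inner 3 0], ![.inner 0 0, .down, .up 0],
    ![.inner 0 1, .down, .up 1], ![.inner 0 2, .inner 4 0, .up 2], ![.inner 3 1, .down, .up 3]]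

/-- The p-fork. -/
def pForkLink : Fin 8 → Fin 3 → Link 8 3 :=
  ![![.inner 1 0, .inner 5 1, .down], ![.inner 0 0, .inner 2 0, .up 1],
    ![.inner 1 1, .inner 3 0, .inner 6 0], ![.inner 2 1, .inner 4 0, .down],
    ![.inner 3 1, .inner 5 0, .up 2], ![.inner 4 1, .inner 0 1, .inner 6 1],
    ![.inner 2 2, .inner 5 2, .inner 7 0], ![.inner 6 2, .down, .up 0]]

/-- The test that the rotations given by `N` are valid. -/
def validBits {k n : ℕ} (link : Fin k → Fin 3 → Link k n) (okOut okIn : Fin n → Bool)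
    (e : Fin n → ℕ) (N : ℕ) : Bool :=
  Valid link okOut okIn e (bits k N) (faceColor link e (bits k N))

/-- The colour that enters the piece through the port `1` of the vertex `a`. -/
def colorIn {k n : ℕ} (link : Fin k → Fin 3 → Link k n) (e : Fin n → ℕ) (N : ℕ) (a : Fin k) : ℕ :=
  faceColor link e (bits k N) a 1

/-- The colour that leaves the piece through the port `1` of the vertex `a`. -/
def colorOut {k n : ℕ} (link : Fin k → Fin 3 → Link k n) (e : Fin n → ℕ) (N : ℕ) (a : Fin k) : ℕ :=
  faceColor link e (bits k N) a (prevPort (bits k N a) 1)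

/-- Four darts with the outgoing colours `u` and the incoming colours `w` include one whose outgoing
colour is the incoming one of another of them, but no three of them form a directed 3-cycle. -/
def GoodFour (u w : Fin 4 → ℕ) : Bool :=
  ((List.finRange 4).any fun s => (List.finRange 4).any fun t => Nat.beq (u s) (w t)) &&
  (List.finRange 4).all fun s => (List.finRange 4).all fun t => !(Nat.beq (u s) (w t)) ||
    (List.finRange 4).all fun z => !(Nat.beq (u t) (w z) && Nat.beq (u z) (w s))

section Search

set_option maxRecDepth 100000

theorem dotTwo_search : search 1 [0, 1] (fun _ => true)
    (validBits dotTwoLink (fun _ => true) fun _ => true) = true := by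
  decide +kernel

theorem dotThree_search : search 0 [0, 1] (fun _ => true)
    (validBits dotThreeLink (fun _ => true) fun _ => true) = true := by
  decide +kernel

theorem triangle_search : search 3 (List.range 8)
    (fun e => (List.finRange 3).all fun x => Nat.blt (e x) 3)
    (validBits triangleLink (fun _ => true) fun _ => true) = true := by
  decide +kernel

theorem subfork_search : search 2 (List.range 4) (fun _ => true)
    (validBits subforkLink (fun _ => true) fun _ => true) = true := by
  decide +kernel

theorem starFork_search : search 3 [1, 14, 3, 8, 2] (fun _ => true)
    (validBits (starLink id) (fun _ => true) fun _ => true) = true := by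
  decide +kernel

theorem pFork_search : search 3 [193, 190, 65] (fun _ => true)
    (validBits pForkLink (fun _ => true) fun _ => true) = true := by
  decide +kernel

theorem fork_search : search 4 ([31, 9, 15, 0, 1, 30, 17, 23] ++ List.range 32)
    (fun e => GoodFour ![0, 1, 2, 3] e)
    (validBits forkLink (fun _ => true) fun _ => true) = true := by
  decide +kernel

/-- If the only agreement of colours is that of `e y` with `x`, the face of this colour can be
closed inside the fork. -/
theorem fork_closing_search : ((List.finRange 4).all fun x => (List.finRange 4).all fun y =>
    Nat.beq x y || (List.range 32).any
      (validBits forkLink (fun z => !(Nat.beq z x)) (fun z => !(Nat.beq z y))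
        fun z => if z = y then x else 4 + z)) = true := by
  decide +kernel

/-- The `up` ports `3` and `4` belong to vertices outside the star fork. If one of the five outgoing
colours is one of the five incoming ones, and not only by an arc between the first two leaves, then
the colouring extends to the star fork such that `GoodFour` holds for the other two darts and those
at the first two half-edges. -/
theorem star_arc_search : search 5 [1, 14, 2, 5, 3, 9, 15, 4]
    (fun e => ((List.finRange 5).any fun x => Nat.blt (e x) 5) &&
      !((Nat.beq (e 0) 1 || Nat.beq (e 1) 0) && (Nat.ble 5 (e 0) || Nat.ble 5 (e 1)) &&
        Nat.ble 5 (e 2) && Nat.ble 5 (e 3) && Nat.ble 5 (e 4)))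
    (fun e N => validBits (starLink ![0, 1, 2]) (fun x => Nat.blt x 3) (fun x => Nat.blt x 3) e N &&
      GoodFour
        ![colorIn (starLink ![0, 1, 2]) e N 1, colorIn (starLink ![0, 1, 2]) e N 2, 3, 4]
        ![colorOut (starLink ![0, 1, 2]) e N 1, colorOut (starLink ![0, 1, 2]) e N 2, e 3, e 4]) =
      true := by
  decide +kernel

/-- If the only agreement of colours is that of `e y` with `x`, the face of this colour can be
closed inside the star fork. Then a face leads from one of the first two half-edges to the other
one, but not vice versa, or no face joins these two and one of them has a new colour. -/
theorem star_closing_search : ((List.finRange 3).all fun x => (List.finRange 3).all fun y =>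
    Nat.beq x y || (List.range 16).any fun N =>
      let e : Fin 3 → ℕ := fun z => if z = y then x else 3 + z
      let ip := colorIn (starLink id) e N 1
      let iq := colorIn (starLink id) e N 2
      let op := colorOut (starLink id) e N 1
      let oq := colorOut (starLink id) e N 2
      validBits (starLink id) (fun z => !(Nat.beq z x)) (fun z => !(Nat.beq z y)) e N &&
      ((Nat.beq ip oq && !(Nat.beq iq op)) || (Nat.beq iq op && !(Nat.beq ip oq)) ||
        (!(Nat.beq ip oq) && !(Nat.beq iq op) &&
          (Nat.ble 6 ip || Nat.ble 6 iq || Nat.ble 6 op || Nat.ble 6 oq)))) = true := by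
  decide +kernel

/-- Without any agreement of colours, any prescribed outgoing or incoming colour of the star fork
can be passed on to one of the first two half-edges. -/
theorem star_pass_search : ((List.finRange 3).all fun x =>
    ((List.range 16).any fun N =>
      let e : Fin 3 → ℕ := fun z => 3 + z
      let ip := colorIn (starLink id) e N 1
      let iq := colorIn (starLink id) e N 2
      let op := colorOut (starLink id) e N 1
      let oq := colorOut (starLink id) e N 2
      validBits (starLink id) (fun _ => true) (fun _ => true) e N &&
        !(Nat.beq ip oq) && !(Nat.beq iq op) && (Nat.beq ip x || Nat.beq iq x)) &&
    ((List.range 16).any fun N =>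
      let e : Fin 3 → ℕ := fun z => 3 + z
      let ip := colorIn (starLink id) e N 1
      let iq := colorIn (starLink id) e N 2
      let op := colorOut (starLink id) e N 1
      let oq := colorOut (starLink id) e N 2
      validBits (starLink id) (fun _ => true) (fun _ => true) e N &&
        !(Nat.beq ip oq) && !(Nat.beq iq op) && (Nat.beq op (3 + x) || Nat.beq oq (3 + x)))) =
    true := by
  decide +kernel

end Search

/-! ### Colourings of the darts -/

/-- `v` has exactly three neighbours, and in one of their two cyclic orders the colour `c a v` of
each dart that enters `v` continues on the dart that leaves `v` to the next neighbour. -/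
def IsRotation {V : Type u} (G : SimpleGraph V) (c : V → V → ℕ) (v : V) : Prop :=
  ∃ a b d, a ≠ b ∧ b ≠ d ∧ a ≠ d ∧ (∀ w, G.Adj v w ↔ w = a ∨ w = b ∨ w = d) ∧
    c a v = c v b ∧ c b v = c v d ∧ c d v = c v a

/-- `c u v` is the colour of the dart from `u` to `v`. The coloured edges are those of `O`, among
them all edges of `G` at vertices outside `S`. No edge has the same colour in both directions, and
the colours are passed on by a rotation at each vertex outside `S`. -/
structure IsFaceColoring {V : Type u} (G O : SimpleGraph V) (S : Set V) (c : V → V → ℕ) :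
    Prop where
  adj : ∀ v ∉ S, ∀ w, G.Adj v w → O.Adj v w
  ne : ∀ v w, O.Adj v w → c v w ≠ c w v
  rot : ∀ v ∉ S, IsRotation G c v

/-- The darts that leave `S` along coloured edges have different colours, and so do the darts that
arrive in `S`. So every colour of such a dart is that of a single trail from `S` to `S`. -/
structure IsState {V : Type u} (G O : SimpleGraph V) (S : Set V) (c : V → V → ℕ) : Prop
    extends IsFaceColoring G O S c where
  out_inj : ∀ v ∈ S, ∀ v' ∈ S, ∀ w w', O.Adj v w → O.Adj v' w' → c v w = c v' w' → v = v' ∧ w = w'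
  in_inj : ∀ v ∈ S, ∀ v' ∈ S, ∀ w w', O.Adj v w → O.Adj v' w' → c w v = c w' v' → v = v' ∧ w = w'

/-- The graph of coloured edges when the edges at the vertices in `N` are added. -/
def expose {V : Type u} (G O : SimpleGraph V) (N : Set V) : SimpleGraph V where
  Adj v w := O.Adj v w ∨ G.Adj v w ∧ (v ∈ N ∨ w ∈ N)
  symm := ⟨fun _ _ h => h.imp (fun h => h.symm) fun h => ⟨h.1.symm, h.2.symm⟩⟩
  loopless := ⟨fun _ h => h.elim (fun h => h.ne rfl) fun h => h.1.ne rfl⟩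

/-- The vertices `f a` in `S` form a piece of the shape `link`, where `nb a p` is the neighbour of
`f a` behind the port `p`. The coloured edges at these vertices are those at `up` ports, and `down`
ports lead to other vertices in `S`. -/
structure IsPiece {V : Type u} {k n : ℕ} (G O : SimpleGraph V) (S : Set V) (f : Fin k → V)
    (nb : Fin k → Fin 3 → V) (link : Fin k → Fin 3 → Link k n) : Prop where
  inj : Function.Injective f
  mem : ∀ a, f a ∈ S
  adj : ∀ a w, G.Adj (f a) w ↔ ∃ p, w = nb a p
  nb_inj : ∀ a, Function.Injective (nb a)
  inner : ∀ a p b q, link a p = .inner b q →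
    nb a p = f b ∧ link b q = .inner a p ∧ ¬ O.Adj (f a) (nb a p)
  up : ∀ a p x, link a p = .up x → O.Adj (f a) (nb a p)
  down : ∀ a p, link a p = .down →
    nb a p ∈ S ∧ nb a p ∉ Set.range f ∧ ¬ O.Adj (f a) (nb a p)

section Extend

variable {V : Type u} {k n : ℕ} {G O : SimpleGraph V} {S : Set V} {f : Fin k → V}
  {nb : Fin k → Fin 3 → V} {link : Fin k → Fin 3 → Link k n}

theorem IsPiece.nb_inner (h : IsPiece G O S f nb link) {a p b q} (hl : link a p = .inner b q) :
    nb a p = f b ∧ nb b q = f a :=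
  ⟨(h.inner a p b q hl).1, (h.inner b q a p (h.inner a p b q hl).2.1).1⟩

theorem IsPiece.expose_adj (h : IsPiece G O S f nb link) {v w : V} (hv : v ∈ S \ Set.range f)
    (hvw : (expose G O (Set.range f)).Adj v w) :
    O.Adj v w ∨ ∃ a p, link a p = .down ∧ v = nb a p ∧ w = f a := by
  rcases hvw with hvw | ⟨hvw, hN | ⟨a, rfl⟩⟩
  · exact Or.inl hvw
  · exact absurd hN hv.2
  · obtain ⟨p, rfl⟩ := (h.adj a v).1 hvw.symm
    rcases hl : link a p with ⟨b, q⟩ | x | _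
    · exact absurd ⟨b, (h.inner a p b q hl).1.symm⟩ hv.2
    · exact Or.inl (h.up a p x hl).symm
    · exact Or.inr ⟨a, p, hl, rfl, rfl⟩

theorem IsPiece.boundary_inj (h : IsPiece G O S f nb link) {c c' : V → V → ℕ}
    {J : Fin k → Fin 3 → ℕ} (h1 : ∀ v w, O.Adj v w → c' v w = c v w)
    (h2 : ∀ a p, c' (nb a p) (f a) = J a p)
    (hd : ∀ a p, link a p = .down → ∀ v ∈ S \ Set.range f, ∀ w, O.Adj v w → c v w ≠ J a p)
    (hdd : ∀ a p b q, link a p = .down → link b q = .down → J a p = J b q → a = b ∧ p = q)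
    (hr : ∀ v ∈ S \ Set.range f, ∀ v' ∈ S \ Set.range f, ∀ w w', O.Adj v w → O.Adj v' w' →
      c v w = c v' w' → v = v' ∧ w = w') :
    ∀ v ∈ S \ Set.range f, ∀ v' ∈ S \ Set.range f, ∀ w w',
      (expose G O (Set.range f)).Adj v w → (expose G O (Set.range f)).Adj v' w' →
      c' v w = c' v' w' → v = v' ∧ w = w' := by
  intro v hv v' hv' w w' hvw hvw' hc
  rcases h.expose_adj hv hvw with hvw | ⟨a, p, hl, rfl, rfl⟩ <;>
    rcases h.expose_adj hv' hvw' with hvw' | ⟨b, q, hl', rfl, rfl⟩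
  · rw [h1 _ _ hvw, h1 _ _ hvw'] at hc
    exact hr v hv v' hv' w w' hvw hvw' hc
  · rw [h1 _ _ hvw, h2] at hc
    exact absurd hc (hd b q hl' v hv w hvw)
  · rw [h1 _ _ hvw', h2] at hc
    exact absurd hc.symm (hd a p hl v' hv' w' hvw')
  · rw [h2, h2] at hc
    obtain ⟨rfl, rfl⟩ := hdd a p b q hl hl' hc
    exact ⟨rfl, rfl⟩

open Classical in
/-- The colouring that is `I a p` on the dart that enters `f a` through the port `p`, `J a p` on the
reverse dart, and `c` elsewhere. -/
noncomputable def recolor (f : Fin k → V) (nb : Fin k → Fin 3 → V) (I J : Fin k → Fin 3 → ℕ)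
    (c : V → V → ℕ) (v w : V) : ℕ :=
  if h : ∃ ap : Fin k × Fin 3, v = f ap.1 ∧ w = nb ap.1 ap.2 then J h.choose.1 h.choose.2
  else if h : ∃ ap : Fin k × Fin 3, w = f ap.1 ∧ v = nb ap.1 ap.2 then I h.choose.1 h.choose.2
  else c v w

theorem IsPiece.recolor_out (h : IsPiece G O S f nb link) (I J : Fin k → Fin 3 → ℕ)
    (c : V → V → ℕ) (a : Fin k) (p : Fin 3) : recolor f nb I J c (f a) (nb a p) = J a p := by
  have hex : ∃ ap : Fin k × Fin 3, f a = f ap.1 ∧ nb a p = nb ap.1 ap.2 := ⟨(a, p), rfl, rfl⟩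
  rw [recolor, dif_pos hex]
  obtain ⟨h1, h2⟩ := hex.choose_spec
  generalize hex.choose = y at h1 h2
  have h3 := h.inj h1
  subst h3
  rw [h.nb_inj _ h2]

theorem IsPiece.recolor_in (h : IsPiece G O S f nb link) {I J : Fin k → Fin 3 → ℕ}
    {c : V → V → ℕ}
    (hi : ∀ a p b q, link a p = .inner b q → I b q = J a p)
    (hu : ∀ a p x, link a p = .up x → I a p = c (nb a p) (f a) ∧ J a p = c (f a) (nb a p))
    (a : Fin k) (p : Fin 3) : recolor f nb I J c (nb a p) (f a) = I a p := by
  by_cases hex : ∃ ap : Fin k × Fin 3, nb a p = f ap.1 ∧ f a = nb ap.1 ap.2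
  · obtain ⟨⟨b, q⟩, h1, h2⟩ := hex
    simp only at h1 h2
    have h3 := h.recolor_out I J c b q
    rw [← h1, ← h2] at h3
    rw [h3]
    rcases hl : link b q with ⟨a', p'⟩ | x | _
    · have h4 := h.nb_inner hl
      have h5 : a = a' := h.inj (h2.trans h4.1)
      subst h5
      have h6 : p = p' := h.nb_inj _ (h1.trans h4.2.symm)
      subst h6
      exact (hi _ _ _ _ hl).symm
    · rcases hl' : link a p with ⟨b', q'⟩ | y | _
      · have h4 := h.nb_inner hl'
        have h5 : b = b' := h.inj (h1.symm.trans h4.1)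
        subst h5
        have h6 : q = q' := h.nb_inj _ (h2.symm.trans h4.2.symm)
        subst h6
        rw [(h.inner _ _ _ _ hl').2.1] at hl
        cases hl
      · rw [(hu _ _ _ hl).2, (hu _ _ _ hl').1, ← h1, ← h2]
      · exact absurd ⟨b, h1.symm⟩ (h.down _ _ hl').2.1
    · exact absurd ⟨a, h2⟩ (h.down _ _ hl).2.1
  · have hex' : ∃ ap : Fin k × Fin 3, f a = f ap.1 ∧ nb a p = nb ap.1 ap.2 := ⟨(a, p), rfl, rfl⟩
    rw [recolor, dif_neg hex, dif_pos hex']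
    obtain ⟨h1, h2⟩ := hex'.choose_spec
    generalize hex'.choose = y at h1 h2
    have h3 := h.inj h1
    subst h3
    rw [h.nb_inj _ h2]

theorem IsPiece.recolor_old (h : IsPiece G O S f nb link) {I J : Fin k → Fin 3 → ℕ}
    {c : V → V → ℕ}
    (hi : ∀ a p b q, link a p = .inner b q → I b q = J a p)
    (hu : ∀ a p x, link a p = .up x → I a p = c (nb a p) (f a) ∧ J a p = c (f a) (nb a p))
    {v w : V} (hvw : O.Adj v w) : recolor f nb I J c v w = c v w := by
  by_cases hex : ∃ ap : Fin k × Fin 3, v = f ap.1 ∧ w = nb ap.1 ap.2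
  · obtain ⟨⟨a, p⟩, rfl, rfl⟩ := hex
    rw [h.recolor_out]
    rcases hl : link a p with ⟨b, q⟩ | x | _
    · exact absurd hvw (h.inner _ _ _ _ hl).2.2
    · exact (hu _ _ _ hl).2
    · exact absurd hvw (h.down _ _ hl).2.2
  · by_cases hex' : ∃ ap : Fin k × Fin 3, w = f ap.1 ∧ v = nb ap.1 ap.2
    · obtain ⟨⟨a, p⟩, rfl, rfl⟩ := hex'
      rw [h.recolor_in hi hu]
      rcases hl : link a p with ⟨b, q⟩ | x | _
      · exact absurd hvw.symm (h.inner _ _ _ _ hl).2.2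
      · exact (hu _ _ _ hl).1
      · exact absurd hvw.symm (h.down _ _ hl).2.2
    · rw [recolor, dif_neg hex, dif_neg hex']

theorem IsPiece.isRotation (h : IsPiece G O S f nb link) {I : Fin k → Fin 3 → ℕ}
    {c : V → V → ℕ} (r : Fin k → Bool) (a : Fin k)
    (h1 : ∀ p, c (nb a p) (f a) = I a p)
    (h2 : ∀ p, c (f a) (nb a p) = I a (prevPort (r a) p)) : IsRotation G c (f a) := by
  have hne : ∀ p q, p ≠ q → nb a p ≠ nb a q := fun p q hpq h' => hpq (h.nb_inj a h')
  have hadj : ∀ w, G.Adj (f a) w ↔ w = nb a 0 ∨ w = nb a 1 ∨ w = nb a 2 := by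
    intro w
    rw [h.adj]
    constructor
    · rintro ⟨p, rfl⟩
      fin_cases p <;> simp
    · rintro (rfl | rfl | rfl) <;> exact ⟨_, rfl⟩
  cases hr : r a
  · refine ⟨nb a 0, nb a 1, nb a 2, hne _ _ (by decide), hne _ _ (by decide), hne _ _ (by decide),
      hadj, ?_, ?_, ?_⟩ <;> rw [h1, h2, hr] <;> rfl
  · refine ⟨nb a 0, nb a 2, nb a 1, hne _ _ (by decide), hne _ _ (by decide), hne _ _ (by decide),
      fun w => (hadj w).trans (by tauto), ?_, ?_, ?_⟩ <;> rw [h1, h2, hr] <;> rfl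

/-- A colouring of the darts of a piece extends a face colouring. -/
theorem IsPiece.extend (h : IsPiece G O S f nb link) {c : V → V → ℕ}
    (hc : IsFaceColoring G O S c) {I : Fin k → Fin 3 → ℕ} (r : Fin k → Bool)
    (hne : ∀ a p, I a p ≠ I a (prevPort (r a) p))
    (hi : ∀ a p b q, link a p = .inner b q → I b q = I a (prevPort (r a) p))
    (hu : ∀ a p x, link a p = .up x →
      I a p = c (nb a p) (f a) ∧ I a (prevPort (r a) p) = c (f a) (nb a p))
    (hout : ∀ a p, link a p = .down → ∀ v ∈ S \ Set.range f, ∀ w, O.Adj v w → c v w ≠ I a p)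
    (hin : ∀ a p, link a p = .down → ∀ v ∈ S \ Set.range f, ∀ w, O.Adj v w →
      c w v ≠ I a (prevPort (r a) p))
    (hdo : ∀ a p b q, link a p = .down → link b q = .down → I a p = I b q → a = b ∧ p = q)
    (hdi : ∀ a p b q, link a p = .down → link b q = .down →
      I a (prevPort (r a) p) = I b (prevPort (r b) q) → a = b ∧ p = q)
    (hro : ∀ v ∈ S \ Set.range f, ∀ v' ∈ S \ Set.range f, ∀ w w', O.Adj v w → O.Adj v' w' →
      c v w = c v' w' → v = v' ∧ w = w')
    (hri : ∀ v ∈ S \ Set.range f, ∀ v' ∈ S \ Set.range f, ∀ w w', O.Adj v w → O.Adj v' w' →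
      c w v = c w' v' → v = v' ∧ w = w') :
    ∃ c', IsState G (expose G O (Set.range f)) (S \ Set.range f) c' ∧
      (∀ v w, O.Adj v w → c' v w = c v w) ∧
      ∀ a p, c' (nb a p) (f a) = I a p ∧ c' (f a) (nb a p) = I a (prevPort (r a) p) := by
  have h1 := fun v w => h.recolor_old (v := v) (w := w) hi hu
  have h2 := h.recolor_in hi hu
  have h3 := h.recolor_out I (fun a p => I a (prevPort (r a) p)) c
  refine ⟨_, ⟨⟨?_, ?_, ?_⟩, ?_, ?_⟩, h1, fun a p => ⟨h2 a p, h3 a p⟩⟩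
  · intro v hv w hvw
    by_cases hN : v ∈ Set.range f
    · exact Or.inr ⟨hvw, Or.inl hN⟩
    · exact Or.inl (hc.adj v (fun hS => hv ⟨hS, hN⟩) w hvw)
  · intro v w hvw
    have key : ∀ a w, G.Adj (f a) w →
        recolor f nb I (fun a p => I a (prevPort (r a) p)) c (f a) w ≠
          recolor f nb I (fun a p => I a (prevPort (r a) p)) c w (f a) := by
      intro a w haw
      obtain ⟨p, rfl⟩ := (h.adj a w).1 haw
      rw [h2, h3]
      exact (hne a p).symm
    rcases hvw with hvw | ⟨hvw, ⟨a, rfl⟩ | ⟨a, rfl⟩⟩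
    · rw [h1 _ _ hvw, h1 _ _ hvw.symm]
      exact hc.ne v w hvw
    · exact key a w hvw
    · exact (key a v hvw.symm).symm
  · intro v hv
    by_cases hN : v ∈ Set.range f
    · obtain ⟨a, rfl⟩ := hN
      exact h.isRotation r a (fun p => h2 a p) (fun p => h3 a p)
    · have hS : v ∉ S := fun hS => hv ⟨hS, hN⟩
      obtain ⟨a, b, d, hab, hbd, had, hadj, e1, e2, e3⟩ := hc.rot v hS
      have ha := hc.adj v hS a ((hadj a).2 (by simp))
      have hb := hc.adj v hS b ((hadj b).2 (by simp))
      have hd := hc.adj v hS d ((hadj d).2 (by simp))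
      exact ⟨a, b, d, hab, hbd, had, hadj, by rw [h1 _ _ ha.symm, h1 _ _ hb, e1],
        by rw [h1 _ _ hb.symm, h1 _ _ hd, e2], by rw [h1 _ _ hd.symm, h1 _ _ ha, e3]⟩
  · exact h.boundary_inj h1 h2 hout hdo hro
  · exact h.boundary_inj (c := fun v w => c w v)
      (c' := fun v w => recolor f nb I (fun a p => I a (prevPort (r a) p)) c w v)
      (fun v w hvw => h1 w v hvw.symm) h3 hin hdi hri

end Extend

/-! ### From patterns to colours -/

open Classical in
/-- The pattern of the outgoing colours `o` and the incoming colours `i`. -/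
noncomputable def patternOf {n : ℕ} (o i : Fin n → ℕ) (x : Fin n) : ℕ :=
  if h : ∃ y, o y = i x then (h.choose : ℕ) else n + x

theorem patternOf_eq {n : ℕ} {o i : Fin n → ℕ} (ho : Function.Injective o) {x y : Fin n}
    (h : o y = i x) : patternOf o i x = y := by
  have hex : ∃ y, o y = i x := ⟨y, h⟩
  rw [patternOf, dif_pos hex, ho (hex.choose_spec.trans h.symm)]

theorem patternOf_eq_add {n : ℕ} {o i : Fin n → ℕ} {x : Fin n} (h : ∀ y, o y ≠ i x) :
    patternOf o i x = n + x := by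
  rw [patternOf, dif_neg (by simpa using h)]

theorem patternOf_lt_iff {n : ℕ} {o i : Fin n → ℕ} (ho : Function.Injective o) {x : Fin n} :
    patternOf o i x < n ↔ ∃ y, o y = i x := by
  constructor
  · intro h
    by_contra hex
    rw [patternOf_eq_add (by simpa using hex)] at h
    omega
  · rintro ⟨y, hy⟩
    rw [patternOf_eq ho hy]
    exact y.2

theorem eq_of_patternOf_eq {n : ℕ} {o i : Fin n → ℕ} (ho : Function.Injective o) {x y : Fin n}
    (h : patternOf o i x = y) : o y = i x := by
  obtain ⟨z, hz⟩ := (patternOf_lt_iff ho (i := i) (x := x)).1 (by rw [h]; exact y.2)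
  rw [patternOf_eq ho hz] at h
  rw [← Fin.ext h, hz]

theorem isPattern_patternOf {n : ℕ} {o i : Fin n → ℕ} (ho : Function.Injective o)
    (hi : Function.Injective i) (hoi : ∀ x, o x ≠ i x) : IsPattern n (patternOf o i) := by
  constructor
  · intro x y hxy
    by_cases hx : ∃ z, o z = i x
    · obtain ⟨z, hz⟩ := hx
      rw [patternOf_eq ho hz] at hxy
      exact hi (hz.symm.trans (eq_of_patternOf_eq ho hxy.symm))
    · by_cases hy : ∃ z, o z = i y
      · obtain ⟨z, hz⟩ := hy
        rw [patternOf_eq ho hz] at hxy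
        exact absurd ⟨z, eq_of_patternOf_eq ho hxy⟩ hx
      · rw [patternOf_eq_add (by simpa using hx), patternOf_eq_add (by simpa using hy)] at hxy
        exact Fin.ext (by omega)
  · intro x
    refine ⟨fun h => hoi x (eq_of_patternOf_eq ho h), ?_⟩
    by_cases hx : ∃ z, o z = i x
    · exact Or.inl ((patternOf_lt_iff ho).2 hx)
    · exact Or.inr (patternOf_eq_add (by simpa using hx))

open Classical in
/-- The colour with a given number: `o x` for `x`, and `i x` for the value of the pattern at `x`.
All other numbers stand for new colours above `M`. -/
noncomputable def colorOf {n : ℕ} (o i : Fin n → ℕ) (M N : ℕ) : ℕ :=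
  if h : N < n then o ⟨N, h⟩
  else if h : ∃ x, patternOf o i x = N then i h.choose
  else M + 1 + N

theorem colorOf_out {n : ℕ} (o i : Fin n → ℕ) (M : ℕ) (x : Fin n) : colorOf o i M x = o x := by
  simp [colorOf]

theorem colorOf_in {n : ℕ} {o i : Fin n → ℕ} (ho : Function.Injective o)
    (hi : Function.Injective i) (hoi : ∀ x, o x ≠ i x) (M : ℕ) (x : Fin n) :
    colorOf o i M (patternOf o i x) = i x := by
  by_cases hx : patternOf o i x < n
  · obtain ⟨y, hy⟩ := (patternOf_lt_iff ho).1 hx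
    rw [patternOf_eq ho hy, colorOf_out, hy]
  · have hex : ∃ y, patternOf o i y = patternOf o i x := ⟨x, rfl⟩
    rw [colorOf, dif_neg hx, dif_pos hex]
    exact congrArg i ((isPattern_patternOf ho hi hoi).1 hex.choose_spec)

theorem colorOf_cases {n : ℕ} (o i : Fin n → ℕ) (M N : ℕ) :
    (∃ x, colorOf o i M N = o x) ∨ (∃ x, colorOf o i M N = i x) ∨ M < colorOf o i M N := by
  unfold colorOf
  split_ifs with h1 h2
  · exact Or.inl ⟨_, rfl⟩
  · exact Or.inr (Or.inl ⟨_, rfl⟩)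
  · exact Or.inr (Or.inr (by omega))

theorem lt_colorOf {n : ℕ} {o i : Fin n → ℕ} (ho : Function.Injective o)
    (hi : Function.Injective i) (hoi : ∀ x, o x ≠ i x) (M : ℕ) {N : ℕ} (hN : 2 * n ≤ N) :
    M < colorOf o i M N := by
  have h1 : ¬ N < n ∧ ¬ ∃ x, patternOf o i x = N := by
    refine ⟨by omega, ?_⟩
    rintro ⟨x, hx⟩
    have := ((isPattern_patternOf ho hi hoi).2 x).2
    omega
  rw [colorOf, dif_neg h1.1, dif_neg h1.2]
  omega

theorem colorOf_injective {n : ℕ} {o i : Fin n → ℕ} (ho : Function.Injective o)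
    (hi : Function.Injective i) {M : ℕ} (hMo : ∀ x, o x ≤ M)
    (hMi : ∀ x, i x ≤ M) : Function.Injective (colorOf o i M) := by
  have key : ∀ N, (∃ h : N < n, colorOf o i M N = o ⟨N, h⟩) ∨
      (¬ N < n ∧ ∃ x, patternOf o i x = N ∧ colorOf o i M N = i x) ∨
      colorOf o i M N = M + 1 + N := by
    intro N
    unfold colorOf
    split_ifs with h1 h2
    · exact Or.inl ⟨h1, rfl⟩
    · exact Or.inr (Or.inl ⟨h1, _, h2.choose_spec, rfl⟩)
    · exact Or.inr (Or.inr rfl)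
  intro N N' h
  rcases key N with ⟨h1, e1⟩ | ⟨h1, x, h2, e1⟩ | e1 <;>
    rcases key N' with ⟨h1', e1'⟩ | ⟨h1', x', h2', e1'⟩ | e1' <;> rw [e1, e1'] at h
  · simpa using ho h
  · exact absurd (h2' ▸ (patternOf_lt_iff ho).2 ⟨_, h⟩) h1'
  · have := hMo ⟨N, h1⟩
    omega
  · exact absurd (h2 ▸ (patternOf_lt_iff ho).2 ⟨_, h.symm⟩) h1
  · rw [← h2, ← h2', hi h]
  · have := hMi x
    omega
  · have := hMo ⟨N', h1'⟩
    omega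
  · have := hMi x'
    omega
  · omega

/-- What `Valid` says. -/
theorem valid_spec {k n : ℕ} {link : Fin k → Fin 3 → Link k n} {okOut okIn : Fin n → Bool}
    {e : Fin n → ℕ} {r : Fin k → Bool} {I : Fin k → Fin 3 → ℕ}
    (h : Valid link okOut okIn e r I = true) :
    (∀ a p, I a p ≠ I a (prevPort (r a) p)) ∧
    (∀ a p b q, link a p = .inner b q → I b q = I a (prevPort (r a) p)) ∧
    (∀ a p x, link a p = .up x → I a p = e x ∧ I a (prevPort (r a) p) = x) ∧
    (∀ a p, link a p = .down →
      (2 * n ≤ I a p ∨ ∃ x, okOut x = true ∧ I a p = x) ∧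
      (2 * n ≤ I a (prevPort (r a) p) ∨ ∃ x, okIn x = true ∧ I a (prevPort (r a) p) = e x)) ∧
    (∀ a p b q, link a p = .down → link b q = .down → ¬ (a = b ∧ p = q) →
      I a p ≠ I b q ∧ I a (prevPort (r a) p) ≠ I b (prevPort (r b) q)) := by
  simp only [Valid, List.all_eq_true, List.mem_finRange, true_implies, Bool.and_eq_true,
    Bool.not_eq_true', ← Bool.not_eq_true, Nat.beq_eq] at h
  refine ⟨fun a p => (h a p).1, fun a p b q hl => ?_, fun a p x hl => ?_, fun a p hl => ?_,
    fun a p b q hl hl' hne => ?_⟩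
  · have := (h a p).2
    simpa [hl, Nat.beq_eq] using this
  · have := (h a p).2
    simpa [hl, Nat.beq_eq] using this
  · have := (h a p).2
    simp only [hl, Bool.and_eq_true, Bool.or_eq_true, List.any_eq_true, List.mem_finRange,
      true_and, Nat.ble_eq, Nat.beq_eq] at this
    exact this.1
  · have := (h a p).2
    simp only [hl, Bool.and_eq_true, List.all_eq_true, List.mem_finRange, true_implies] at this
    have := this.2 b q
    simp only [hl', Bool.or_eq_true, Bool.and_eq_true, Nat.beq_eq, Bool.not_eq_true',
      ← Bool.not_eq_true] at this
    rcases this with h1 | h1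
    · exact absurd ⟨Fin.ext h1.1, Fin.ext h1.2⟩ hne
    · exact h1

/-- A colouring of a piece by numbers becomes a colouring by the given outgoing colours `o`, the
given incoming colours `i`, and new colours. -/
theorem IsPiece.extend_of_valid {V : Type u} [Finite V] {k n : ℕ} {G O : SimpleGraph V} {S : Set V}
    {f : Fin k → V} {nb : Fin k → Fin 3 → V} {link : Fin k → Fin 3 → Link k n}
    (h : IsPiece G O S f nb link) {c : V → V → ℕ} (hc : IsFaceColoring G O S c)
    {o i : Fin n → ℕ} (ho : Function.Injective o) (hi : Function.Injective i)
    (hoi : ∀ x, o x ≠ i x)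
    (hup : ∀ a p x, link a p = .up x → c (f a) (nb a p) = o x ∧ c (nb a p) (f a) = i x)
    {okOut okIn : Fin n → Bool}
    (hokOut : ∀ x, okOut x = true → ∀ v ∈ S \ Set.range f, ∀ w, O.Adj v w → c v w ≠ o x)
    (hokIn : ∀ x, okIn x = true → ∀ v ∈ S \ Set.range f, ∀ w, O.Adj v w → c w v ≠ i x)
    (hro : ∀ v ∈ S \ Set.range f, ∀ v' ∈ S \ Set.range f, ∀ w w', O.Adj v w → O.Adj v' w' →
      c v w = c v' w' → v = v' ∧ w = w')
    (hri : ∀ v ∈ S \ Set.range f, ∀ v' ∈ S \ Set.range f, ∀ w w', O.Adj v w → O.Adj v' w' →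
      c w v = c w' v' → v = v' ∧ w = w')
    {r : Fin k → Bool} {I : Fin k → Fin 3 → ℕ}
    (hI : Valid link okOut okIn (patternOf o i) r I = true) :
    ∃ c' M, IsState G (expose G O (Set.range f)) (S \ Set.range f) c' ∧
      (∀ v w, O.Adj v w → c' v w = c v w) ∧
      (∀ a p, c' (nb a p) (f a) = colorOf o i M (I a p) ∧
        c' (f a) (nb a p) = colorOf o i M (I a (prevPort (r a) p))) ∧
      (∀ v w, c v w ≤ M) ∧ (∀ x, o x ≤ M) ∧ ∀ x, i x ≤ M := by
  obtain ⟨M, hM⟩ : ∃ M, (∀ v w, c v w ≤ M) ∧ (∀ x, o x ≤ M) ∧ ∀ x, i x ≤ M := by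
    obtain ⟨M1, h1⟩ := (Set.finite_range fun vw : V × V => c vw.1 vw.2).bddAbove
    obtain ⟨M2, h2⟩ := (Set.finite_range o).bddAbove
    obtain ⟨M3, h3⟩ := (Set.finite_range i).bddAbove
    refine ⟨M1 + M2 + M3, fun v w => ?_, fun x => ?_, fun x => ?_⟩
    · have := h1 ⟨(v, w), rfl⟩
      simp only at this
      omega
    · have := h2 ⟨x, rfl⟩
      omega
    · have := h3 ⟨x, rfl⟩
      omega
  have hinj := colorOf_injective ho hi hM.2.1 hM.2.2
  obtain ⟨s1, s2, s3, s4, s5⟩ := valid_spec hI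
  obtain ⟨c', h1, h2, h3⟩ := h.extend hc (I := fun a p => colorOf o i M (I a p)) r
    (fun a p h => s1 a p (hinj h))
    (fun a p b q hl => by simp only [s2 a p b q hl])
    (fun a p x hl => by
      rw [(s3 a p x hl).1, (s3 a p x hl).2, colorOf_in ho hi hoi, colorOf_out, (hup a p x hl).1,
        (hup a p x hl).2]
      exact ⟨rfl, rfl⟩)
    (fun a p hl v hv w hvw heq => by
      rcases (s4 a p hl).1 with hN | ⟨x, hx, hN⟩
      · have := lt_colorOf ho hi hoi M hN
        have := hM.1 v w
        omega
      · rw [hN, colorOf_out] at heq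
        exact hokOut x hx v hv w hvw heq)
    (fun a p hl v hv w hvw heq => by
      rcases (s4 a p hl).2 with hN | ⟨x, hx, hN⟩
      · have := lt_colorOf ho hi hoi M hN
        have := hM.1 w v
        omega
      · rw [hN, colorOf_in ho hi hoi] at heq
        exact hokIn x hx v hv w hvw heq)
    (fun a p b q hl hl' heq => by
      by_contra hne
      exact (s5 a p b q hl hl' hne).1 (hinj heq))
    (fun a p b q hl hl' heq => by
      by_contra hne
      exact (s5 a p b q hl hl' hne).2 (hinj heq))
    hro hri
  exact ⟨c', M, h1, h2, h3, hM⟩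

/-- A vertex of degree three has its neighbours distributed over three ports, where the places of
some of them can be prescribed. -/
theorem exists_ports {V : Type u} {G : SimpleGraph V} {v : V} (hv : (G.neighborSet v).ncard = 3)
    (s : Set (Fin 3)) (g : Fin 3 → V) (hg : ∀ p ∈ s, G.Adj v (g p)) (hinj : Set.InjOn g s) :
    ∃ nb : Fin 3 → V, Function.Injective nb ∧ (∀ w, G.Adj v w ↔ ∃ p, w = nb p) ∧
      ∀ p ∈ s, nb p = g p := by
  classical
  have hfin : (G.neighborSet v).Finite := Set.finite_of_ncard_pos (by omega)
  have hcard : Fintype.card (Fin 3) = hfin.toFinset.card := by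
    rw [← Set.ncard_eq_toFinset_card _ hfin, hv, Fintype.card_fin]
  obtain ⟨e, he⟩ := Set.MapsTo.exists_equiv_extend_of_card_eq hcard
    (s := s) (f := g) (fun p hp => by simpa using hg p hp) hinj
  refine ⟨fun p => e p, fun p q h => e.injective (Subtype.ext h), fun w => ⟨fun hw => ?_, ?_⟩, he⟩
  · have hw' : w ∈ hfin.toFinset := by simpa using hw
    exact ⟨e.symm ⟨w, hw'⟩, by simp⟩
  · rintro ⟨p, rfl⟩
    exact (Set.Finite.mem_toFinset hfin).1 (e p).2

/-- The ports of the vertices `f a` can be arranged as `link` says, if the uncoloured edges at these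
vertices are those between them as in `link` and those to the vertices `d a p`. -/
theorem exists_isPiece {V : Type u} {k n : ℕ} {G O : SimpleGraph V} (hG : IsCubic G) {S : Set V}
    {f : Fin k → V} {link : Fin k → Fin 3 → Link k n} (d : Fin k → Fin 3 → V)
    (hf : Function.Injective f) (hmem : ∀ a, f a ∈ S)
    (hsymm : ∀ a p b q, link a p = .inner b q → link b q = .inner a p)
    (hinj : ∀ a p p' b q q', link a p = .inner b q → link a p' = .inner b q' → p = p')
    (hd : ∀ a p, link a p = .down → d a p ∈ S ∧ d a p ∉ Set.range f)
    (hdinj : ∀ a p p', link a p = .down → link a p' = .down → d a p = d a p' → p = p')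
    (hH : ∀ a w, G.Adj (f a) w ∧ ¬ O.Adj (f a) w ↔
      (∃ p b q, link a p = .inner b q ∧ w = f b) ∨ ∃ p, link a p = .down ∧ w = d a p) :
    ∃ nb, IsPiece G O S f nb link ∧ ∀ a p, link a p = .down → nb a p = d a p := by
  have key : ∀ a, ∃ nb : Fin 3 → V, Function.Injective nb ∧
      (∀ w, G.Adj (f a) w ↔ ∃ p, w = nb p) ∧
      (∀ p b q, link a p = .inner b q → nb p = f b) ∧ ∀ p, link a p = .down → nb p = d a p := by
    intro a
    let g : Fin 3 → V := fun p => match link a p with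
      | .inner b _ => f b
      | .up _ => f a
      | .down => d a p
    have hgi : ∀ p b q, link a p = .inner b q → g p = f b := fun p b q h => by simp [g, h]
    have hgd : ∀ p, link a p = .down → g p = d a p := fun p h => by simp [g, h]
    obtain ⟨nb, h1, h2, h3⟩ := exists_ports (hG (f a))
      {p | (∃ b q, link a p = .inner b q) ∨ link a p = .down} g
      (by
        rintro p (⟨b, q, hl⟩ | hl)
        · rw [hgi p b q hl]
          exact ((hH a _).2 (Or.inl ⟨p, b, q, hl, rfl⟩)).1
        · rw [hgd p hl]
          exact ((hH a _).2 (Or.inr ⟨p, hl, rfl⟩)).1)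
      (by
        rintro p (⟨b, q, hl⟩ | hl) p' (⟨b', q', hl'⟩ | hl') heq
        · rw [hgi p b q hl, hgi p' b' q' hl'] at heq
          have := hf heq
          subst this
          exact hinj a p p' b q q' hl hl'
        · rw [hgi p b q hl, hgd p' hl'] at heq
          exact absurd ⟨b, heq⟩ (hd a p' hl').2
        · rw [hgd p hl, hgi p' b' q' hl'] at heq
          exact absurd ⟨b', heq.symm⟩ (hd a p hl).2
        · rw [hgd p hl, hgd p' hl'] at heq
          exact hdinj a p p' hl hl' heq)
    exact ⟨nb, h1, h2, fun p b q hl => (h3 p (Or.inl ⟨b, q, hl⟩)).trans (hgi p b q hl),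
      fun p hl => (h3 p (Or.inr hl)).trans (hgd p hl)⟩
  choose nb h1 h2 h3 h4 using key
  refine ⟨nb, ⟨hf, hmem, h2, h1, fun a p b q hl => ⟨h3 a p b q hl, hsymm a p b q hl, ?_⟩,
    fun a p x hl => ?_, fun a p hl => ?_⟩, h4⟩
  · rw [h3 a p b q hl]
    exact ((hH a _).2 (Or.inl ⟨p, b, q, hl, rfl⟩)).2
  · by_contra hO
    have hadj := (h2 a (nb a p)).2 ⟨p, rfl⟩
    rcases (hH a _).1 ⟨hadj, hO⟩ with ⟨p', b, q, hl', he⟩ | ⟨p', hl', he⟩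
    · rw [← h3 a p' b q hl'] at he
      rw [h1 a he, hl'] at hl
      cases hl
    · rw [← h4 a p' hl'] at he
      rw [h1 a he, hl'] at hl
      cases hl
  · rw [h4 a p hl]
    exact ⟨(hd a p hl).1, (hd a p hl).2, ((hH a _).2 (Or.inr ⟨p, hl, rfl⟩)).2⟩

/-- A state extends to a piece if the search for its rotations succeeds. -/
theorem IsPiece.exists_state {V : Type u} [Finite V] {k n : ℕ} {G O : SimpleGraph V} {S : Set V}
    {f : Fin k → V} {nb : Fin k → Fin 3 → V} {link : Fin k → Fin 3 → Link k n}
    (h : IsPiece G O S f nb link) {c : V → V → ℕ} (hc : IsState G O S c)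
    {P : Fin n → Fin k × Fin 3} (hP : ∀ x, link (P x).1 (P x).2 = .up x)
    (hP' : ∀ a p x, link a p = .up x → P x = (a, p))
    (hN : ∀ e, IsPattern n e → (∀ x, e x = patternOf
        (fun x => c (f (P x).1) (nb (P x).1 (P x).2))
        (fun x => c (nb (P x).1 (P x).2) (f (P x).1)) x) →
      ∃ N, validBits link (fun _ => true) (fun _ => true) e N = true) :
    ∃ c', IsState G (expose G O (Set.range f)) (S \ Set.range f) c' := by
  have hO : ∀ x, O.Adj (f (P x).1) (nb (P x).1 (P x).2) := fun x => h.up _ _ x (hP x)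
  have hinj : ∀ x y, f (P x).1 = f (P y).1 ∧ nb (P x).1 (P x).2 = nb (P y).1 (P y).2 → x = y := by
    rintro x y ⟨h1, h2⟩
    have h3 := h.inj h1
    rw [← h3] at h2
    have h4 := h.nb_inj _ h2
    have h5 := hP x
    rw [h3, h4, hP y] at h5
    exact (Link.up.inj h5).symm
  have ho : Function.Injective fun x => c (f (P x).1) (nb (P x).1 (P x).2) := fun x y hxy =>
    hinj x y (hc.out_inj _ (h.mem _) _ (h.mem _) _ _ (hO x) (hO y) hxy)
  have hi : Function.Injective fun x => c (nb (P x).1 (P x).2) (f (P x).1) := fun x y hxy =>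
    hinj x y (hc.in_inj _ (h.mem _) _ (h.mem _) _ _ (hO x) (hO y) hxy)
  have hoi := fun x => hc.ne _ _ (hO x)
  obtain ⟨N, hN⟩ := hN _ (isPattern_patternOf ho hi hoi) fun _ => rfl
  obtain ⟨c', M, h1, -⟩ := h.extend_of_valid hc.toIsFaceColoring ho hi hoi
    (fun a p x hl => by rw [hP' a p x hl]; exact ⟨rfl, rfl⟩)
    (fun x _ v hv w hvw heq => hv.2
      ⟨_, (hc.out_inj v hv.1 _ (h.mem _) _ _ hvw (hO x) heq).1.symm⟩)
    (fun x _ v hv w hvw heq => hv.2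
      ⟨_, (hc.in_inj v hv.1 _ (h.mem _) _ _ hvw (hO x) heq).1.symm⟩)
    (fun v hv v' hv' => hc.out_inj v hv.1 v' hv'.1)
    (fun v hv v' hv' => hc.in_inj v hv.1 v' hv'.1) hN
  exact ⟨c', h1⟩

/-- As the colours are passed on at each vertex outside `S`, equally many darts of each colour leave
and enter `S`. -/
theorem IsFaceColoring.balance {V : Type u} [Finite V] {G O : SimpleGraph V} {S : Set V}
    {c : V → V → ℕ} (hc : IsFaceColoring G O S c) (hOG : O ≤ G) (κ : ℕ) :
    (∃ v ∈ S, ∃ w, O.Adj v w ∧ c v w = κ) ↔ ∃ v ∈ S, ∃ w, O.Adj v w ∧ c w v = κ := by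
  classical
  have := Fintype.ofFinite V
  let F : V → V → ℕ := fun v w => if O.Adj v w ∧ c v w = κ then 1 else 0
  have hrot : ∀ v ∉ S, ∑ w, F v w = ∑ w, F w v := by
    intro v hv
    obtain ⟨a, b, d, hab, hbd, had, hadj, e1, e2, e3⟩ := hc.rot v hv
    have hO : ∀ w, O.Adj v w ↔ w = a ∨ w = b ∨ w = d := fun w =>
      ⟨fun h => (hadj w).1 (hOG h), fun h => hc.adj v hv w ((hadj w).2 h)⟩
    have hsub : ∀ g : V → ℕ, (∀ w, ¬ O.Adj v w → g w = 0) → ∑ w, g w = g a + g b + g d := by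
      intro g hg
      rw [← Finset.sum_subset (Finset.subset_univ {a, b, d})
        (fun w _ hw => hg w (by rw [hO]; simpa using hw)),
        Finset.sum_insert (by simp [hab, had]), Finset.sum_insert (by simp [hbd]),
        Finset.sum_singleton, add_assoc]
    have ha := (hO a).2 (by simp)
    have hb := (hO b).2 (by simp)
    have hd := (hO d).2 (by simp)
    rw [hsub _ fun w hw => by simp [F, hw], hsub _ fun w hw => by simp [F, hw, O.adj_comm w v]]
    simp only [F, ha, hb, hd, ha.symm, hb.symm, hd.symm, true_and, e1, e2, e3]
    ring
  have hS : ∑ v ∈ Finset.univ.filter (· ∈ S), ∑ w, F v w =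
      ∑ v ∈ Finset.univ.filter (· ∈ S), ∑ w, F w v := by
    have h1 : ∑ v, ∑ w, F v w = ∑ v, ∑ w, F w v := Finset.sum_comm
    rw [← Finset.sum_filter_add_sum_filter_not Finset.univ (· ∈ S) (fun v => ∑ w, F v w),
      ← Finset.sum_filter_add_sum_filter_not Finset.univ (· ∈ S) (fun v => ∑ w, F w v)] at h1
    have h2 := Finset.sum_congr (rfl : Finset.univ.filter (· ∉ S) = _)
      fun v hv => hrot v (Finset.mem_filter.1 hv).2
    omega
  have h3 : (∃ v ∈ S, ∃ w, O.Adj v w ∧ c v w = κ) ↔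
      ∑ v ∈ Finset.univ.filter (· ∈ S), ∑ w, F v w ≠ 0 := by
    simp [F, Finset.sum_eq_zero_iff]
  have h4 : (∃ v ∈ S, ∃ w, O.Adj v w ∧ c w v = κ) ↔
      ∑ v ∈ Finset.univ.filter (· ∈ S), ∑ w, F w v ≠ 0 := by
    simp [F, Finset.sum_eq_zero_iff, O.adj_comm]
  rw [h3, h4, hS]

/-! ### Additions of single pieces -/

/-- The edges of `G` that do not lie inside `S`. -/
def outside {V : Type u} (G : SimpleGraph V) (S : Set V) : SimpleGraph V where
  Adj v w := G.Adj v w ∧ ¬ (v ∈ S ∧ w ∈ S)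
  symm := ⟨fun _ _ h => ⟨h.1.symm, fun h' => h.2 h'.symm⟩⟩
  loopless := ⟨fun _ h => h.1.ne rfl⟩

theorem outside_le {V : Type u} (G : SimpleGraph V) (S : Set V) : outside G S ≤ G :=
  fun _ _ h => h.1

theorem expose_outside {V : Type u} (G : SimpleGraph V) {S W : Set V} (h : Disjoint S W) :
    expose G (outside G (S ∪ W)) W = outside G S := by
  ext v w
  have h1 : ∀ x, x ∈ S → x ∉ W := fun x hS hW => Set.disjoint_left.1 h hS hW
  have := h1 v
  have := h1 w
  simp only [expose, outside, Set.mem_union]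
  tauto

/-- `link a p = .inner b q`, as a Boolean. -/
def isInner {k n : ℕ} (link : Fin k → Fin 3 → Link k n) (a : Fin k) (p : Fin 3) (b : Fin k)
    (q : Fin 3) : Bool :=
  match link a p with
  | .inner b' q' => b' == b && q' == q
  | _ => false

/-- `link a p = .down`, as a Boolean. -/
def isDown {k n : ℕ} (link : Fin k → Fin 3 → Link k n) (a : Fin k) (p : Fin 3) : Bool :=
  match link a p with
  | .down => true
  | _ => false

/-- `link a p = .up x`, as a Boolean. -/
def isUp {k n : ℕ} (link : Fin k → Fin 3 → Link k n) (a : Fin k) (p : Fin 3) (x : Fin n) : Bool :=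
  match link a p with
  | .up y => y == x
  | _ => false

theorem isInner_iff {k n : ℕ} {link : Fin k → Fin 3 → Link k n} {a p b q} :
    isInner link a p b q = true ↔ link a p = .inner b q := by
  unfold isInner
  split <;> rename_i h
  · simp [h]
  · simpa using h b q

theorem isDown_iff {k n : ℕ} {link : Fin k → Fin 3 → Link k n} {a p} :
    isDown link a p = true ↔ link a p = .down := by
  unfold isDown
  split
  · rename_i h
    simp [h]
  · rename_i h
    simpa using h

theorem isUp_iff {k n : ℕ} {link : Fin k → Fin 3 → Link k n} {a p x} :
    isUp link a p x = true ↔ link a p = .up x := by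
  unfold isUp
  split <;> rename_i h
  · simp [h]
  · simpa using h x

/-- The inner ports are matched with each other, at most one for each pair of vertices. -/
def IsMatched {k n : ℕ} (link : Fin k → Fin 3 → Link k n) : Prop :=
  (∀ a p b q, isInner link a p b q = true → isInner link b q a p = true) ∧
  ∀ a p p' b q q', isInner link a p b q = true → isInner link a p' b q' = true → p = p'

instance {k n : ℕ} (link : Fin k → Fin 3 → Link k n) : Decidable (IsMatched link) :=
  inferInstanceAs (Decidable (_ ∧ _))

/-- `P x` is the only port that is `up x`. -/
def IsUpPort {k n : ℕ} (link : Fin k → Fin 3 → Link k n) (P : Fin n → Fin k × Fin 3) : Prop :=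
  (∀ x, isUp link (P x).1 (P x).2 x = true) ∧
  ∀ a p x, isUp link a p x = true → P x = (a, p)

instance {k n : ℕ} (link : Fin k → Fin 3 → Link k n) (P : Fin n → Fin k × Fin 3) :
    Decidable (IsUpPort link P) :=
  inferInstanceAs (Decidable (_ ∧ _))

/-- The inner ports form the graph `P`, and `a` has `h a` ports that are `down`. -/
def HasShape {k n : ℕ} (link : Fin k → Fin 3 → Link k n) (P : SimpleGraph (Fin k))
    (h : Fin k → ℕ) : Prop :=
  (∀ a b, P.Adj a b ↔ ∃ p q, isInner link a p b q = true) ∧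
  ∀ a, (Finset.univ.filter fun p => isDown link a p = true).card = h a

theorem IsBoldCopy.exists_isPiece {V : Type u} [Finite V] {k n : ℕ} {G : SimpleGraph V}
    (hG : IsCubic G) {S W : Set V} (hSW : Disjoint S W) {P : SimpleGraph (Fin k)} {h : Fin k → ℕ}
    (hb : IsBoldCopy G S W P h) {link : Fin k → Fin 3 → Link k n} (hm : IsMatched link)
    (hs : HasShape link P h) :
    ∃ f nb, IsPiece G (outside G (S ∪ W)) (S ∪ W) f nb link ∧ Set.range f = W := by
  obtain ⟨f, hfW, hadj, hdeg⟩ := hb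
  have hd : ∀ a, ∃ d : Fin 3 → V,
      (∀ p p', link a p = .down → link a p' = .down → d p = d p' → p = p') ∧
      ∀ w, G.Adj (f a) w ∧ w ∈ S ↔ ∃ p, link a p = .down ∧ w = d p := by
    intro a
    have hcard : Nat.card {p : Fin 3 // link a p = .down} =
        Nat.card (G.neighborSet (f a) ∩ S : Set V) := by
      rw [Nat.card_coe_set_eq]
      refine Eq.trans ?_ (hdeg a).symm
      rw [← hs.2 a, Nat.subtype_card]
      intro p
      simp [isDown_iff]
    obtain ⟨e⟩ := Finite.card_eq.1 hcard
    classical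
    refine ⟨fun p => if hp : link a p = .down then (e ⟨p, hp⟩ : V) else f a, ?_, ?_⟩
    · intro p p' hp hp' heq
      simp only [hp, hp', dite_true] at heq
      simpa using e.injective (Subtype.ext heq)
    · intro w
      constructor
      · intro hw
        obtain ⟨⟨p, hp⟩, hpw⟩ := e.surjective ⟨w, hw⟩
        refine ⟨p, hp, ?_⟩
        simp only [hp, dite_true, hpw]
      · rintro ⟨p, hp, rfl⟩
        simp only [hp, dite_true]
        exact (e ⟨p, hp⟩).2
  choose d hd1 hd2 using hd
  have hW : ∀ a, f a ∈ W := fun a => hfW ▸ ⟨a, rfl⟩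
  obtain ⟨nb, hnb, -⟩ := ForkGraph.exists_isPiece (O := outside G (S ∪ W)) (S := S ∪ W) (f := f)
    (link := link) hG d
    f.injective (fun a => Or.inr (hW a))
    (fun a p b q hl => isInner_iff.1 (hm.1 a p b q (isInner_iff.2 hl)))
    (fun a p p' b q q' hl hl' => hm.2 a p p' b q q' (isInner_iff.2 hl) (isInner_iff.2 hl'))
    (fun a p hl => by
      have h1 := ((hd2 a _).2 ⟨p, hl, rfl⟩).2
      exact ⟨Or.inl h1, fun h2 => Set.disjoint_left.1 hSW h1 (hfW ▸ h2)⟩)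
    (fun a => hd1 a)
    (fun a w => by
      rw [← hd2 a w]
      have h1 : (∃ p b q, link a p = .inner b q ∧ w = f b) ↔ G.Adj (f a) w ∧ w ∈ W := by
        constructor
        · rintro ⟨p, b, q, hl, rfl⟩
          exact ⟨(hadj a b).2 ((hs.1 a b).2 ⟨p, q, isInner_iff.2 hl⟩), hW b⟩
        · rintro ⟨h1, h2⟩
          rw [← hfW] at h2
          obtain ⟨b, rfl⟩ := h2
          obtain ⟨p, q, hl⟩ := (hs.1 a b).1 ((hadj a b).1 h1)
          exact ⟨p, b, q, isInner_iff.1 hl, rfl⟩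
      rw [h1]
      have := hW a
      simp only [outside, Set.mem_union]
      tauto)
  exact ⟨f, nb, hnb, hfW⟩

/-- Removal of a bold member of the fork-collection for which a suitable rotation is always found.
-/
theorem IsBoldCopy.exists_state {V : Type u} [Finite V] {k n : ℕ} {G : SimpleGraph V}
    (hG : IsCubic G) {S W : Set V} (hSW : Disjoint S W) {P : SimpleGraph (Fin k)} {h : Fin k → ℕ}
    (hb : IsBoldCopy G S W P h) {link : Fin k → Fin 3 → Link k n} (hm : IsMatched link)
    (hs : HasShape link P h) {U : Fin n → Fin k × Fin 3} (hU : IsUpPort link U)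
    (hN : ∀ e, IsPattern n e →
      ∃ N, validBits link (fun _ => true) (fun _ => true) e N = true)
    {c : V → V → ℕ} (hc : IsState G (outside G (S ∪ W)) (S ∪ W) c) :
    ∃ c', IsState G (outside G S) S c' := by
  obtain ⟨f, nb, hp, rfl⟩ := hb.exists_isPiece hG hSW hm hs
  obtain ⟨c', hc'⟩ := hp.exists_state hc (fun x => isUp_iff.1 (hU.1 x))
    (fun a p x hl => hU.2 a p x (isUp_iff.2 hl)) (fun e he _ => hN e he)
  rw [expose_outside G hSW, Set.union_sdiff_cancel_right
    (Set.disjoint_iff.1 hSW)] at hc'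
  exact ⟨c', hc'⟩

section Shape

set_option maxRecDepth 10000

theorem hasShape_dotTwo : HasShape dotTwoLink dotGraph ![2] :=
  ⟨by simp only [dotGraph, bot_adj]; decide, by decide⟩

theorem hasShape_dotThree : HasShape dotThreeLink dotGraph ![3] :=
  ⟨by simp only [dotGraph, bot_adj]; decide, by decide⟩

theorem hasShape_subfork : HasShape subforkLink subforkGraph ![1, 1] :=
  ⟨by simp only [subforkGraph, fromEdgeSet_adj, Set.mem_singleton_iff, Sym2.eq_iff]; decide,
    by decide⟩

theorem hasShape_starFork : HasShape (starLink (n := 3) id) starForkGraph ![0, 1, 1, 1] :=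
  ⟨by
    simp only [starForkGraph, fromEdgeSet_adj, Set.mem_insert_iff, Set.mem_singleton_iff,
      Sym2.eq_iff]
    decide, by decide⟩

theorem hasShape_fork : HasShape forkLink forkGraph ![0, 1, 1, 0, 1] :=
  ⟨by
    simp only [forkGraph, fromEdgeSet_adj, Set.mem_insert_iff, Set.mem_singleton_iff,
      Sym2.eq_iff]
    decide +kernel, by decide⟩

theorem hasShape_pFork : HasShape pForkLink pForkGraph ![1, 0, 0, 1, 0, 0, 0, 1] :=
  ⟨by
    simp only [pForkGraph, fromEdgeSet_adj, Set.mem_insert_iff, Set.mem_singleton_iff,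
      Sym2.eq_iff]
    decide +kernel, by decide⟩

section

variable {V : Type u} [Finite V] {G : SimpleGraph V} {S W : Set V} {c : V → V → ℕ}

theorem exists_state_of_dotTwo (hG : IsCubic G) (hSW : Disjoint S W)
    (hb : IsBoldCopy G S W dotGraph ![2]) (hc : IsState G (outside G (S ∪ W)) (S ∪ W) c) :
    ∃ c', IsState G (outside G S) S c' :=
  hb.exists_state hG hSW (link := dotTwoLink) (by decide) hasShape_dotTwo (U := ![(0, 2)])
    (by decide) (fun _ he => exists_of_search dotTwo_search he rfl) hc

theorem exists_state_of_dotThree (hG : IsCubic G) (hSW : Disjoint S W)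
    (hb : IsBoldCopy G S W dotGraph ![3]) (hc : IsState G (outside G (S ∪ W)) (S ∪ W) c) :
    ∃ c', IsState G (outside G S) S c' :=
  hb.exists_state hG hSW (link := dotThreeLink) (by decide) hasShape_dotThree (U := ![])
    (by decide) (fun _ he => exists_of_search dotThree_search he rfl) hc

theorem exists_state_of_subfork (hG : IsCubic G) (hSW : Disjoint S W)
    (hb : IsBoldCopy G S W subforkGraph ![1, 1]) (hc : IsState G (outside G (S ∪ W)) (S ∪ W) c) :
    ∃ c', IsState G (outside G S) S c' :=
  hb.exists_state hG hSW (link := subforkLink) (by decide) hasShape_subfork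
    (U := ![(0, 2), (1, 2)]) (by decide) (fun _ he => exists_of_search subfork_search he rfl) hc

theorem exists_state_of_starFork (hG : IsCubic G) (hSW : Disjoint S W)
    (hb : IsBoldCopy G S W starForkGraph ![0, 1, 1, 1])
    (hc : IsState G (outside G (S ∪ W)) (S ∪ W) c) : ∃ c', IsState G (outside G S) S c' :=
  hb.exists_state hG hSW (link := starLink id) (by decide +kernel) hasShape_starFork
    (U := ![(1, 2), (2, 2), (3, 2)]) (by decide +kernel)
    (fun _ he => exists_of_search starFork_search he rfl) hc

theorem exists_state_of_pFork (hG : IsCubic G) (hSW : Disjoint S W)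
    (hb : IsBoldCopy G S W pForkGraph ![1, 0, 0, 1, 0, 0, 0, 1])
    (hc : IsState G (outside G (S ∪ W)) (S ∪ W) c) : ∃ c', IsState G (outside G S) S c' :=
  hb.exists_state hG hSW (link := pForkLink) (by decide +kernel) hasShape_pFork
    (U := ![(7, 2), (1, 2), (4, 2)]) (by decide +kernel)
    (fun _ he => exists_of_search pFork_search he rfl) hc

end

end Shape

/-! ### Passing a star fork of a big-fork -/

theorem goodFour_iff {u w : Fin 4 → ℕ} : GoodFour u w = true ↔
    (∃ s t, u s = w t) ∧ ∀ s t z, u s = w t → u t = w z → u z ≠ w s := by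
  simp only [GoodFour, Bool.and_eq_true, List.any_eq_true, List.all_eq_true, List.mem_finRange,
    true_and, true_implies, Nat.beq_eq, Bool.or_eq_true, Bool.not_eq_true', ← Bool.not_eq_true]
  refine and_congr Iff.rfl (forall_congr' fun s => forall_congr' fun t => ?_)
  constructor
  · rintro (h | h) z h1 h2 h3
    · exact h h1
    · exact h z ⟨h2, h3⟩
  · intro h
    by_cases h1 : u s = w t
    · exact Or.inr fun z hz => h z h1 hz.1 hz.2
    · exact Or.inl h1

theorem goodFour_comp {u w : Fin 4 → ℕ} {g : ℕ → ℕ} (hg : Function.Injective g)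
    (h : GoodFour u w = true) : GoodFour (fun s => g (u s)) (fun s => g (w s)) = true := by
  rw [goodFour_iff] at h ⊢
  simpa only [hg.eq_iff, ne_eq] using h

section Goodness

variable {V : Type u}

/-- `x` is a dart along a coloured edge that starts in `W`. -/
def IsExit (O : SimpleGraph V) (W : Set V) (x : V × V) : Prop :=
  x.1 ∈ W ∧ O.Adj x.1 x.2

/-- A trail that leaves `W` through the dart `x` and returns through the reverse of `y`. -/
def IsArc (O : SimpleGraph V) (W : Set V) (c : V → V → ℕ) (x y : V × V) : Prop :=
  IsExit O W x ∧ IsExit O W y ∧ c x.1 x.2 = c y.2 y.1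

/-- There are four exits of `W` with an arc and without a directed 3-cycle of arcs. -/
def HasGoodArc (O : SimpleGraph V) (W : Set V) (c : V → V → ℕ) : Prop :=
  ∃ d : Fin 4 → V × V, Function.Injective d ∧ (∀ s, IsExit O W (d s)) ∧
    GoodFour (fun s => c (d s).1 (d s).2) (fun s => c (d s).2 (d s).1) = true

/-- There is no arc, but the trail that arrives through the reverse of `y` and the one that leaves
through `x` can be joined, as no edge belongs to both of them. -/
def HasGoodPair (O : SimpleGraph V) (W : Set V) (c : V → V → ℕ) : Prop :=
  (∀ x y, ¬ IsArc O W c x y) ∧ ∃ x y, x ≠ y ∧ IsExit O W x ∧ IsExit O W y ∧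
    ∀ v w, O.Adj v w → c v w = c x.1 x.2 → c w v ≠ c y.2 y.1

theorem HasGoodArc.exists_isArc {O : SimpleGraph V} {W : Set V} {c : V → V → ℕ}
    (h : HasGoodArc O W c) : ∃ x y, IsArc O W c x y := by
  obtain ⟨d, -, h1, h2⟩ := h
  obtain ⟨⟨s, t, hst⟩, -⟩ := goodFour_iff.1 h2
  exact ⟨d s, d t, h1 s, h1 t, hst⟩

/-- A star fork with the vertices `t a`, as part of the set `T`, where the first two half-edges lead
to `W` and the third one does not. -/
structure IsStar (G O : SimpleGraph V) (T W : Set V) (t : Fin 4 → V) (nb : Fin 4 → Fin 3 → V) :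
    Prop where
  piece : IsPiece G O T t nb (starLink (n := 3) id)
  le : O ≤ G
  subset : W ⊆ T
  notMem : ∀ a, t a ∉ W
  mem_one : nb 1 1 ∈ W
  mem_two : nb 2 1 ∈ W
  notMem_three : nb 3 1 ∉ W

variable {G O : SimpleGraph V} {T W : Set V} {t : Fin 4 → V} {nb : Fin 4 → Fin 3 → V}
  {c : V → V → ℕ}

/-- The dart that leaves the star fork at the leaf `x + 1`. -/
def starExit (t : Fin 4 → V) (nb : Fin 4 → Fin 3 → V) (x : Fin 3) : V × V :=
  (t x.succ, nb x.succ 2)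

theorem starLink_up {a : Fin 4} {p x : Fin 3} (h : starLink id a p = .up x) :
    a = x.succ ∧ p = 2 := by
  have key : ∀ (a : Fin 4) (p x : Fin 3), isUp (starLink (n := 3) id) a p x = true →
    a = x.succ ∧ p = 2 := by decide
  exact key a p x (isUp_iff.2 h)

theorem starLink_succ (x : Fin 3) : starLink id x.succ 2 = .up x := by
  fin_cases x <;> rfl

theorem starLink_down {a : Fin 4} {p : Fin 3} (h : starLink (n := 3) id a p = .down) :
    (a = 1 ∨ a = 2 ∨ a = 3) ∧ p = 1 := by
  have key : ∀ (a : Fin 4) (p : Fin 3), isDown (starLink (n := 3) id) a p = true →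
    (a = 1 ∨ a = 2 ∨ a = 3) ∧ p = 1 := by decide
  exact key a p (isDown_iff.2 h)

namespace IsStar

theorem isExit (h : IsStar G O T W t nb) (x : Fin 3) :
    IsExit O (W ∪ Set.range t) (starExit t nb x) :=
  ⟨Or.inr ⟨_, rfl⟩, h.piece.up _ _ x (starLink_succ x)⟩

theorem starExit_injective (h : IsStar G O T W t nb) : Function.Injective (starExit t nb) :=
  fun _ _ hxy => Fin.succ_injective _ (h.piece.inj (Prod.ext_iff.1 hxy).1)

theorem starExit_ne (h : IsStar G O T W t nb) (x : Fin 3) {y : V × V} (hy : y.1 ∈ W) :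
    starExit t nb x ≠ y := by
  rintro rfl
  exact h.notMem _ hy

theorem exit_cases (h : IsStar G O T W t nb) {x : V × V} (hx : IsExit O (W ∪ Set.range t) x) :
    IsExit O W x ∨ ∃ z, x = starExit t nb z := by
  obtain ⟨v, w⟩ := x
  rcases hx with ⟨hv | ⟨a, rfl⟩, hO⟩
  · exact Or.inl ⟨hv, hO⟩
  · right
    simp only at hO
    obtain ⟨p, rfl⟩ := (h.piece.adj a w).1 (h.le hO)
    rcases hl : starLink (n := 3) id a p with ⟨b, q⟩ | z | _
    · exact absurd hO (h.piece.inner _ _ _ _ hl).2.2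
    · obtain ⟨rfl, rfl⟩ := starLink_up hl
      exact ⟨z, rfl⟩
    · exact absurd hO (h.piece.down _ _ hl).2.2

/-- The dart that enters the star fork at the vertex `t a`. -/
def starEntry (t : Fin 4 → V) (nb : Fin 4 → Fin 3 → V) (a : Fin 4) : V × V :=
  (nb a 1, t a)

theorem expose_of_isExit {x : V × V} (hx : IsExit O W x) :
    IsExit (expose G O (Set.range t)) W x :=
  ⟨hx.1, Or.inl hx.2⟩

theorem isExit_starEntry (h : IsStar G O T W t nb) {a : Fin 4} (ha : a = 1 ∨ a = 2) :
    IsExit (expose G O (Set.range t)) W (starEntry t nb a) := by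
  refine ⟨?_, Or.inr ⟨((h.piece.adj a _).2 ⟨1, rfl⟩).symm, Or.inr ⟨a, rfl⟩⟩⟩
  rcases ha with rfl | rfl
  · exact h.mem_one
  · exact h.mem_two

theorem starEntry_ne (h : IsStar G O T W t nb) {a : Fin 4} (ha : a = 1 ∨ a = 2) {x : V × V}
    (hx : IsExit O W x) : starEntry t nb a ≠ x := by
  rintro rfl
  have hl : starLink (n := 3) id a 1 = .down := by rcases ha with rfl | rfl <;> rfl
  exact (h.piece.down _ _ hl).2.2 hx.2.symm

theorem starEntry_ne' (h : IsStar G O T W t nb) : starEntry t nb 1 ≠ starEntry t nb 2 := by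
  intro h1
  exact absurd (h.piece.inj (Prod.ext_iff.1 h1).2) (by decide)

theorem exit_cases_expose (h : IsStar G O T W t nb) {x : V × V}
    (hx : IsExit (expose G O (Set.range t)) W x) :
    IsExit O W x ∨ x = starEntry t nb 1 ∨ x = starEntry t nb 2 := by
  obtain ⟨v, w⟩ := x
  obtain ⟨hv, hO⟩ := hx
  simp only at hv hO
  have hvt : v ∉ Set.range t := by
    rintro ⟨a, rfl⟩
    exact h.notMem a hv
  rcases h.piece.expose_adj ⟨h.subset hv, hvt⟩ hO with hO | ⟨a, p, hl, rfl, rfl⟩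
  · exact Or.inl ⟨hv, hO⟩
  · obtain ⟨rfl | rfl | rfl, rfl⟩ := starLink_down hl
    · exact Or.inr (Or.inl rfl)
    · exact Or.inr (Or.inr rfl)
    · exact absurd hv h.notMem_three

/-- Colours the star fork by rotations that were found by a search. The colours at the exits of `W`
in `hW` do not occur at the star fork. -/
theorem exists_extension [Finite V] (h : IsStar G O T W t nb) (hc : IsFaceColoring G O T c)
    {o i : Fin 3 → ℕ}
    (ho' : ∀ z, o z = c (starExit t nb z).1 (starExit t nb z).2)
    (hi' : ∀ z, i z = c (starExit t nb z).2 (starExit t nb z).1)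
    (ho : Function.Injective o) (hi : Function.Injective i)
    (hW : ∀ u, IsExit O W u → ∀ z,
      o z ≠ c u.1 u.2 ∧ i z ≠ c u.1 u.2 ∧ o z ≠ c u.2 u.1 ∧ i z ≠ c u.2 u.1)
    {okOut okIn : Fin 3 → Bool}
    (hokOut : ∀ x, okOut x = true → ∀ v ∈ T \ Set.range t, ∀ w, O.Adj v w → c v w ≠ o x)
    (hokIn : ∀ x, okIn x = true → ∀ v ∈ T \ Set.range t, ∀ w, O.Adj v w → c w v ≠ i x)
    (hro : ∀ v ∈ T \ Set.range t, ∀ v' ∈ T \ Set.range t, ∀ w w', O.Adj v w → O.Adj v' w' →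
      c v w = c v' w' → v = v' ∧ w = w')
    (hri : ∀ v ∈ T \ Set.range t, ∀ v' ∈ T \ Set.range t, ∀ w w', O.Adj v w → O.Adj v' w' →
      c w v = c w' v' → v = v' ∧ w = w')
    {N : ℕ} (hN : validBits (starLink id) okOut okIn (patternOf o i) N = true) :
    ∃ (c' : V → V → ℕ) (g : ℕ → ℕ),
      IsState G (expose G O (Set.range t)) (T \ Set.range t) c' ∧
      (∀ v w, O.Adj v w → c' v w = c v w) ∧ Function.Injective g ∧
      (∀ z : Fin 3, g z = o z) ∧ (∀ z, g (patternOf o i z) = i z) ∧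
      (∀ a, c' (starEntry t nb a).1 (starEntry t nb a).2
          = g (colorIn (starLink id) (patternOf o i) N a) ∧
        c' (starEntry t nb a).2 (starEntry t nb a).1
          = g (colorOut (starLink id) (patternOf o i) N a)) ∧
      (∀ m, 6 ≤ m → ∀ v w, c v w ≠ g m) ∧
      ∀ v w, (expose G O (Set.range t)).Adj v w → O.Adj v w ∨
        ∀ u, IsExit O W u → c' v w ≠ c u.1 u.2 ∧ c' v w ≠ c u.2 u.1 := by
  have hoi : ∀ z, o z ≠ i z := fun z => by
    rw [ho', hi']
    exact hc.ne _ _ (h.isExit z).2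
  obtain ⟨c', M, h1, h2, h3, hM, hMo, hMi⟩ := h.piece.extend_of_valid hc ho hi hoi
    (fun a p x hl => by
      obtain ⟨rfl, rfl⟩ := starLink_up hl
      exact ⟨(ho' x).symm, (hi' x).symm⟩) hokOut hokIn hro hri hN
  have key : ∀ m u, IsExit O W u → colorOf o i M m ≠ c u.1 u.2 ∧ colorOf o i M m ≠ c u.2 u.1 := by
    intro m u hu
    rcases colorOf_cases o i M m with ⟨z, hz⟩ | ⟨z, hz⟩ | hlt
    · rw [hz]
      exact ⟨(hW u hu z).1, (hW u hu z).2.2.1⟩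
    · rw [hz]
      exact ⟨(hW u hu z).2.1, (hW u hu z).2.2.2⟩
    · exact ⟨(lt_of_le_of_lt (hM _ _) hlt).ne', (lt_of_le_of_lt (hM _ _) hlt).ne'⟩
  refine ⟨c', colorOf o i M, h1, h2, colorOf_injective ho hi hMo hMi, colorOf_out o i M,
    colorOf_in ho hi hoi M, fun a => h3 a 1, fun m hm v w => ?_, ?_⟩
  · exact (lt_of_le_of_lt (hM v w) (lt_colorOf ho hi hoi M hm)).ne
  · rintro v w (hO | ⟨hG, ⟨a, rfl⟩ | ⟨a, rfl⟩⟩)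
    · exact Or.inl hO
    · obtain ⟨p, rfl⟩ := (h.piece.adj a w).1 hG
      right
      rw [(h3 a p).2]
      exact key _
    · obtain ⟨p, rfl⟩ := (h.piece.adj a v).1 hG.symm
      right
      rw [(h3 a p).1]
      exact key _

/-- Without arcs between the four exits at the star fork or between other exits of `W`, a pair that
contains an old exit of `W` is good when the old edges do not prevent it. -/
theorem hasGoodPair (h : IsStar G O T W t nb) {c' : V → V → ℕ}
    (hold : ∀ v w, O.Adj v w → c' v w = c v w)
    (hnew : ∀ v w, (expose G O (Set.range t)).Adj v w → O.Adj v w ∨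
        ∀ u, IsExit O W u → c' v w ≠ c u.1 u.2 ∧ c' v w ≠ c u.2 u.1)
    (hne : ∀ v w, (expose G O (Set.range t)).Adj v w → c' v w ≠ c' w v)
    (harc : ∀ x y, ¬ IsArc O W c x y)
    (h12 : c' (starEntry t nb 1).1 (starEntry t nb 1).2 ≠
      c' (starEntry t nb 2).2 (starEntry t nb 2).1)
    (h21 : c' (starEntry t nb 2).1 (starEntry t nb 2).2 ≠
      c' (starEntry t nb 1).2 (starEntry t nb 1).1)
    {x u : V × V} (hx : IsExit (expose G O (Set.range t)) W x) (hu : IsExit O W u) (hxu : x ≠ u)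
    (hpair : (∀ v w, O.Adj v w → c v w = c' x.1 x.2 → c w v ≠ c u.2 u.1) ∨
      ∀ v w, O.Adj v w → c v w = c u.1 u.2 → c w v ≠ c' x.2 x.1) :
    HasGoodPair (expose G O (Set.range t)) W c' := by
  have hent : ∀ a, a = 1 ∨ a = 2 → ∀ u, IsExit O W u →
      c' (starEntry t nb a).1 (starEntry t nb a).2 ≠ c u.2 u.1 ∧
      c u.1 u.2 ≠ c' (starEntry t nb a).2 (starEntry t nb a).1 := by
    intro a ha u hu
    have hl : starLink (n := 3) id a 1 = .down := by rcases ha with rfl | rfl <;> rfl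
    have hO := (h.piece.down _ _ hl).2.2
    have hx := (h.isExit_starEntry ha).2
    exact ⟨(((hnew _ _ hx).resolve_left fun h => hO h.symm) u hu).2,
      (((hnew _ _ hx.symm).resolve_left hO) u hu).1.symm⟩
  refine ⟨?_, ?_⟩
  · rintro x y ⟨hx, hy, hxy⟩
    rcases h.exit_cases_expose hx with hx' | rfl | rfl <;>
      rcases h.exit_cases_expose hy with hy' | rfl | rfl
    · rw [hold _ _ hx'.2, hold _ _ hy'.2.symm] at hxy
      exact harc x y ⟨hx', hy', hxy⟩
    · rw [hold _ _ hx'.2] at hxy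
      exact (hent 1 (Or.inl rfl) x hx').2 hxy
    · rw [hold _ _ hx'.2] at hxy
      exact (hent 2 (Or.inr rfl) x hx').2 hxy
    · rw [hold _ _ hy'.2.symm] at hxy
      exact (hent 1 (Or.inl rfl) y hy').1 hxy
    · exact hne _ _ hx.2 hxy
    · exact h12 hxy
    · rw [hold _ _ hy'.2.symm] at hxy
      exact (hent 2 (Or.inr rfl) y hy').1 hxy
    · exact h21 hxy
    · exact hne _ _ hx.2 hxy
  · rcases hpair with hp | hp
    · refine ⟨x, u, hxu, hx, expose_of_isExit hu, fun v w hvw h1 h2 => ?_⟩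
      rw [hold _ _ hu.2.symm] at h2
      rcases hnew w v hvw.symm with hO | hn
      · rw [hold _ _ hO] at h2
        rw [hold _ _ hO.symm] at h1
        exact hp v w hO.symm h1 h2
      · exact (hn u hu).2 h2
    · refine ⟨u, x, hxu.symm, expose_of_isExit hu, hx, fun v w hvw h1 h2 => ?_⟩
      rw [hold _ _ hu.2] at h1
      rcases hnew v w hvw with hO | hn
      · rw [hold _ _ hO] at h1
        rw [hold _ _ hO.symm] at h2
        exact hp v w hO h1 h2
      · exact (hn u hu).1 h1

end IsStar
end Goodness

section Merge

variable {V : Type u} {G O : SimpleGraph V} {T U : Set V} {c : V → V → ℕ}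

/-- The colouring in which the colour `φ` is replaced by `κ`. -/
def merge (c : V → V → ℕ) (φ κ : ℕ) (v w : V) : ℕ := if c v w = φ then κ else c v w

theorem IsFaceColoring.merge (hc : IsFaceColoring G O T c) {φ κ : ℕ}
    (h : ∀ v w, O.Adj v w → c v w = φ → c w v ≠ κ) :
    IsFaceColoring G O T (merge c φ κ) := by
  refine ⟨hc.adj, fun v w hvw => ?_, fun v hv => ?_⟩
  · have h1 := hc.ne v w hvw
    have h2 := h v w hvw
    have h3 := h w v hvw.symm
    simp only [ForkGraph.merge]
    split_ifs with h4 h5 h5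
    · exact absurd (h4.trans h5.symm) h1
    · exact (h2 h4).symm
    · exact h3 h5
    · exact h1
  · obtain ⟨a, b, d, hab, hbd, had, hadj, e1, e2, e3⟩ := hc.rot v hv
    exact ⟨a, b, d, hab, hbd, had, hadj, by simp only [ForkGraph.merge, e1],
      by simp only [ForkGraph.merge, e2], by simp only [ForkGraph.merge, e3]⟩

theorem IsState.merge_out (hc : IsState G O T c) (hU : U ⊆ T) {x : V × V} (hx : IsExit O U x)
    (κ : ℕ) {v w : V} (hv : v ∈ T) (hvw : O.Adj v w) (hne : (v, w) ≠ x) :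
    merge c (c x.1 x.2) κ v w = c v w := by
  rw [merge, if_neg]
  intro h1
  exact hne (Prod.ext_iff.2 (hc.out_inj _ hv _ (hU hx.1) _ _ hvw hx.2 h1))

theorem merge_self (x : V × V) (κ : ℕ) : merge c (c x.1 x.2) κ x.1 x.2 = κ := if_pos rfl

theorem merge_in (harc : ∀ x y, ¬ IsArc O U c x y) {x : V × V} (hx : IsExit O U x) (κ : ℕ)
    {u : V × V} (hu : IsExit O U u) : merge c (c x.1 x.2) κ u.2 u.1 = c u.2 u.1 := by
  rw [merge, if_neg]
  exact fun h1 => harc x u ⟨hx, hu, h1.symm⟩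

theorem IsState.merge_in_inj (hc : IsState G O T c) (hU : U ⊆ T) {x y : V × V}
    (hy : IsExit O U y) {R : Set V} (hR : R ⊆ T) (hyR : y.1 ∉ R) :
    ∀ v ∈ R, ∀ v' ∈ R, ∀ w w', O.Adj v w → O.Adj v' w' →
      merge c (c x.1 x.2) (c y.2 y.1) w v = merge c (c x.1 x.2) (c y.2 y.1) w' v' →
      v = v' ∧ w = w' := by
  have key : ∀ v ∈ R, ∀ w, O.Adj v w → c w v ≠ c y.2 y.1 := by
    intro v hv w hvw heq
    obtain ⟨rfl, -⟩ := hc.in_inj v (hR hv) _ (hU hy.1) _ _ hvw hy.2 heq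
    exact hyR hv
  intro v hv v' hv' w w' hvw hvw' heq
  simp only [merge] at heq
  split_ifs at heq with h1 h2 h2
  · exact hc.in_inj _ (hR hv) _ (hR hv') _ _ hvw hvw' (h1.trans h2.symm)
  · exact absurd heq.symm (key v' hv' w' hvw')
  · exact absurd heq (key v hv w hvw)
  · exact hc.in_inj _ (hR hv) _ (hR hv') _ _ hvw hvw' heq

theorem IsState.merge_in_ne (hc : IsState G O T c) (hU : U ⊆ T) {x y : V × V}
    (hy : IsExit O U y) {R : Set V} (hR : R ⊆ T) {u : V × V} (hu : IsExit O U u) (huR : u.1 ∉ R)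
    (huy : u ≠ y) : ∀ v ∈ R, ∀ w, O.Adj v w →
      merge c (c x.1 x.2) (c y.2 y.1) w v ≠ c u.2 u.1 := by
  intro v hv w hvw heq
  simp only [merge] at heq
  split_ifs at heq with h1
  · exact huy (Prod.ext_iff.2 (hc.in_inj _ (hU hu.1) _ (hU hy.1) _ _ hu.2 hy.2 heq.symm))
  · obtain ⟨rfl, -⟩ := hc.in_inj _ (hR hv) _ (hU hu.1) _ _ hvw hu.2 heq
    exact huR hv

end Merge

section Star

variable {V : Type u} {G O : SimpleGraph V} {T W : Set V} {t : Fin 4 → V} {nb : Fin 4 → Fin 3 → V}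
  {c : V → V → ℕ}

namespace IsStar

/-- The only arc of the star fork, from `y` to `x`, is closed inside the star fork. -/
theorem exists_state_of_closing [Finite V] (h : IsStar G O T W t nb) (hc : IsFaceColoring G O T c)
    {o i : Fin 3 → ℕ}
    (ho' : ∀ z, o z = c (starExit t nb z).1 (starExit t nb z).2)
    (hi' : ∀ z, i z = c (starExit t nb z).2 (starExit t nb z).1)
    (ho : Function.Injective o) (hi : Function.Injective i)
    (hW : ∀ u, IsExit O W u → ∀ z,
      o z ≠ c u.1 u.2 ∧ i z ≠ c u.1 u.2 ∧ o z ≠ c u.2 u.1 ∧ i z ≠ c u.2 u.1)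
    (harc : ∀ x y, ¬ IsArc O W c x y)
    {x y : Fin 3} (hxy : ∀ z z', o z = i z' ↔ z = x ∧ z' = y)
    (hokOut : ∀ z ≠ x, ∀ v ∈ T \ Set.range t, ∀ w, O.Adj v w → c v w ≠ o z)
    (hokIn : ∀ z ≠ y, ∀ v ∈ T \ Set.range t, ∀ w, O.Adj v w → c w v ≠ i z)
    (hro : ∀ v ∈ T \ Set.range t, ∀ v' ∈ T \ Set.range t, ∀ w w', O.Adj v w → O.Adj v' w' →
      c v w = c v' w' → v = v' ∧ w = w')
    (hri : ∀ v ∈ T \ Set.range t, ∀ v' ∈ T \ Set.range t, ∀ w w', O.Adj v w → O.Adj v' w' →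
      c w v = c w' v' → v = v' ∧ w = w')
    {A B : V × V} (hA : IsExit O W A) (hB : IsExit O W B) (hAB : A ≠ B) :
    ∃ c', IsState G (expose G O (Set.range t)) (T \ Set.range t) c' ∧
      (HasGoodArc (expose G O (Set.range t)) W c' ∨
        HasGoodPair (expose G O (Set.range t)) W c') := by
  have hne : x ≠ y := by
    rintro rfl
    have h1 := (hxy x x).2 ⟨rfl, rfl⟩
    rw [ho', hi'] at h1
    exact hc.ne _ _ (h.isExit x).2 h1
  have he : patternOf o i = fun z => if z = y then (x : ℕ) else 3 + z := by
    funext z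
    split_ifs with hz
    · exact patternOf_eq ho ((hxy x z).2 ⟨rfl, hz⟩)
    · exact patternOf_eq_add fun y' hy' => hz ((hxy y' z).1 hy').2
  have hs := star_closing_search
  simp only [List.all_eq_true, List.mem_finRange, true_implies] at hs
  have hs := hs x y
  rw [Bool.or_eq_true, Nat.beq_eq, ← he] at hs
  obtain ⟨N, -, hN⟩ := List.any_eq_true.1 (hs.resolve_left fun h => hne (Fin.ext h))
  simp only [Bool.and_eq_true, Bool.or_eq_true, Bool.not_eq_true', ← Bool.not_eq_true, Nat.beq_eq,
    Nat.ble_eq] at hN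
  obtain ⟨hN, hcase⟩ := hN
  obtain ⟨c', g, hst, hold, hg, -, -, hent, hbig, hnew⟩ := h.exists_extension hc ho' hi' ho hi hW
    (okOut := fun z => !(Nat.beq z x)) (okIn := fun z => !(Nat.beq z y))
    (fun z hz => hokOut z (by rintro rfl; simp at hz))
    (fun z hz => hokIn z (by rintro rfl; simp at hz)) hro hri hN
  refine ⟨c', hst, ?_⟩
  have hP := h.isExit_starEntry (Or.inl rfl : (1 : Fin 4) = 1 ∨ (1 : Fin 4) = 2)
  have hQ := h.isExit_starEntry (Or.inr rfl : (2 : Fin 4) = 1 ∨ (2 : Fin 4) = 2)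
  have hPA := fun {u} (hu : IsExit O W u) =>
    h.starEntry_ne (Or.inl rfl : (1 : Fin 4) = 1 ∨ (1 : Fin 4) = 2) hu
  have hQA := fun {u} (hu : IsExit O W u) =>
    h.starEntry_ne (Or.inr rfl : (2 : Fin 4) = 1 ∨ (2 : Fin 4) = 2) hu
  have hPQ := h.starEntry_ne'
  set P := starEntry t nb 1 with hPdef
  set Q := starEntry t nb 2 with hQdef
  have e12 : c' P.1 P.2 = c' Q.2 Q.1 ↔ colorIn (starLink id) (patternOf o i) N 1 =
      colorOut (starLink id) (patternOf o i) N 2 := by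
    rw [(hent 1).1, (hent 2).2, hg.eq_iff]
  have e21 : c' Q.1 Q.2 = c' P.2 P.1 ↔ colorIn (starLink id) (patternOf o i) N 2 =
      colorOut (starLink id) (patternOf o i) N 1 := by
    rw [(hent 2).1, (hent 1).2, hg.eq_iff]
  rw [← e12, ← e21] at hcase
  -- An arc between the first two half-edges is the only one, so it is not part of a 3-cycle.
  have hsingle : (c' P.1 P.2 = c' Q.2 Q.1 ∧ c' Q.1 Q.2 ≠ c' P.2 P.1 ∨
      c' Q.1 Q.2 = c' P.2 P.1 ∧ c' P.1 P.2 ≠ c' Q.2 Q.1) →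
      HasGoodArc (expose G O (Set.range t)) W c' := by
    intro hcase
    have hnP : ¬ O.Adj P.1 P.2 := fun hO => hPA ⟨hP.1, hO⟩ rfl
    have hnQ : ¬ O.Adj Q.1 Q.2 := fun hO => hQA ⟨hQ.1, hO⟩ rfl
    have hmix : ∀ u, IsExit O W u → c' P.1 P.2 ≠ c' u.2 u.1 ∧ c' u.1 u.2 ≠ c' P.2 P.1 ∧
        c' Q.1 Q.2 ≠ c' u.2 u.1 ∧ c' u.1 u.2 ≠ c' Q.2 Q.1 := by
      intro u hu
      rw [hold _ _ hu.2, hold _ _ hu.2.symm]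
      exact ⟨((hnew _ _ hP.2).resolve_left hnP u hu).2,
        ((hnew _ _ hP.2.symm).resolve_left (fun h => hnP h.symm) u hu).1.symm,
        ((hnew _ _ hQ.2).resolve_left hnQ u hu).2,
        ((hnew _ _ hQ.2.symm).resolve_left (fun h => hnQ h.symm) u hu).1.symm⟩
    have hold2 : ∀ u v, IsExit O W u → IsExit O W v → c' u.1 u.2 ≠ c' v.2 v.1 := by
      intro u v hu hv
      rw [hold _ _ hu.2, hold _ _ hv.2.symm]
      exact fun h => harc u v ⟨hu, hv, h⟩
    have hPP := hst.ne _ _ hP.2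
    have hQQ := hst.ne _ _ hQ.2
    refine ⟨![P, Q, A, B], ?_, ?_, ?_⟩
    · intro s s' hss
      fin_cases s <;> fin_cases s' <;> simp at hss <;> first | rfl | skip
      exacts [(hPQ hss).elim, (hPA hA hss).elim, (hPA hB hss).elim, (hPQ hss.symm).elim,
        (hQA hA hss).elim, (hQA hB hss).elim, (hPA hA hss.symm).elim, (hQA hA hss.symm).elim,
        (hAB hss).elim, (hPA hB hss.symm).elim, (hQA hB hss.symm).elim, (hAB hss.symm).elim]
    · intro s
      fin_cases s
      exacts [hP, hQ, expose_of_isExit hA, expose_of_isExit hB]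
    · have hno : ∀ s s' : Fin 4,
          c' ((![P, Q, A, B] : Fin 4 → V × V) s).1 ((![P, Q, A, B] : Fin 4 → V × V) s).2 =
          c' ((![P, Q, A, B] : Fin 4 → V × V) s').2 ((![P, Q, A, B] : Fin 4 → V × V) s').1 →
          s = 0 ∧ s' = 1 ∨ s = 1 ∧ s' = 0 := by
        intro s s' hss
        have hAm := hmix A hA
        have hBm := hmix B hB
        fin_cases s <;> fin_cases s' <;> first
          | exact Or.inl ⟨rfl, rfl⟩
          | exact Or.inr ⟨rfl, rfl⟩
          | exact absurd hss hPP
          | exact absurd hss hQQ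
          | exact absurd hss hAm.1
          | exact absurd hss hAm.2.1
          | exact absurd hss hAm.2.2.1
          | exact absurd hss hAm.2.2.2
          | exact absurd hss hBm.1
          | exact absurd hss hBm.2.1
          | exact absurd hss hBm.2.2.1
          | exact absurd hss hBm.2.2.2
          | exact absurd hss (hold2 _ _ hA hA)
          | exact absurd hss (hold2 _ _ hA hB)
          | exact absurd hss (hold2 _ _ hB hA)
          | exact absurd hss (hold2 _ _ hB hB)
      rw [goodFour_iff]
      constructor
      · rcases hcase with hcase | hcase
        · exact ⟨0, 1, hcase.1⟩
        · exact ⟨1, 0, hcase.1⟩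
      · intro s s' z h1 h2 h3
        rcases hno _ _ h1 with ⟨rfl, rfl⟩ | ⟨rfl, rfl⟩ <;>
          rcases hno _ _ h2 with ⟨h4, rfl⟩ | ⟨h4, rfl⟩ <;>
          rcases hno _ _ h3 with ⟨h5, h6⟩ | ⟨h5, h6⟩ <;> revert h4 h5 h6 <;> decide
  rcases hcase with hcase | ⟨⟨h12, h21⟩, hcase⟩
  · exact Or.inl (hsingle hcase)
  · right
    have key : ∀ {v}, IsExit (expose G O (Set.range t)) W v → v ≠ A →
        ((∃ m, 6 ≤ m ∧ c' v.1 v.2 = g m) ∨ ∃ m, 6 ≤ m ∧ c' v.2 v.1 = g m) →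
        HasGoodPair (expose G O (Set.range t)) W c' := by
      intro v hv hvA hm
      refine h.hasGoodPair hold hnew hst.ne harc h12 h21 hv hA hvA ?_
      rcases hm with ⟨m, hm, hvm⟩ | ⟨m, hm, hvm⟩
      · left
        intro v w _ h1
        exact absurd (h1.trans hvm) (hbig m hm v w)
      · right
        intro v w _ _ h2
        exact hbig m hm w v (h2.trans hvm)
    rcases hcase with ((h1 | h1) | h1) | h1
    · exact key hP (hPA hA) (Or.inl ⟨_, h1, (hent 1).1⟩)
    · exact key hQ (hQA hA) (Or.inl ⟨_, h1, (hent 2).1⟩)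
    · exact key hP (hPA hA) (Or.inr ⟨_, h1, (hent 1).2⟩)
    · exact key hQ (hQA hA) (Or.inr ⟨_, h1, (hent 2).2⟩)

/-- In a state without arcs, the colours at the star fork and at the exits of `W` are all different.
-/
theorem colors_ne (h : IsStar G O T W t nb) (hc : IsState G O T c)
    (harc : ∀ x y, ¬ IsArc O (W ∪ Set.range t) c x y) {u : V × V} (hu : IsExit O W u) (z : Fin 3) :
    c (starExit t nb z).1 (starExit t nb z).2 ≠ c u.1 u.2 ∧
    c (starExit t nb z).2 (starExit t nb z).1 ≠ c u.1 u.2 ∧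
    c (starExit t nb z).1 (starExit t nb z).2 ≠ c u.2 u.1 ∧
    c (starExit t nb z).2 (starExit t nb z).1 ≠ c u.2 u.1 := by
  have hu' : IsExit O (W ∪ Set.range t) u := ⟨Or.inl hu.1, hu.2⟩
  have hz := h.isExit z
  have hzT : (starExit t nb z).1 ∈ T := h.piece.mem _
  have hne := h.starExit_ne z hu.1
  refine ⟨fun h1 => hne ?_, fun h1 => harc _ _ ⟨hu', hz, h1.symm⟩, fun h1 => harc _ _ ⟨hz, hu', h1⟩,
    fun h1 => hne ?_⟩
  · exact Prod.ext_iff.2 (hc.out_inj _ hzT _ (h.subset hu.1) _ _ hz.2 hu.2 h1)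
  · exact Prod.ext_iff.2 (hc.in_inj _ hzT _ (h.subset hu.1) _ _ hz.2 hu.2 h1)

theorem out_ne (h : IsStar G O T W t nb) (hc : IsState G O T c) (z : Fin 3) :
    ∀ v ∈ T \ Set.range t, ∀ w, O.Adj v w →
      c v w ≠ c (starExit t nb z).1 (starExit t nb z).2 := by
  intro v hv w hvw heq
  exact hv.2 ⟨_, (hc.out_inj v hv.1 _ (h.piece.mem _) _ _ hvw (h.isExit z).2 heq).1.symm⟩

theorem in_ne (h : IsStar G O T W t nb) (hc : IsState G O T c) (z : Fin 3) :
    ∀ v ∈ T \ Set.range t, ∀ w, O.Adj v w →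
      c w v ≠ c (starExit t nb z).2 (starExit t nb z).1 := by
  intro v hv w hvw heq
  exact hv.2 ⟨_, (hc.in_inj v hv.1 _ (h.piece.mem _) _ _ hvw (h.isExit z).2 heq).1.symm⟩

theorem out_injective (h : IsStar G O T W t nb) (hc : IsState G O T c) :
    Function.Injective fun z => c (starExit t nb z).1 (starExit t nb z).2 := fun z z' hz =>
  h.starExit_injective (Prod.ext_iff.2
    (hc.out_inj _ (h.piece.mem _) _ (h.piece.mem _) _ _ (h.isExit z).2 (h.isExit z').2 hz))

theorem in_injective (h : IsStar G O T W t nb) (hc : IsState G O T c) :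
    Function.Injective fun z => c (starExit t nb z).2 (starExit t nb z).1 := fun z z' hz =>
  h.starExit_injective (Prod.ext_iff.2
    (hc.in_inj _ (h.piece.mem _) _ (h.piece.mem _) _ _ (h.isExit z).2 (h.isExit z').2 hz))

/-- A good pair with an exit of the star fork is passed on to the half-edges of the star fork. -/
theorem exists_state_of_pass [Finite V] (h : IsStar G O T W t nb) (hc : IsState G O T c)
    (harc : ∀ x y, ¬ IsArc O (W ∪ Set.range t) c x y) {x u : V × V}
    (hx : IsExit O (W ∪ Set.range t) x) (hu : IsExit O W u) (hxu : x ≠ u)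
    (hpair : (∀ v w, O.Adj v w → c v w = c x.1 x.2 → c w v ≠ c u.2 u.1) ∨
      ∀ v w, O.Adj v w → c v w = c u.1 u.2 → c w v ≠ c x.2 x.1) :
    ∃ c', IsState G (expose G O (Set.range t)) (T \ Set.range t) c' ∧
        HasGoodPair (expose G O (Set.range t)) W c' := by
  have harcW : ∀ x y, ¬ IsArc O W c x y := fun x y hxy =>
    harc x y ⟨⟨Or.inl hxy.1.1, hxy.1.2⟩, ⟨Or.inl hxy.2.1.1, hxy.2.1.2⟩, hxy.2.2⟩
  set o : Fin 3 → ℕ := fun z => c (starExit t nb z).1 (starExit t nb z).2 with ho'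
  set i : Fin 3 → ℕ := fun z => c (starExit t nb z).2 (starExit t nb z).1 with hi'
  have he : patternOf o i = fun z : Fin 3 => 3 + (z : ℕ) := by
    funext z
    exact patternOf_eq_add fun y hy => harc _ _ ⟨h.isExit y, h.isExit z, hy⟩
  have hs := star_pass_search
  simp only [List.all_eq_true, List.mem_finRange, true_implies, Bool.and_eq_true,
    List.any_eq_true, ← he] at hs
  have hmain := fun (N : ℕ) (hN : validBits (starLink id) (fun _ => true) (fun _ => true)
      (patternOf o i) N = true) => h.exists_extension hc.toIsFaceColoring (fun _ => rfl)
    (fun _ => rfl) (h.out_injective hc) (h.in_injective hc)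
    (fun u hu z => h.colors_ne hc harc hu z)
    (okOut := fun _ => true) (okIn := fun _ => true)
    (fun z _ => h.out_ne hc z) (fun z _ => h.in_ne hc z)
    (fun v hv v' hv' => hc.out_inj v hv.1 v' hv'.1)
    (fun v hv v' hv' => hc.in_inj v hv.1 v' hv'.1) hN
  have hP := h.isExit_starEntry (Or.inl rfl : (1 : Fin 4) = 1 ∨ (1 : Fin 4) = 2)
  have hQ := h.isExit_starEntry (Or.inr rfl : (2 : Fin 4) = 1 ∨ (2 : Fin 4) = 2)
  have hPA := h.starEntry_ne (Or.inl rfl : (1 : Fin 4) = 1 ∨ (1 : Fin 4) = 2) hu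
  have hQA := h.starEntry_ne (Or.inr rfl : (2 : Fin 4) = 1 ∨ (2 : Fin 4) = 2) hu
  have hbeq : ∀ {a b : ℕ}, Nat.beq a b = true ↔ a = b := by simp
  rcases hpair with hp | hp
  · obtain ⟨z, hz⟩ : ∃ z : Fin 3, ∀ k, x = starExit t nb k → z = k := by
      rcases h.exit_cases hx with hx | ⟨z, rfl⟩
      · exact ⟨0, fun k hk => absurd hk.symm (h.starExit_ne k hx.1)⟩
      · exact ⟨z, fun k hk => h.starExit_injective hk⟩
    obtain ⟨N, -, ⟨⟨hN, h12⟩, h21⟩, hcase⟩ := (hs z).1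
    obtain ⟨c', g, hst, hold, hg, hgo, -, hent, -, hnew⟩ := hmain N hN
    refine ⟨c', hst, ?_⟩
    have e12 : c' (starEntry t nb 1).1 (starEntry t nb 1).2 ≠
        c' (starEntry t nb 2).2 (starEntry t nb 2).1 := by
      rw [(hent 1).1, (hent 2).2, hg.ne_iff]
      simpa [← Bool.not_eq_true, Nat.beq_eq] using h12
    have e21 : c' (starEntry t nb 2).1 (starEntry t nb 2).2 ≠
        c' (starEntry t nb 1).2 (starEntry t nb 1).1 := by
      rw [(hent 2).1, (hent 1).2, hg.ne_iff]
      simpa [← Bool.not_eq_true, Nat.beq_eq] using h21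
    rcases h.exit_cases hx with hx | ⟨k, rfl⟩
    · exact h.hasGoodPair hold hnew hst.ne harcW e12 e21 (expose_of_isExit hx) hu hxu
        (Or.inl fun v w hvw h1 => hp v w hvw (by rw [h1, hold _ _ hx.2]))
    · obtain rfl := hz k rfl
      rw [Bool.or_eq_true, hbeq, hbeq] at hcase
      rcases hcase with h1 | h1
      · exact h.hasGoodPair hold hnew hst.ne harcW e12 e21 hP hu hPA
          (Or.inl fun v w hvw h2 => hp v w hvw (by rw [h2, (hent 1).1, h1, hgo]))
      · exact h.hasGoodPair hold hnew hst.ne harcW e12 e21 hQ hu hQA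
          (Or.inl fun v w hvw h2 => hp v w hvw (by rw [h2, (hent 2).1, h1, hgo]))
  · obtain ⟨z, hz⟩ : ∃ z : Fin 3, ∀ k, x = starExit t nb k → z = k := by
      rcases h.exit_cases hx with hx | ⟨z, rfl⟩
      · exact ⟨0, fun k hk => absurd hk.symm (h.starExit_ne k hx.1)⟩
      · exact ⟨z, fun k hk => h.starExit_injective hk⟩
    obtain ⟨N, -, ⟨⟨hN, h12⟩, h21⟩, hcase⟩ := (hs z).2
    obtain ⟨c', g, hst, hold, hg, -, hgi, hent, -, hnew⟩ := hmain N hN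
    refine ⟨c', hst, ?_⟩
    have e12 : c' (starEntry t nb 1).1 (starEntry t nb 1).2 ≠
        c' (starEntry t nb 2).2 (starEntry t nb 2).1 := by
      rw [(hent 1).1, (hent 2).2, hg.ne_iff]
      simpa [← Bool.not_eq_true, Nat.beq_eq] using h12
    have e21 : c' (starEntry t nb 2).1 (starEntry t nb 2).2 ≠
        c' (starEntry t nb 1).2 (starEntry t nb 1).1 := by
      rw [(hent 2).1, (hent 1).2, hg.ne_iff]
      simpa [← Bool.not_eq_true, Nat.beq_eq] using h21
    rcases h.exit_cases hx with hx | ⟨k, rfl⟩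
    · exact h.hasGoodPair hold hnew hst.ne harcW e12 e21 (expose_of_isExit hx) hu hxu
        (Or.inr fun v w hvw h1 h2 => hp v w hvw h1 (by rw [h2, hold _ _ hx.2.symm]))
    · obtain rfl := hz k rfl
      have hgz : g (3 + z) = c (starExit t nb z).2 (starExit t nb z).1 := by
        rw [← hgi z, he]
      rw [Bool.or_eq_true, hbeq, hbeq] at hcase
      rcases hcase with h1 | h1
      · exact h.hasGoodPair hold hnew hst.ne harcW e12 e21 hP hu hPA
          (Or.inr fun v w hvw h2 h3 => hp v w hvw h2 (by rw [h3, (hent 1).2, h1, hgz]))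
      · exact h.hasGoodPair hold hnew hst.ne harcW e12 e21 hQ hu hQA
          (Or.inr fun v w hvw h2 h3 => hp v w hvw h2 (by rw [h3, (hent 2).2, h1, hgz]))

/-- A good pair of two exits of the star fork is joined and then closed. -/
theorem exists_state_of_merge [Finite V] (h : IsStar G O T W t nb) (hc : IsState G O T c)
    (harc : ∀ x y, ¬ IsArc O (W ∪ Set.range t) c x y) {x y : Fin 3} (hxy : x ≠ y)
    (hpair : ∀ v w, O.Adj v w → c v w = c (starExit t nb x).1 (starExit t nb x).2 →
      c w v ≠ c (starExit t nb y).2 (starExit t nb y).1)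
    {A B : V × V} (hA : IsExit O W A) (hB : IsExit O W B) (hAB : A ≠ B) :
    ∃ c', IsState G (expose G O (Set.range t)) (T \ Set.range t) c' ∧
      (HasGoodArc (expose G O (Set.range t)) W c' ∨
        HasGoodPair (expose G O (Set.range t)) W c') := by
  have hU : W ∪ Set.range t ⊆ T := by
    rintro v (hv | ⟨a, rfl⟩)
    · exact h.subset hv
    · exact h.piece.mem a
  have hux : ∀ {u}, IsExit O W u → IsExit O (W ∪ Set.range t) u := fun hu => ⟨Or.inl hu.1, hu.2⟩
  have hmem : ∀ z, (starExit t nb z).1 ∈ T := fun z => h.piece.mem _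
  have hR : T \ Set.range t ⊆ T := Set.sdiff_subset
  have hnR : ∀ z, (starExit t nb z).1 ∉ T \ Set.range t := fun z hz => hz.2 ⟨_, rfl⟩
  set κ := c (starExit t nb y).2 (starExit t nb y).1 with hκ
  set c₁ := merge c (c (starExit t nb x).1 (starExit t nb x).2) κ with hc₁
  have hout : ∀ z ≠ x, c₁ (starExit t nb z).1 (starExit t nb z).2 =
      c (starExit t nb z).1 (starExit t nb z).2 := fun z hz =>
    hc.merge_out hU (h.isExit x) κ (hmem z) (h.isExit z).2 fun h1 => hz (h.starExit_injective h1)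
  have houtx : c₁ (starExit t nb x).1 (starExit t nb x).2 = κ := merge_self _ κ
  have hin : ∀ z, c₁ (starExit t nb z).2 (starExit t nb z).1 =
      c (starExit t nb z).2 (starExit t nb z).1 :=
    fun z => merge_in harc (h.isExit x) κ (h.isExit z)
  have hinW : ∀ {u}, IsExit O W u → c₁ u.2 u.1 = c u.2 u.1 := fun hu =>
    merge_in harc (h.isExit x) κ (hux hu)
  have houtR : ∀ {v w}, v ∈ T \ Set.range t → O.Adj v w → c₁ v w = c v w := fun {v w} hv hvw =>
    hc.merge_out hU (h.isExit x) κ hv.1 hvw fun h1 => hv.2 ⟨_, (Prod.ext_iff.1 h1).1.symm⟩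
  have houtW : ∀ {u}, IsExit O W u → c₁ u.1 u.2 = c u.1 u.2 := fun {u} hu =>
    hc.merge_out hU (h.isExit x) κ (h.subset hu.1) hu.2 fun h1 => h.starExit_ne x hu.1 h1.symm
  have hin_inj : ∀ z z', c (starExit t nb z).2 (starExit t nb z).1 =
      c (starExit t nb z').2 (starExit t nb z').1 → z = z' :=
    fun _ _ hz => h.in_injective hc hz
  refine h.exists_state_of_closing (hc.toIsFaceColoring.merge hpair) (fun _ => rfl) (fun _ => rfl)
    ?_ ?_ ?_ ?_ (x := x) (y := y) ?_ ?_ ?_ ?_ ?_ hA hB hAB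
  · intro z z' hz
    change c₁ _ _ = c₁ _ _ at hz
    by_cases h1 : z = x <;> by_cases h2 : z' = x
    · rw [h1, h2]
    · rw [h1, houtx, hout z' h2] at hz
      exact absurd ⟨h.isExit z', h.isExit y, hz.symm⟩ (harc _ _)
    · rw [h2, houtx, hout z h1] at hz
      exact absurd ⟨h.isExit z, h.isExit y, hz⟩ (harc _ _)
    · rw [hout z h1, hout z' h2] at hz
      exact h.out_injective hc hz
  · intro z z' hz
    change c₁ _ _ = c₁ _ _ at hz
    rw [hin, hin] at hz
    exact hin_inj _ _ hz
  · intro u hu z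
    change c₁ _ _ ≠ c₁ _ _ ∧ c₁ _ _ ≠ c₁ _ _ ∧ c₁ _ _ ≠ c₁ _ _ ∧ c₁ _ _ ≠ c₁ _ _
    rw [hinW hu, houtW hu, hin]
    have h1 := h.colors_ne hc harc hu z
    refine ⟨?_, h1.2.1, ?_, h1.2.2.2⟩
    · by_cases hz : z = x
      · rw [hz, houtx]
        exact (h.colors_ne hc harc hu y).2.1
      · rw [hout z hz]
        exact h1.1
    · by_cases hz : z = x
      · rw [hz, houtx]
        exact (h.colors_ne hc harc hu y).2.2.2
      · rw [hout z hz]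
        exact h1.2.2.1
  · rintro u v ⟨hu, hv, huv⟩
    change c₁ _ _ = c₁ _ _ at huv
    rw [houtW hu, hinW hv] at huv
    exact harc u v ⟨hux hu, hux hv, huv⟩
  · intro z z'
    change c₁ _ _ = c₁ _ _ ↔ _
    rw [hin]
    constructor
    · intro hz
      by_cases h1 : z = x
      · rw [h1, houtx] at hz
        exact ⟨h1, (hin_inj _ _ hz).symm⟩
      · rw [hout z h1] at hz
        exact absurd ⟨h.isExit z, h.isExit z', hz⟩ (harc _ _)
    · rintro ⟨rfl, rfl⟩
      exact houtx
  · intro z hz v hv w hvw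
    change c₁ _ _ ≠ c₁ _ _
    rw [houtR hv hvw, hout z hz]
    exact h.out_ne hc z v hv w hvw
  · intro z hz v hv w hvw
    change c₁ _ _ ≠ c₁ _ _
    rw [hin]
    exact hc.merge_in_ne hU (h.isExit y) hR (h.isExit z) (hnR z)
      (fun h1 => hz (h.starExit_injective h1)) v hv w hvw
  · intro v hv v' hv' w w' hvw hvw' heq
    change c₁ _ _ = c₁ _ _ at heq
    rw [houtR hv hvw, houtR hv' hvw'] at heq
    exact hc.out_inj v hv.1 v' hv'.1 w w' hvw hvw' heq
  · exact hc.merge_in_inj hU (h.isExit y) hR (hnR y)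

end IsStar
end Star

section Star

variable {V : Type u} {G O : SimpleGraph V} {T W : Set V} {t : Fin 4 → V} {nb : Fin 4 → Fin 3 → V}
  {c : V → V → ℕ}

namespace IsStar

/-- The outside edges of the star fork get the first three of five numbers. -/
theorem isPiece_five (h : IsStar G O T W t nb) :
    IsPiece G O T t nb (starLink (n := 5) ![0, 1, 2]) := by
  have hi : ∀ a p b q, isInner (starLink (n := 5) ![0, 1, 2]) a p b q =
      isInner (starLink (n := 3) id) a p b q := by decide +kernel
  have hd : ∀ a p, isDown (starLink (n := 5) ![0, 1, 2]) a p =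
      isDown (starLink (n := 3) id) a p := by decide
  have hu : ∀ a p x, isUp (starLink (n := 5) ![0, 1, 2]) a p x = true →
      ∃ y, isUp (starLink (n := 3) id) a p y = true := by decide
  refine ⟨h.piece.inj, h.piece.mem, h.piece.adj, h.piece.nb_inj, fun a p b q hl => ?_,
    fun a p x hl => ?_, fun a p hl => ?_⟩
  · have h1 := h.piece.inner a p b q (isInner_iff.1 (hi a p b q ▸ isInner_iff.2 hl))
    exact ⟨h1.1, isInner_iff.1 ((hi b q a p).trans (isInner_iff.2 h1.2.1)), h1.2.2⟩
  · obtain ⟨y, hy⟩ := hu a p x (isUp_iff.2 hl)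
    exact h.piece.up a p y (isUp_iff.1 hy)
  · exact h.piece.down a p (isDown_iff.1 (hd a p ▸ isDown_iff.2 hl))

/-- The three exits of the star fork, and two others. -/
def fiveExits (t : Fin 4 → V) (nb : Fin 4 → Fin 3 → V) (a b : V × V) : Fin 5 → V × V :=
  ![starExit t nb 0, starExit t nb 1, starExit t nb 2, a, b]

/-- Five exits with suitable arcs provide a good arc at the lower level. -/
theorem exists_state_of_five [Finite V] (h : IsStar G O T W t nb) (hc : IsState G O T c)
    {a b : V × V} (ha : IsExit O W a) (hb : IsExit O W b) (hab : a ≠ b)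
    (hyp : ∀ e : Fin 5 → ℕ, (∀ s s', c (fiveExits t nb a b s).1 (fiveExits t nb a b s).2 =
        c (fiveExits t nb a b s').2 (fiveExits t nb a b s').1 → e s' = s) →
      ((∃ s, e s < 5) ∧ ¬ ((e 0 = 1 ∨ e 1 = 0) ∧ (5 ≤ e 0 ∨ 5 ≤ e 1) ∧
        5 ≤ e 2 ∧ 5 ≤ e 3 ∧ 5 ≤ e 4))) :
    ∃ c', IsState G (expose G O (Set.range t)) (T \ Set.range t) c' ∧
      HasGoodArc (expose G O (Set.range t)) W c' := by
  have hex : ∀ s, (fiveExits t nb a b s).1 ∈ T ∧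
      O.Adj (fiveExits t nb a b s).1 (fiveExits t nb a b s).2 := by
    intro s
    fin_cases s
    exacts [⟨h.piece.mem _, (h.isExit 0).2⟩, ⟨h.piece.mem _, (h.isExit 1).2⟩,
      ⟨h.piece.mem _, (h.isExit 2).2⟩, ⟨h.subset ha.1, ha.2⟩, ⟨h.subset hb.1, hb.2⟩]
  have hinj : Function.Injective (fiveExits t nb a b) := by
    have h01 : starExit t nb 0 ≠ starExit t nb 1 := h.starExit_injective.ne (by decide)
    have h02 : starExit t nb 0 ≠ starExit t nb 2 := h.starExit_injective.ne (by decide)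
    have h12 : starExit t nb 1 ≠ starExit t nb 2 := h.starExit_injective.ne (by decide)
    intro s s' hss
    fin_cases s <;> fin_cases s' <;> first | rfl | skip
    all_goals first
      | exact absurd hss h01 | exact absurd hss h02 | exact absurd hss h12 | exact absurd hss hab
      | exact absurd hss.symm h01 | exact absurd hss.symm h02 | exact absurd hss.symm h12
      | exact absurd hss.symm hab | exact absurd hss (h.starExit_ne _ ha.1)
      | exact absurd hss (h.starExit_ne _ hb.1) | exact absurd hss.symm (h.starExit_ne _ ha.1)
      | exact absurd hss.symm (h.starExit_ne _ hb.1)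
  set o : Fin 5 → ℕ := fun s => c (fiveExits t nb a b s).1 (fiveExits t nb a b s).2 with ho'
  set i : Fin 5 → ℕ := fun s => c (fiveExits t nb a b s).2 (fiveExits t nb a b s).1 with hi'
  have ho : Function.Injective o := fun s s' hss => hinj (Prod.ext_iff.2
    (hc.out_inj _ (hex s).1 _ (hex s').1 _ _ (hex s).2 (hex s').2 hss))
  have hi : Function.Injective i := fun s s' hss => hinj (Prod.ext_iff.2
    (hc.in_inj _ (hex s).1 _ (hex s').1 _ _ (hex s).2 (hex s').2 hss))
  have hoi : ∀ s, o s ≠ i s := fun s => hc.ne _ _ (hex s).2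
  obtain ⟨N, hN⟩ := exists_of_search star_arc_search (isPattern_patternOf ho hi hoi) (by
    have h1 := hyp (patternOf o i) fun s s' hss => patternOf_eq ho hss
    obtain ⟨⟨s, hs⟩, h1⟩ := h1
    rw [Bool.and_eq_true]
    refine ⟨List.any_eq_true.2 ⟨s, List.mem_finRange s, by simpa [Nat.blt_eq] using hs⟩, ?_⟩
    rw [Bool.not_eq_true', ← Bool.not_eq_true]
    simpa only [Bool.and_eq_true, Bool.or_eq_true, Nat.beq_eq, Nat.ble_eq, and_assoc] using h1)
  simp only [Bool.and_eq_true] at hN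
  obtain ⟨hN, hgood⟩ := hN
  have hstar : ∀ x : Fin 3, fiveExits t nb a b ((![0, 1, 2] : Fin 3 → Fin 5) x) =
      starExit t nb x := by
    intro x
    fin_cases x <;> rfl
  have hlt : ∀ x : Fin 5, Nat.blt x 3 = true →
      fiveExits t nb a b x ∈ Set.range (starExit t nb) := by
    intro x hx
    fin_cases x
    exacts [⟨0, rfl⟩, ⟨1, rfl⟩, ⟨2, rfl⟩, absurd hx (by decide), absurd hx (by decide)]
  obtain ⟨c', M, hst, hold, hcol, -, hMo, hMi⟩ := h.isPiece_five.extend_of_valid hc.toIsFaceColoring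
    ho hi hoi
    (fun a p x hl => by
      have key : ∀ (a : Fin 4) (p : Fin 3) (x : Fin 5),
          isUp (starLink (n := 5) ![0, 1, 2]) a p x = true →
          ∃ y : Fin 3, a = y.succ ∧ p = 2 ∧ x = (![0, 1, 2] : Fin 3 → Fin 5) y := by
        decide +kernel
      obtain ⟨y, rfl, rfl, rfl⟩ := key a p x (isUp_iff.2 hl)
      simp only [ho', hi', hstar]
      exact ⟨rfl, rfl⟩)
    (fun x hx => by
      obtain ⟨z, hz⟩ := hlt x hx
      simp only [ho', ← hz]
      exact h.out_ne hc z)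
    (fun x hx => by
      obtain ⟨z, hz⟩ := hlt x hx
      simp only [hi', ← hz]
      exact h.in_ne hc z)
    (fun v hv v' hv' => hc.out_inj v hv.1 v' hv'.1)
    (fun v hv v' hv' => hc.in_inj v hv.1 v' hv'.1) hN
  have hP := h.isExit_starEntry (Or.inl rfl : (1 : Fin 4) = 1 ∨ (1 : Fin 4) = 2)
  have hQ := h.isExit_starEntry (Or.inr rfl : (2 : Fin 4) = 1 ∨ (2 : Fin 4) = 2)
  have hPA := fun {u} (hu : IsExit O W u) =>
    h.starEntry_ne (Or.inl rfl : (1 : Fin 4) = 1 ∨ (1 : Fin 4) = 2) hu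
  have hQA := fun {u} (hu : IsExit O W u) =>
    h.starEntry_ne (Or.inr rfl : (2 : Fin 4) = 1 ∨ (2 : Fin 4) = 2) hu
  have hPQ := h.starEntry_ne'
  refine ⟨c', hst, ![starEntry t nb 1, starEntry t nb 2, a, b], ?_, ?_, ?_⟩
  · intro s s' hss
    fin_cases s <;> fin_cases s' <;> first | rfl | skip
    exacts [(hPQ hss).elim, (hPA ha hss).elim, (hPA hb hss).elim, (hPQ hss.symm).elim,
      (hQA ha hss).elim, (hQA hb hss).elim, (hPA ha hss.symm).elim, (hQA ha hss.symm).elim,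
      (hab hss).elim, (hPA hb hss.symm).elim, (hQA hb hss.symm).elim, (hab hss.symm).elim]
  · intro s
    fin_cases s
    exacts [hP, hQ, expose_of_isExit ha, expose_of_isExit hb]
  · have hcomp := goodFour_comp (colorOf_injective ho hi hMo hMi) hgood
    convert hcomp using 1
    · congr 1 <;> funext s <;> fin_cases s
      · exact (hcol 1 1).1
      · exact (hcol 2 1).1
      · exact (hold _ _ ha.2).trans (colorOf_out o i M 3).symm
      · exact (hold _ _ hb.2).trans (colorOf_out o i M 4).symm
      · exact (hcol 1 1).2
      · exact (hcol 2 1).2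
      · exact (hold _ _ ha.2.symm).trans (colorOf_in ho hi hoi M 3).symm
      · exact (hold _ _ hb.2.symm).trans (colorOf_in ho hi hoi M 4).symm

/-- The ends of an arc, as far as they are not at the star fork, are among two exits of `W`. -/
theorem exists_two_exits (h : IsStar G O T W t nb) {A B : V × V} (hA : IsExit O W A)
    (hB : IsExit O W B) (hAB : A ≠ B) {x y : V × V} (hx : IsExit O (W ∪ Set.range t) x)
    (hy : IsExit O (W ∪ Set.range t) y) (hxy : x ≠ y) :
    ∃ a b, IsExit O W a ∧ IsExit O W b ∧ a ≠ b ∧ (∃ s, x = fiveExits t nb a b s) ∧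
      ∃ s, y = fiveExits t nb a b s := by
  have hz : ∀ a b z, ∃ s, starExit t nb z = fiveExits t nb a b s := by
    intro a b z
    fin_cases z
    exacts [⟨0, rfl⟩, ⟨1, rfl⟩, ⟨2, rfl⟩]
  have hother : ∀ x, ∃ b, IsExit O W b ∧ x ≠ b := by
    intro x
    by_cases hxA : x = A
    · exact ⟨B, hB, hxA ▸ hAB⟩
    · exact ⟨A, hA, hxA⟩
  rcases h.exit_cases hx with hx' | ⟨z, rfl⟩ <;> rcases h.exit_cases hy with hy' | ⟨z', rfl⟩
  · exact ⟨x, y, hx', hy', hxy, ⟨3, rfl⟩, ⟨4, rfl⟩⟩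
  · obtain ⟨b, hb, hxb⟩ := hother x
    exact ⟨x, b, hx', hb, hxb, ⟨3, rfl⟩, hz _ _ _⟩
  · obtain ⟨b, hb, hyb⟩ := hother y
    exact ⟨y, b, hy', hb, hyb, hz _ _ _, ⟨3, rfl⟩⟩
  · exact ⟨A, B, hA, hB, hAB, hz _ _ _, hz _ _ _⟩

/-- Goodness is passed down through a star fork, provided that `W` has two further exits. -/
theorem exists_state [Finite V] (h : IsStar G O T W t nb) (hc : IsState G O T c)
    (hgood : (∃ x y, IsArc O (W ∪ Set.range t) c x y) ∨ HasGoodPair O (W ∪ Set.range t) c)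
    {A B : V × V} (hA : IsExit O W A) (hB : IsExit O W B) (hAB : A ≠ B) :
    ∃ c', IsState G (expose G O (Set.range t)) (T \ Set.range t) c' ∧
      (HasGoodArc (expose G O (Set.range t)) W c' ∨
        HasGoodPair (expose G O (Set.range t)) W c') := by
  have hU : W ∪ Set.range t ⊆ T := by
    rintro v (hv | ⟨a, rfl⟩)
    · exact h.subset hv
    · exact h.piece.mem a
  have hux : ∀ {u}, IsExit O W u → IsExit O (W ∪ Set.range t) u := fun hu => ⟨Or.inl hu.1, hu.2⟩
  rcases hgood with ⟨x₀, y₀, hxy₀⟩ | ⟨harc, x, y, hxy, hx, hy, hpair⟩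
  · by_cases hout : ∃ x y, IsArc O (W ∪ Set.range t) c x y ∧
        ¬ ((x = starExit t nb 0 ∨ x = starExit t nb 1) ∧
          (y = starExit t nb 0 ∨ y = starExit t nb 1))
    · obtain ⟨x, y, ⟨hx, hy, hxy⟩, hn⟩ := hout
      have hne : x ≠ y := by
        rintro rfl
        exact hc.ne _ _ hx.2 hxy
      obtain ⟨a, b, ha, hb, hab, ⟨s, rfl⟩, ⟨s', rfl⟩⟩ :=
        h.exists_two_exits hA hB hAB hx hy hne
      obtain ⟨c', h1, h2⟩ := h.exists_state_of_five hc ha hb hab fun e he => by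
        have h1 := he s s' hxy
        refine ⟨⟨s', h1 ▸ s.2⟩, ?_⟩
        rintro ⟨h2, h3, h4, h5, h6⟩
        fin_cases s' <;> simp only [Fin.zero_eta, Fin.mk_one, Fin.reduceFinMk] at h1 <;>
          first | omega | skip
        all_goals
          fin_cases s <;> simp at h1 <;> first | omega | skip
        all_goals exact hn (by simp [fiveExits])
      exact ⟨c', h1, Or.inl h2⟩
    · push Not at hout
      by_cases hboth : IsArc O (W ∪ Set.range t) c (starExit t nb 0) (starExit t nb 1) ∧
          IsArc O (W ∪ Set.range t) c (starExit t nb 1) (starExit t nb 0)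
      · obtain ⟨c', h1, h2⟩ := h.exists_state_of_five hc hA hB hAB fun e he => by
          have h1 : e 1 = 0 := he 0 1 hboth.1.2.2
          have h2 : e 0 = 1 := he 1 0 hboth.2.2.2
          refine ⟨⟨0, by omega⟩, ?_⟩
          rintro ⟨-, h3, -⟩
          omega
        exact ⟨c', h1, Or.inl h2⟩
      · -- The only arc joins the first two leaves of the star fork.
        obtain ⟨x, y, hx01, hxy⟩ : ∃ x y : Fin 3, (x = 0 ∧ y = 1 ∨ x = 1 ∧ y = 0) ∧
            ∀ u v, IsArc O (W ∪ Set.range t) c u v ↔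
              u = starExit t nb x ∧ v = starExit t nb y := by
          have hdiag : ∀ u, ¬ IsArc O (W ∪ Set.range t) c u u := fun u hu =>
            hc.ne _ _ hu.1.2 hu.2.2
          by_cases h01 : IsArc O (W ∪ Set.range t) c (starExit t nb 0) (starExit t nb 1)
          · refine ⟨0, 1, Or.inl ⟨rfl, rfl⟩, fun u v => ⟨fun huv => ?_, ?_⟩⟩
            · obtain ⟨rfl | rfl, rfl | rfl⟩ := hout u v huv
              exacts [absurd huv (hdiag _), ⟨rfl, rfl⟩, absurd ⟨h01, huv⟩ hboth,
                absurd huv (hdiag _)]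
            · rintro ⟨rfl, rfl⟩
              exact h01
          · refine ⟨1, 0, Or.inr ⟨rfl, rfl⟩, fun u v => ⟨fun huv => ?_, ?_⟩⟩
            · obtain ⟨rfl | rfl, rfl | rfl⟩ := hout u v huv
              exacts [absurd huv (hdiag _), absurd huv h01, ⟨rfl, rfl⟩, absurd huv (hdiag _)]
            · rintro ⟨rfl, rfl⟩
              obtain ⟨h1 | h1, h2 | h2⟩ := hout x₀ y₀ hxy₀
              · rw [h1, h2] at hxy₀
                exact absurd hxy₀ (hdiag _)
              · rw [h1, h2] at hxy₀
                exact absurd hxy₀ h01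
              · rw [h1, h2] at hxy₀
                exact hxy₀
              · rw [h1, h2] at hxy₀
                exact absurd hxy₀ (hdiag _)
        refine h.exists_state_of_closing hc.toIsFaceColoring (fun _ => rfl) (fun _ => rfl)
          (h.out_injective hc) (h.in_injective hc) ?_ ?_ (x := x) (y := y) ?_
          (fun z _ => h.out_ne hc z) (fun z _ => h.in_ne hc z)
          (fun v hv v' hv' => hc.out_inj v hv.1 v' hv'.1)
          (fun v hv v' hv' => hc.in_inj v hv.1 v' hv'.1) hA hB hAB
        · intro u hu z
          have hz := h.isExit z
          have hzT : (starExit t nb z).1 ∈ T := h.piece.mem _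
          have hne := h.starExit_ne z hu.1
          refine ⟨fun h1 => hne ?_, fun h1 => ?_, fun h1 => ?_, fun h1 => hne ?_⟩
          · exact Prod.ext_iff.2 (hc.out_inj _ hzT _ (h.subset hu.1) _ _ hz.2 hu.2 h1)
          · exact h.starExit_ne x hu.1 ((hxy _ _).1 ⟨hux hu, hz, h1.symm⟩).1.symm
          · exact h.starExit_ne y hu.1 ((hxy _ _).1 ⟨hz, hux hu, h1⟩).2.symm
          · exact Prod.ext_iff.2 (hc.in_inj _ hzT _ (h.subset hu.1) _ _ hz.2 hu.2 h1)
        · rintro u v ⟨hu, hv, huv⟩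
          exact h.starExit_ne x hu.1 ((hxy _ _).1 ⟨hux hu, hux hv, huv⟩).1.symm
        · intro z z'
          have h1 := hxy (starExit t nb z) (starExit t nb z')
          rw [h.starExit_injective.eq_iff, h.starExit_injective.eq_iff] at h1
          rw [← h1]
          exact ⟨fun h2 => ⟨h.isExit z, h.isExit z', h2⟩, fun h2 => h2.2.2⟩
  · rcases h.exit_cases hy with hy' | ⟨z', rfl⟩
    · obtain ⟨c', h1, h2⟩ := h.exists_state_of_pass hc harc hx hy' hxy (Or.inl hpair)
      exact ⟨c', h1, Or.inr h2⟩
    · rcases h.exit_cases hx with hx' | ⟨z, rfl⟩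
      · obtain ⟨c', h1, h2⟩ := h.exists_state_of_pass hc harc hy hx' hxy.symm (Or.inr hpair)
        exact ⟨c', h1, Or.inr h2⟩
      · exact h.exists_state_of_merge hc harc (fun h1 => hxy (congrArg _ h1)) hpair hA hB hAB

end IsStar
end Star

/-! ### The fork -/

section Fork

variable {V : Type u} {G O : SimpleGraph V} {T : Set V} {f : Fin 5 → V} {nb : Fin 5 → Fin 3 → V}
  {c : V → V → ℕ}

/-- The dart that leaves the fork at the vertex `x + 1`. -/
def forkExit (f : Fin 5 → V) (nb : Fin 5 → Fin 3 → V) (x : Fin 4) : V × V :=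
  (f x.succ, nb x.succ 2)

theorem forkLink_up {a : Fin 5} {p : Fin 3} {x : Fin 4} (h : forkLink a p = .up x) :
    a = x.succ ∧ p = 2 := by
  have key : ∀ (a : Fin 5) (p : Fin 3) (x : Fin 4), isUp forkLink a p x = true →
    a = x.succ ∧ p = 2 := by decide
  exact key a p x (isUp_iff.2 h)

theorem forkLink_succ (x : Fin 4) : forkLink x.succ 2 = .up x := by
  fin_cases x <;> rfl

theorem IsPiece.isExit_forkExit (h : IsPiece G O T f nb forkLink) (x : Fin 4) :
    IsExit O (Set.range f) (forkExit f nb x) :=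
  ⟨⟨_, rfl⟩, h.up _ _ x (forkLink_succ x)⟩

theorem IsPiece.forkExit_injective (h : IsPiece G O T f nb forkLink) :
    Function.Injective (forkExit f nb) :=
  fun _ _ hxy => Fin.succ_injective _ (h.inj (Prod.ext_iff.1 hxy).1)

theorem IsPiece.eq_forkExit (h : IsPiece G O T f nb forkLink) (hOG : O ≤ G) {x : V × V}
    (hx : IsExit O (Set.range f) x) : ∃ z, x = forkExit f nb z := by
  obtain ⟨v, w⟩ := x
  obtain ⟨⟨a, rfl⟩, hO⟩ := hx
  simp only at hO
  obtain ⟨p, rfl⟩ := (h.adj a w).1 (hOG hO)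
  rcases hl : forkLink a p with ⟨b, q⟩ | z | _
  · exact absurd hO (h.inner _ _ _ _ hl).2.2
  · obtain ⟨rfl, rfl⟩ := forkLink_up hl
    exact ⟨z, rfl⟩
  · exact absurd hO (h.down _ _ hl).2.2

/-- A good arc, possibly one among several, allows to colour the fork. -/
theorem IsPiece.exists_state_of_hasGoodArc [Finite V] (h : IsPiece G O T f nb forkLink)
    (hOG : O ≤ G) (hc : IsState G O T c) (hgood : HasGoodArc O (Set.range f) c) :
    ∃ c', IsState G (expose G O (Set.range f)) (T \ Set.range f) c' := by
  obtain ⟨d, hd, hex, hgood⟩ := hgood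
  choose π hπ using fun s => h.eq_forkExit hOG (hex s)
  have hπi : Function.Injective π := fun s s' hss => hd (by rw [hπ, hπ, hss])
  have hπs : Function.Surjective π := Finite.surjective_of_injective hπi
  refine h.exists_state hc (P := fun x => (x.succ, 2)) forkLink_succ (fun a p x hl => by
    obtain ⟨rfl, rfl⟩ := forkLink_up hl
    rfl) fun e he hpat => exists_of_search fork_search he ?_
  have ho : Function.Injective fun x => c (forkExit f nb x).1 (forkExit f nb x).2 := fun x y hxy =>
    h.forkExit_injective (Prod.ext_iff.2 (hc.out_inj _ (h.mem _) _ (h.mem _) _ _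
      (h.isExit_forkExit x).2 (h.isExit_forkExit y).2 hxy))
  have key : ∀ s s' : Fin 4, (![0, 1, 2, 3] : Fin 4 → ℕ) s = e s' ↔
      c (forkExit f nb s).1 (forkExit f nb s).2 = c (forkExit f nb s').2 (forkExit f nb s').1 := by
    intro s s'
    have hs : (![0, 1, 2, 3] : Fin 4 → ℕ) s = s := by fin_cases s <;> rfl
    rw [hs]
    constructor
    · intro hss
      exact eq_of_patternOf_eq ho ((hpat s').symm.trans hss.symm)
    · intro hss
      exact ((hpat s').trans (patternOf_eq ho hss)).symm
  rw [goodFour_iff] at hgood ⊢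
  obtain ⟨⟨s, s', hss⟩, hcyc⟩ := hgood
  simp only [hπ] at hss hcyc
  refine ⟨⟨π s, π s', (key _ _).2 hss⟩, fun a b z h1 h2 h3 => ?_⟩
  obtain ⟨a, rfl⟩ := hπs a
  obtain ⟨b, rfl⟩ := hπs b
  obtain ⟨z, rfl⟩ := hπs z
  exact hcyc a b z ((key _ _).1 h1) ((key _ _).1 h2) ((key _ _).1 h3)

/-- A good pair is joined, and the resulting arc is closed inside the fork. -/
theorem IsPiece.exists_state_of_hasGoodPair [Finite V] (h : IsPiece G O T f nb forkLink)
    (hOG : O ≤ G) (hc : IsState G O T c) (hgood : HasGoodPair O (Set.range f) c) :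
    ∃ c', IsState G (expose G O (Set.range f)) (T \ Set.range f) c' := by
  obtain ⟨harc, x, y, hxy, hx, hy, hpair⟩ := hgood
  obtain ⟨x, rfl⟩ := h.eq_forkExit hOG hx
  obtain ⟨y, rfl⟩ := h.eq_forkExit hOG hy
  have hU : Set.range f ⊆ T := by
    rintro _ ⟨a, rfl⟩
    exact h.mem a
  have hex := h.isExit_forkExit
  have hmem : ∀ z, (forkExit f nb z).1 ∈ T := fun z => h.mem _
  have hR : T \ Set.range f ⊆ T := Set.sdiff_subset
  have hnR : ∀ z, (forkExit f nb z).1 ∉ T \ Set.range f := fun z hz => hz.2 ⟨_, rfl⟩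
  set κ := c (forkExit f nb y).2 (forkExit f nb y).1 with hκ
  set c₁ := merge c (c (forkExit f nb x).1 (forkExit f nb x).2) κ with hc₁
  have hc₁f : IsFaceColoring G O T c₁ := hc.toIsFaceColoring.merge hpair
  have hout : ∀ z ≠ x, c₁ (forkExit f nb z).1 (forkExit f nb z).2 =
      c (forkExit f nb z).1 (forkExit f nb z).2 := fun z hz =>
    hc.merge_out hU hx κ (hmem z) (hex z).2 fun h1 => hz (h.forkExit_injective h1)
  have houtx : c₁ (forkExit f nb x).1 (forkExit f nb x).2 = κ := merge_self _ κ
  have hin : ∀ z, c₁ (forkExit f nb z).2 (forkExit f nb z).1 =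
      c (forkExit f nb z).2 (forkExit f nb z).1 := fun z => merge_in harc hx κ (hex z)
  have houtR : ∀ {v w}, v ∈ T \ Set.range f → O.Adj v w → c₁ v w = c v w := fun {v w} hv hvw =>
    hc.merge_out hU hx κ hv.1 hvw fun h1 => hv.2 ⟨_, (Prod.ext_iff.1 h1).1.symm⟩
  set o : Fin 4 → ℕ := fun z => c₁ (forkExit f nb z).1 (forkExit f nb z).2 with ho'
  set i : Fin 4 → ℕ := fun z => c₁ (forkExit f nb z).2 (forkExit f nb z).1 with hi'
  have ho : Function.Injective o := by
    intro z z' hz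
    by_cases h1 : z = x <;> by_cases h2 : z' = x
    · rw [h1, h2]
    · rw [h1, ho'] at hz
      simp only [houtx, hout z' h2] at hz
      exact absurd ⟨hex z', hy, hz.symm⟩ (harc _ _)
    · rw [h2, ho'] at hz
      simp only [houtx, hout z h1] at hz
      exact absurd ⟨hex z, hy, hz⟩ (harc _ _)
    · simp only [ho', hout z h1, hout z' h2] at hz
      exact h.forkExit_injective (Prod.ext_iff.2
        (hc.out_inj _ (hmem z) _ (hmem z') _ _ (hex z).2 (hex z').2 hz))
  have hi : Function.Injective i := by
    intro z z' hz
    simp only [hi', hin] at hz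
    exact h.forkExit_injective (Prod.ext_iff.2
      (hc.in_inj _ (hmem z) _ (hmem z') _ _ (hex z).2 (hex z').2 hz))
  have hoi : ∀ z, o z ≠ i z := fun z => hc₁f.ne _ _ (hex z).2
  have he : patternOf o i = fun z => if z = y then (x : ℕ) else 4 + z := by
    funext z
    split_ifs with hz
    · refine patternOf_eq ho ?_
      simp only [ho', hi', houtx, hin, hz, hκ]
    · refine patternOf_eq_add fun z' heq => ?_
      simp only [ho', hi', hin] at heq
      by_cases h1 : z' = x
      · rw [h1, houtx] at heq
        exact hz (h.forkExit_injective (Prod.ext_iff.2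
          (hc.in_inj _ (hmem z) _ (hmem y) _ _ (hex z).2 hy.2 heq.symm)))
      · rw [hout z' h1] at heq
        exact harc _ _ ⟨hex z', hex z, heq⟩
  have hs := fork_closing_search
  simp only [List.all_eq_true, List.mem_finRange, true_implies] at hs
  have hs := hs x y
  rw [Bool.or_eq_true, Nat.beq_eq, ← he] at hs
  obtain ⟨N, -, hN⟩ := List.any_eq_true.1 (hs.resolve_left fun h => hxy (congrArg _ (Fin.ext h)))
  obtain ⟨c', M, h1, -⟩ := h.extend_of_valid hc₁f ho hi hoi
    (fun a p z hl => by
      obtain ⟨rfl, rfl⟩ := forkLink_up hl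
      exact ⟨rfl, rfl⟩)
    (okOut := fun z => !(Nat.beq z x)) (okIn := fun z => !(Nat.beq z y))
    (fun z hz v hv w hvw heq => by
      have hzx : z ≠ x := by
        rintro rfl
        simp at hz
      simp only [ho', hout z hzx] at heq
      rw [houtR hv hvw] at heq
      exact hv.2 ⟨_, (hc.out_inj v hv.1 _ (hmem z) _ _ hvw (hex z).2 heq).1.symm⟩)
    (fun z hz v hv w hvw => by
      have hzy : z ≠ y := by
        rintro rfl
        simp at hz
      simp only [hi', hin]
      exact hc.merge_in_ne hU hy hR (hex z) (hnR z)
        (fun h1 => hzy (h.forkExit_injective h1)) v hv w hvw)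
    (fun v hv v' hv' w w' hvw hvw' heq => by
      rw [houtR hv hvw, houtR hv' hvw'] at heq
      exact hc.out_inj v hv.1 v' hv'.1 w w' hvw hvw' heq)
    (hc.merge_in_inj hU hy hR (hnR y)) hN
  exact ⟨c', h1⟩

end Fork

/-! ### Dismantling a big-fork -/

section Tower

variable {V : Type u} {G : SimpleGraph V} {S W C : Set V} {L : SimpleGraph V} {η : V → V} {j : ℕ}

theorem IsForkTower.mem_of_adj (h : IsForkTower j L W C) {v w : V} (hvw : L.Adj v w) :
    v ∈ W ∧ w ∈ W := by
  induction h generalizing v w with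
  | fork f =>
    obtain ⟨a, b, -, rfl, rfl⟩ := (SimpleGraph.map_adj _ _ _ _).1 hvw
    exact ⟨⟨a, rfl⟩, ⟨b, rfl⟩⟩
  | addStar h t ht p q hp hq hpq _ _ _ _ ih =>
    rcases hvw with ((hvw | hvw) | hvw) | hvw
    · exact ⟨Or.inl (ih hvw).1, Or.inl (ih hvw).2⟩
    · obtain ⟨a, b, -, rfl, rfl⟩ := (SimpleGraph.map_adj _ _ _ _).1 hvw
      exact ⟨Or.inr ⟨a, rfl⟩, Or.inr ⟨b, rfl⟩⟩
    · rcases (edge_adj _ _ _ _).1 hvw with ⟨⟨rfl, rfl⟩ | ⟨rfl, rfl⟩, -⟩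
      · exact ⟨Or.inr ⟨1, rfl⟩, Or.inl hp⟩
      · exact ⟨Or.inl hp, Or.inr ⟨1, rfl⟩⟩
    · rcases (edge_adj _ _ _ _).1 hvw with ⟨⟨rfl, rfl⟩ | ⟨rfl, rfl⟩, -⟩
      · exact ⟨Or.inr ⟨2, rfl⟩, Or.inl hq⟩
      · exact ⟨Or.inl hq, Or.inr ⟨2, rfl⟩⟩

theorem IsForkTower.connecting_subset (h : IsForkTower j L W C) : C ⊆ W := by
  induction h with
  | fork f =>
    rintro _ (rfl | rfl | rfl) <;> exact ⟨_, rfl⟩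
  | addStar h t ht p q hp hq hpq _ _ _ _ ih =>
    rintro _ (rfl | hx)
    · exact Or.inr ⟨3, rfl⟩
    · exact Or.inl (ih hx)

/-- The graph `L`, together with the edges inside `S` and one half-edge from each `x` in the
connecting set `C` to a vertex `η x` in `S`. -/
def bare (S : Set V) (L : SimpleGraph V) (C : Set V) (η : V → V) : SimpleGraph V where
  Adj v w := v ≠ w ∧
    (v ∈ S ∧ w ∈ S ∨ L.Adj v w ∨ v ∈ C ∧ w = η v ∨ w ∈ C ∧ v = η w)
  symm := ⟨fun _ _ h => ⟨h.1.symm, by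
    rcases h.2 with h | h | h | h
    exacts [Or.inl h.symm, Or.inr (Or.inl h.symm), Or.inr (Or.inr (Or.inr h)),
      Or.inr (Or.inr (Or.inl h))]⟩⟩
  loopless := ⟨fun _ h => h.1 rfl⟩

/-- `L` is a part of the cubic graph `G`, outside `S`, and has its half-edges to `S`. -/
structure IsAttached (G : SimpleGraph V) (S : Set V) (L : SimpleGraph V) (W C : Set V) (η : V → V) :
    Prop where
  le : L ≤ G
  disjoint : Disjoint S W
  mem : ∀ x ∈ C, η x ∈ S
  adj : ∀ x ∈ C, G.Adj x (η x)

section Step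

variable {t : Fin 4 ↪ V} {p q : V}

theorem IsAttached.lower (hA : IsAttached G S
    (L ⊔ starForkGraph.map t ⊔ edge (t 1) p ⊔ edge (t 2) q) (W ∪ Set.range t) (insert (t 3) C) η) :
    IsAttached G S L W C η :=
  ⟨fun _ _ h => hA.le (Or.inl (Or.inl (Or.inl h))), hA.disjoint.mono_right Set.subset_union_left,
    fun x hx => hA.mem x (Or.inr hx), fun x hx => hA.adj x (Or.inr hx)⟩

theorem bare_mono : bare S L C η ≤
    bare S (L ⊔ starForkGraph.map t ⊔ edge (t 1) p ⊔ edge (t 2) q) (insert (t 3) C) η := by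
  rintro v w ⟨hne, h | h | h | h⟩
  exacts [⟨hne, Or.inl h⟩, ⟨hne, Or.inr (Or.inl (Or.inl (Or.inl (Or.inl h))))⟩,
    ⟨hne, Or.inr (Or.inr (Or.inl ⟨Or.inr h.1, h.2⟩))⟩,
    ⟨hne, Or.inr (Or.inr (Or.inr ⟨Or.inr h.1, h.2⟩))⟩]

/-- The edges that a star fork adds to `bare`. -/
theorem bare_addStar {v w : V}
    (h : (bare S (L ⊔ starForkGraph.map t ⊔ edge (t 1) p ⊔ edge (t 2) q)
      (insert (t 3) C) η).Adj v w) : (bare S L C η).Adj v w ∨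
      (starForkGraph.map t).Adj v w ∨ (v = t 1 ∧ w = p ∨ v = p ∧ w = t 1) ∨
      (v = t 2 ∧ w = q ∨ v = q ∧ w = t 2) ∨ (v = t 3 ∧ w = η (t 3) ∨ v = η (t 3) ∧ w = t 3) := by
  obtain ⟨hne, h | (((h | h) | h) | h) | ⟨rfl | h, hw⟩ | ⟨rfl | h, hv⟩⟩ := h
  · exact Or.inl ⟨hne, Or.inl h⟩
  · exact Or.inl ⟨hne, Or.inr (Or.inl h)⟩
  · exact Or.inr (Or.inl h)
  · exact Or.inr (Or.inr (Or.inl ((edge_adj _ _ _ _).1 h).1))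
  · exact Or.inr (Or.inr (Or.inr (Or.inl ((edge_adj _ _ _ _).1 h).1)))
  · exact Or.inr (Or.inr (Or.inr (Or.inr (Or.inl ⟨rfl, hw⟩))))
  · exact Or.inl ⟨hne, Or.inr (Or.inr (Or.inl ⟨h, hw⟩))⟩
  · exact Or.inr (Or.inr (Or.inr (Or.inr (Or.inr ⟨hv, rfl⟩))))
  · exact Or.inl ⟨hne, Or.inr (Or.inr (Or.inr ⟨h, hv⟩))⟩

theorem IsForkTower.mem_of_bare_adj (h : IsForkTower j L W C) (hA : IsAttached G S L W C η)
    {v w : V} (hvw : (bare S L C η).Adj v w) : v ∈ S ∪ W ∧ w ∈ S ∪ W := by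
  obtain ⟨-, hvw | hvw | ⟨hv, rfl⟩ | ⟨hw, rfl⟩⟩ := hvw
  · exact ⟨Or.inl hvw.1, Or.inl hvw.2⟩
  · exact ⟨Or.inr (h.mem_of_adj hvw).1, Or.inr (h.mem_of_adj hvw).2⟩
  · exact ⟨Or.inr (h.connecting_subset hv), Or.inl (hA.mem v hv)⟩
  · exact ⟨Or.inl (hA.mem w hw), Or.inr (h.connecting_subset hw)⟩

theorem bare_of_mem (hA : IsAttached G S
    (L ⊔ starForkGraph.map t ⊔ edge (t 1) p ⊔ edge (t 2) q) (W ∪ Set.range t) (insert (t 3) C) η)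
    (ht : Disjoint (Set.range t) W) {x y : V} (hx : x ∈ W) (hxp : x ≠ p) (hxq : x ≠ q)
    (h : (bare S (L ⊔ starForkGraph.map t ⊔ edge (t 1) p ⊔ edge (t 2) q)
      (insert (t 3) C) η).Adj x y) : (bare S L C η).Adj x y := by
  have hxt : ∀ a, x ≠ t a := by
    rintro a rfl
    exact Set.disjoint_left.1 ht ⟨a, rfl⟩ hx
  rcases bare_addStar h with h | h | h | h | h
  · exact h
  · obtain ⟨a, b, -, h1, -⟩ := (SimpleGraph.map_adj _ _ _ _).1 h
    exact absurd h1.symm (hxt a)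
  · rcases h with h | h
    exacts [absurd h.1 (hxt 1), absurd h.1 hxp]
  · rcases h with h | h
    exacts [absurd h.1 (hxt 2), absurd h.1 hxq]
  · rcases h with h | h
    · exact absurd h.1 (hxt 3)
    · have h1 := hA.mem (t 3) (Or.inl rfl)
      rw [← h.1] at h1
      exact absurd (Or.inl hx) (Set.disjoint_left.1 hA.disjoint h1)

end Step

/-- A big-fork has at least `j + 4` vertices with at most two edges in `bare`. -/
theorem IsForkTower.exists_finset (h : IsForkTower j L W C) (hA : IsAttached G S L W C η) :
    ∃ F : Finset V, j + 4 ≤ F.card ∧ ↑F ⊆ W ∧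
      ∀ x ∈ F, ∃ a b, ∀ y, (bare S L C η).Adj x y → y = a ∨ y = b := by
  classical
  induction h with
  | fork f =>
    have hS : ∀ a, f a ∉ S := fun a ha => Set.disjoint_left.1 hA.disjoint ha ⟨a, rfl⟩
    have hC : ∀ a, f a ∈ ({f 1, f 2, f 4} : Set V) ↔ a = 1 ∨ a = 2 ∨ a = 4 := by
      intro a
      simp only [Set.mem_insert_iff, Set.mem_singleton_iff, f.injective.eq_iff]
    have key : ∀ a y, (bare S (forkGraph.map f) {f 1, f 2, f 4} η).Adj (f a) y →
        (∃ b, forkGraph.Adj a b ∧ y = f b) ∨ (a = 1 ∨ a = 2 ∨ a = 4) ∧ y = η (f a) := by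
      rintro a y ⟨-, h | h | h | h⟩
      · exact absurd h.1 (hS a)
      · obtain ⟨a', b, hab, h1, rfl⟩ := (SimpleGraph.map_adj _ _ _ _).1 h
        obtain rfl := f.injective h1
        exact Or.inl ⟨b, hab, rfl⟩
      · exact Or.inr ⟨(hC a).1 h.1, h.2⟩
      · have h1 := hA.mem _ h.1
        rw [← h.2] at h1
        exact absurd h1 (hS a)
    have hadj : ∀ a b, forkGraph.Adj a b → a ≠ 0 → (a = 1 ∨ a = 2) ∧ b = 0 ∨
        a = 3 ∧ (b = 0 ∨ b = 4) ∨ a = 4 ∧ b = 3 := by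
      simp only [forkGraph, fromEdgeSet_adj, Set.mem_insert_iff, Set.mem_singleton_iff,
        Sym2.eq_iff]
      decide +kernel
    refine ⟨{f 1, f 2, f 3, f 4}, ?_, ?_, ?_⟩
    · rw [Finset.card_insert_of_notMem (by simp), Finset.card_insert_of_notMem (by simp),
        Finset.card_insert_of_notMem (by simp), Finset.card_singleton]
    · simp [Set.insert_subset_iff]
    · intro x hx
      obtain ⟨a, ha, rfl⟩ : ∃ a, a ≠ 0 ∧ x = f a := by
        simp only [Finset.mem_insert, Finset.mem_singleton] at hx
        rcases hx with rfl | rfl | rfl | rfl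
        exacts [⟨1, by decide, rfl⟩, ⟨2, by decide, rfl⟩, ⟨3, by decide, rfl⟩,
          ⟨4, by decide, rfl⟩]
      by_cases h3 : a = 3
      · refine ⟨f 0, f 4, fun y hy => ?_⟩
        rcases key a y hy with ⟨b, hb, rfl⟩ | ⟨h1, -⟩
        · rcases hadj a b hb ha with ⟨h1, -⟩ | ⟨-, rfl | rfl⟩ | ⟨h1, -⟩
          · omega
          · exact Or.inl rfl
          · exact Or.inr rfl
          · omega
        · omega
      · refine ⟨if a = 4 then f 3 else f 0, η (f a), fun y hy => ?_⟩
        rcases key a y hy with ⟨b, hb, rfl⟩ | ⟨-, h2⟩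
        · rcases hadj a b hb ha with ⟨h1, rfl⟩ | ⟨h1, -⟩ | ⟨rfl, rfl⟩
          · left
            rw [if_neg (by omega)]
          · exact absurd h1 h3
          · left
            rw [if_pos rfl]
        · exact Or.inr h2
  | @addStar j L W C h t ht p q hp hq hpq _ _ _ _ ih =>
    obtain ⟨F, hF, hFW, hdeg⟩ := ih hA.lower
    have htW : ∀ a, t a ∉ W := fun a ha => Set.disjoint_left.1 ht ⟨a, rfl⟩ ha
    have htS : ∀ a, t a ∉ S := fun a ha => Set.disjoint_left.1 hA.disjoint ha (Or.inr ⟨a, rfl⟩)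
    have htF : ∀ a, t a ∉ (F.erase p).erase q := fun a ha =>
      htW a (hFW (Finset.mem_of_mem_erase (Finset.mem_of_mem_erase ha)))
    refine ⟨insert (t 1) (insert (t 2) (insert (t 3) ((F.erase p).erase q))), ?_, ?_, ?_⟩
    · rw [Finset.card_insert_of_notMem (by simp [htF]),
        Finset.card_insert_of_notMem (by simp [htF]),
        Finset.card_insert_of_notMem (htF 3)]
      have h1 := Finset.pred_card_le_card_erase (s := F) (a := p)
      have h2 := Finset.pred_card_le_card_erase (s := F.erase p) (a := q)
      omega
    · intro x hx
      simp only [Finset.coe_insert, Set.mem_insert_iff, Finset.mem_coe] at hx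
      rcases hx with rfl | rfl | rfl | hx
      · exact Or.inr ⟨1, rfl⟩
      · exact Or.inr ⟨2, rfl⟩
      · exact Or.inr ⟨3, rfl⟩
      · exact Or.inl (hFW (Finset.mem_of_mem_erase (Finset.mem_of_mem_erase hx)))
    · have hleaf : ∀ a ≠ 0, ∀ d, (∀ y, (a = 1 ∧ y = p ∨ a = 2 ∧ y = q ∨ a = 3 ∧ y = η (t 3)) →
          y = d) → ∀ y, (bare S (L ⊔ starForkGraph.map t ⊔ edge (t 1) p ⊔ edge (t 2) q)
          (insert (t 3) C) η).Adj (t a) y → y = t 0 ∨ y = d := by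
        intro a ha d hd y hy
        rcases bare_addStar hy with h' | h' | h' | h' | h'
        · rcases (h.mem_of_bare_adj hA.lower h').1 with h1 | h1
          exacts [absurd h1 (htS a), absurd h1 (htW a)]
        · obtain ⟨a', b, hab, h1, rfl⟩ := (SimpleGraph.map_adj _ _ _ _).1 h'
          obtain rfl := t.injective h1
          have key : ∀ a b, starForkGraph.Adj a b → a ≠ 0 → b = 0 := by
            simp only [starForkGraph, fromEdgeSet_adj, Set.mem_insert_iff, Set.mem_singleton_iff,
              Sym2.eq_iff]
            decide +kernel
          rw [key _ _ hab ha]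
          exact Or.inl rfl
        · rcases h' with h' | h'
          · exact Or.inr (hd y (Or.inl ⟨t.injective h'.1, h'.2⟩))
          · exact absurd (h'.1 ▸ hp) (htW a)
        · rcases h' with h' | h'
          · exact Or.inr (hd y (Or.inr (Or.inl ⟨t.injective h'.1, h'.2⟩)))
          · exact absurd (h'.1 ▸ hq) (htW a)
        · rcases h' with h' | h'
          · exact Or.inr (hd y (Or.inr (Or.inr ⟨t.injective h'.1, h'.2⟩)))
          · exact absurd (h'.1 ▸ hA.mem (t 3) (Or.inl rfl)) (htS a)
      intro x hx
      simp only [Finset.mem_insert] at hx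
      rcases hx with rfl | rfl | rfl | hx
      · exact ⟨t 0, p, hleaf 1 (by decide) p (by simp)⟩
      · exact ⟨t 0, q, hleaf 2 (by decide) q (by simp)⟩
      · exact ⟨t 0, η (t 3), hleaf 3 (by decide) (η (t 3)) (by simp)⟩
      · obtain ⟨hxq, hx⟩ := Finset.mem_erase.1 hx
        obtain ⟨hxp, hx⟩ := Finset.mem_erase.1 hx
        obtain ⟨a, b, hab⟩ := hdeg x hx
        exact ⟨a, b, fun y hy => hab y (bare_of_mem hA ht (hFW hx) hxp hxq hy)⟩

theorem exists_sdiff_adj (hG : IsCubic G) {H : SimpleGraph V} {x a b : V}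
    (h : ∀ y, H.Adj x y → y = a ∨ y = b) : ∃ y, (G \ H).Adj x y := by
  obtain ⟨y, hy, hn⟩ := Set.exists_mem_notMem_of_ncard_lt_ncard (s := {a, b})
    (t := G.neighborSet x) (by
      rw [hG x]
      exact lt_of_le_of_lt (Set.ncard_insert_le a {b}) (by simp))
  exact ⟨y, hy, fun h' => hn (h y h')⟩

end Tower

section Tower

variable {V : Type u} {G : SimpleGraph V} {S W C : Set V} {L : SimpleGraph V} {η : V → V} {j : ℕ}

/-- The last star fork of a big-fork is a star fork in the sense of `IsStar`. -/
theorem IsForkTower.exists_isStar (hG : IsCubic G) {t : Fin 4 ↪ V} {p q : V}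
    (h : IsForkTower j L W C) (ht : Disjoint (Set.range t) W) (hp : p ∈ W) (hq : q ∈ W)
    (hA : IsAttached G S
      (L ⊔ starForkGraph.map t ⊔ edge (t 1) p ⊔ edge (t 2) q) (W ∪ Set.range t)
      (insert (t 3) C) η) :
    ∃ nb, IsStar G (G \ bare S (L ⊔ starForkGraph.map t ⊔ edge (t 1) p ⊔ edge (t 2) q)
      (insert (t 3) C) η) (S ∪ (W ∪ Set.range t)) W t nb := by
  have htW : ∀ a, t a ∉ W := fun a ha => Set.disjoint_left.1 ht ⟨a, rfl⟩ ha
  have htS : ∀ a, t a ∉ S := fun a ha => Set.disjoint_left.1 hA.disjoint ha (Or.inr ⟨a, rfl⟩)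
  have hη := hA.mem (t 3) (Or.inl rfl)
  have hdown : ∀ (a : Fin 4) (p : Fin 3), starLink (n := 3) id a p = .down →
      (a = 1 ∨ a = 2 ∨ a = 3) ∧ p = 1 := fun a p => starLink_down
  set d : Fin 4 → Fin 3 → V := fun a _ => (![t 0, p, q, η (t 3)] : Fin 4 → V) a with hd
  have hdt : ∀ a b, a = 1 ∨ a = 2 ∨ a = 3 → ∀ k, d a k ≠ t b := by
    rintro a b (rfl | rfl | rfl) k hk
    · exact htW b (hk ▸ hp)
    · exact htW b (hk ▸ hq)
    · exact htS b (hk ▸ hη)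
  obtain ⟨nb, hnb, hnbd⟩ := ForkGraph.exists_isPiece
    (O := G \ bare S (L ⊔ starForkGraph.map t ⊔ edge (t 1) p ⊔ edge (t 2) q) (insert (t 3) C) η)
    (S := S ∪ (W ∪ Set.range t)) (f := t) (link := starLink (n := 3) id) hG d t.injective
    (fun a => Or.inr (Or.inr ⟨a, rfl⟩))
    (fun a p b q hl => by
      have hm : IsMatched (starLink (n := 3) id) := by decide +kernel
      exact isInner_iff.1 (hm.1 a p b q (isInner_iff.2 hl)))
    (fun a p p' b q q' hl hl' => by
      have hm : IsMatched (starLink (n := 3) id) := by decide +kernel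
      exact hm.2 a p p' b q q' (isInner_iff.2 hl) (isInner_iff.2 hl'))
    (fun a k hl => by
      obtain ⟨ha, -⟩ := hdown a k hl
      refine ⟨?_, ?_⟩
      · rcases ha with rfl | rfl | rfl
        exacts [Or.inr (Or.inl hp), Or.inr (Or.inl hq), Or.inl hη]
      · rintro ⟨b, hb⟩
        exact hdt a b ha k hb.symm)
    (fun a k k' hl hl' _ => (hdown a k hl).2.trans (hdown a k' hl').2.symm)
    (fun a w => by
      constructor
      · rintro ⟨hGw, hO⟩
        have hB : (bare S (L ⊔ starForkGraph.map t ⊔ edge (t 1) p ⊔ edge (t 2) q)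
            (insert (t 3) C) η).Adj (t a) w := by
          by_contra hB
          exact hO ⟨hGw, hB⟩
        rcases bare_addStar hB with h' | h' | h' | h' | h'
        · rcases (h.mem_of_bare_adj hA.lower h').1 with h1 | h1
          exacts [absurd h1 (htS a), absurd h1 (htW a)]
        · obtain ⟨a', b, hab, h1, rfl⟩ := (SimpleGraph.map_adj _ _ _ _).1 h'
          obtain rfl := t.injective h1
          obtain ⟨k, l, hl⟩ := (hasShape_starFork.1 a' b).1 hab
          exact Or.inl ⟨k, b, l, isInner_iff.1 hl, rfl⟩
        · rcases h' with h' | h'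
          · obtain rfl := t.injective h'.1
            exact Or.inr ⟨1, rfl, h'.2⟩
          · exact absurd (h'.1 ▸ hp) (htW a)
        · rcases h' with h' | h'
          · obtain rfl := t.injective h'.1
            exact Or.inr ⟨1, rfl, h'.2⟩
          · exact absurd (h'.1 ▸ hq) (htW a)
        · rcases h' with h' | h'
          · obtain rfl := t.injective h'.1
            exact Or.inr ⟨1, rfl, h'.2⟩
          · exact absurd (h'.1 ▸ hη) (htS a)
      · rintro (⟨k, b, l, hl, rfl⟩ | ⟨k, hl, rfl⟩)
        · have hab := (hasShape_starFork.1 a b).2 ⟨k, l, isInner_iff.2 hl⟩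
          have hadj : (starForkGraph.map t).Adj (t a) (t b) :=
            (SimpleGraph.map_adj _ _ _ _).2 ⟨a, b, hab, rfl, rfl⟩
          exact ⟨hA.le (Or.inl (Or.inl (Or.inr hadj))), fun hO => hO.2
            ⟨hadj.ne, Or.inr (Or.inl (Or.inl (Or.inl (Or.inr hadj))))⟩⟩
        · obtain ⟨ha, -⟩ := hdown a k hl
          have hne : t a ≠ d a k := (hdt a a ha k).symm
          rcases ha with rfl | rfl | rfl
          · have hadj : (edge (t 1) p).Adj (t 1) p := (edge_adj _ _ _ _).2 ⟨Or.inl ⟨rfl, rfl⟩, hne⟩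
            exact ⟨hA.le (Or.inl (Or.inr hadj)),
              fun hO => hO.2 ⟨hne, Or.inr (Or.inl (Or.inl (Or.inr hadj)))⟩⟩
          · have hadj : (edge (t 2) q).Adj (t 2) q := (edge_adj _ _ _ _).2 ⟨Or.inl ⟨rfl, rfl⟩, hne⟩
            exact ⟨hA.le (Or.inr hadj),
              fun hO => hO.2 ⟨hne, Or.inr (Or.inl (Or.inr hadj))⟩⟩
          · exact ⟨hA.adj _ (Or.inl rfl),
              fun hO => hO.2 ⟨hne, Or.inr (Or.inr (Or.inl ⟨Or.inl rfl, rfl⟩))⟩⟩)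
  refine ⟨nb, hnb, sdiff_le, fun v hv => Or.inr (Or.inl hv), htW, ?_, ?_, ?_⟩
  · rw [hnbd 1 1 rfl]
    exact hp
  · rw [hnbd 2 1 rfl]
    exact hq
  · rw [hnbd 3 1 rfl]
    exact fun h1 => Set.disjoint_left.1 hA.disjoint hη (Or.inl h1)

theorem IsForkTower.expose_star {t : Fin 4 ↪ V} {p q : V}
    (h : IsForkTower j L W C) (ht : Disjoint (Set.range t) W)
    (hA : IsAttached G S
      (L ⊔ starForkGraph.map t ⊔ edge (t 1) p ⊔ edge (t 2) q) (W ∪ Set.range t)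
      (insert (t 3) C) η) :
    expose G (G \ bare S (L ⊔ starForkGraph.map t ⊔ edge (t 1) p ⊔ edge (t 2) q)
      (insert (t 3) C) η) (Set.range t) = G \ bare S L C η := by
  have hnot : ∀ a, t a ∉ S ∪ W := by
    rintro a (ha | ha)
    · exact Set.disjoint_left.1 hA.disjoint ha (Or.inr ⟨a, rfl⟩)
    · exact Set.disjoint_left.1 ht ⟨a, rfl⟩ ha
  ext v w
  constructor
  · rintro (⟨hGv, hB⟩ | ⟨hGv, ⟨a, rfl⟩ | ⟨a, rfl⟩⟩)
    · exact ⟨hGv, fun hB' => hB (bare_mono hB')⟩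
    · exact ⟨hGv, fun hB => hnot a (h.mem_of_bare_adj hA.lower hB).1⟩
    · exact ⟨hGv, fun hB => hnot a (h.mem_of_bare_adj hA.lower hB).2⟩
  · rintro ⟨hGv, hB⟩
    by_cases hN : v ∈ Set.range t ∨ w ∈ Set.range t
    · exact Or.inr ⟨hGv, hN⟩
    · refine Or.inl ⟨hGv, fun hB' => ?_⟩
      have hn : ∀ a, v ≠ t a ∧ w ≠ t a := fun a =>
        ⟨fun h1 => hN (Or.inl ⟨a, h1.symm⟩), fun h1 => hN (Or.inr ⟨a, h1.symm⟩)⟩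
      rcases bare_addStar hB' with h' | h' | h' | h' | h'
      · exact hB h'
      · obtain ⟨a, b, -, rfl, rfl⟩ := (SimpleGraph.map_adj _ _ _ _).1 h'
        exact (hn a).1 rfl
      · rcases h' with h' | h'
        exacts [(hn 1).1 h'.1, (hn 1).2 h'.2]
      · rcases h' with h' | h'
        exacts [(hn 2).1 h'.1, (hn 2).2 h'.2]
      · rcases h' with h' | h'
        exacts [(hn 3).1 h'.1, (hn 3).2 h'.2]

/-- The fork at the bottom of a big-fork is a piece. -/
theorem exists_isPiece_fork (hG : IsCubic G) {f : Fin 5 ↪ V}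
    (hA : IsAttached G S (forkGraph.map f) (Set.range f) {f 1, f 2, f 4} η) :
    ∃ nb, IsPiece G (G \ bare S (forkGraph.map f) {f 1, f 2, f 4} η) (S ∪ Set.range f) f nb
      forkLink := by
  have hfS : ∀ a, f a ∉ S := fun a ha => Set.disjoint_left.1 hA.disjoint ha ⟨a, rfl⟩
  have hC : ∀ a, f a ∈ ({f 1, f 2, f 4} : Set V) ↔ a = 1 ∨ a = 2 ∨ a = 4 := by
    intro a
    simp only [Set.mem_insert_iff, Set.mem_singleton_iff, f.injective.eq_iff]
  have hm : IsMatched forkLink := by decide +kernel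
  have hdown : ∀ (a : Fin 5) (k : Fin 3), forkLink a k = .down ↔
      (a = 1 ∨ a = 2 ∨ a = 4) ∧ k = 1 := by
    have key : ∀ (a : Fin 5) (k : Fin 3), isDown forkLink a k = true ↔
      (a = 1 ∨ a = 2 ∨ a = 4) ∧ k = 1 := by decide +kernel
    exact fun a k => isDown_iff.symm.trans (key a k)
  obtain ⟨nb, hnb, -⟩ := ForkGraph.exists_isPiece
    (O := G \ bare S (forkGraph.map f) {f 1, f 2, f 4} η) (S := S ∪ Set.range f) (f := f)
    (link := forkLink) hG (fun a _ => η (f a)) f.injective (fun a => Or.inr ⟨a, rfl⟩)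
    (fun a p b q hl => isInner_iff.1 (hm.1 a p b q (isInner_iff.2 hl)))
    (fun a p p' b q q' hl hl' => hm.2 a p p' b q q' (isInner_iff.2 hl) (isInner_iff.2 hl'))
    (fun a k hl => by
      have h1 := hA.mem _ ((hC a).2 ((hdown a k).1 hl).1)
      exact ⟨Or.inl h1, fun h2 => Set.disjoint_left.1 hA.disjoint h1 h2⟩)
    (fun a k k' hl hl' _ => ((hdown a k).1 hl).2.trans ((hdown a k').1 hl').2.symm)
    (fun a w => by
      constructor
      · rintro ⟨hGw, hO⟩
        have hB : (bare S (forkGraph.map f) {f 1, f 2, f 4} η).Adj (f a) w := by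
          by_contra hB
          exact hO ⟨hGw, hB⟩
        obtain ⟨-, h' | h' | h' | h'⟩ := hB
        · exact absurd h'.1 (hfS a)
        · obtain ⟨a', b, hab, h1, rfl⟩ := (SimpleGraph.map_adj _ _ _ _).1 h'
          obtain rfl := f.injective h1
          obtain ⟨k, l, hl⟩ := (hasShape_fork.1 a' b).1 hab
          exact Or.inl ⟨k, b, l, isInner_iff.1 hl, rfl⟩
        · exact Or.inr ⟨1, (hdown a 1).2 ⟨(hC a).1 h'.1, rfl⟩, h'.2⟩
        · exact absurd (h'.2 ▸ hA.mem _ h'.1) (hfS a)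
      · rintro (⟨k, b, l, hl, rfl⟩ | ⟨k, hl, rfl⟩)
        · have hab := (hasShape_fork.1 a b).2 ⟨k, l, isInner_iff.2 hl⟩
          have hadj : (forkGraph.map f).Adj (f a) (f b) :=
            (SimpleGraph.map_adj _ _ _ _).2 ⟨a, b, hab, rfl, rfl⟩
          exact ⟨hA.le hadj, fun hO => hO.2 ⟨hadj.ne, Or.inr (Or.inl hadj)⟩⟩
        · have h1 := (hC a).2 ((hdown a k).1 hl).1
          exact ⟨hA.adj _ h1,
            fun hO => hO.2 ⟨(hA.adj _ h1).ne, Or.inr (Or.inr (Or.inl ⟨h1, rfl⟩))⟩⟩)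
  exact ⟨nb, hnb⟩

theorem expose_fork {f : Fin 5 ↪ V}
    (hA : IsAttached G S (forkGraph.map f) (Set.range f) {f 1, f 2, f 4} η) :
    expose G (G \ bare S (forkGraph.map f) {f 1, f 2, f 4} η) (Set.range f) = outside G S := by
  have hfS : ∀ a, f a ∉ S := fun a ha => Set.disjoint_left.1 hA.disjoint ha ⟨a, rfl⟩
  have hC : ∀ x ∈ ({f 1, f 2, f 4} : Set V), x ∈ Set.range f := by
    rintro _ (rfl | rfl | rfl) <;> exact ⟨_, rfl⟩
  ext v w
  constructor
  · rintro (⟨hGv, hB⟩ | ⟨hGv, ⟨a, rfl⟩ | ⟨a, rfl⟩⟩)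
    · exact ⟨hGv, fun hS => hB ⟨hGv.ne, Or.inl hS⟩⟩
    · exact ⟨hGv, fun hS => hfS a hS.1⟩
    · exact ⟨hGv, fun hS => hfS a hS.2⟩
  · rintro ⟨hGv, hS⟩
    by_cases hN : v ∈ Set.range f ∨ w ∈ Set.range f
    · exact Or.inr ⟨hGv, hN⟩
    · refine Or.inl ⟨hGv, ?_⟩
      rintro ⟨-, h' | h' | h' | h'⟩
      · exact hS h'
      · obtain ⟨a, b, -, rfl, rfl⟩ := (SimpleGraph.map_adj _ _ _ _).1 h'
        exact hN (Or.inl ⟨a, rfl⟩)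
      · exact hN (Or.inl (hC _ h'.1))
      · exact hN (Or.inr (hC _ h'.1))

/-- A good state is extended to a big-fork: the star forks are coloured one after the other, and
the fork at the end. -/
theorem IsForkTower.exists_state [Finite V] (hG : IsCubic G) (h : IsForkTower j L W C)
    (hA : IsAttached G S L W C η) {c : V → V → ℕ} (hc : IsState G (G \ bare S L C η) (S ∪ W) c)
    (hgood : HasGoodArc (G \ bare S L C η) W c ∨ HasGoodPair (G \ bare S L C η) W c ∨
      1 ≤ j ∧ ∃ x y, IsArc (G \ bare S L C η) W c x y) :
    ∃ c', IsState G (outside G S) S c' := by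
  classical
  induction h generalizing c with
  | fork f =>
    obtain ⟨nb, hnb⟩ := exists_isPiece_fork hG hA
    have h1 : ∃ c', IsState G (expose G (G \ bare S (forkGraph.map f) {f 1, f 2, f 4} η)
        (Set.range f)) ((S ∪ Set.range f) \ Set.range f) c' := by
      rcases hgood with hgood | hgood | ⟨hgood, -⟩
      · exact hnb.exists_state_of_hasGoodArc sdiff_le hc hgood
      · exact hnb.exists_state_of_hasGoodPair sdiff_le hc hgood
      · omega
    rwa [expose_fork hA, Set.union_sdiff_cancel_right (Set.disjoint_iff.1 hA.disjoint)] at h1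
  | @addStar j L W C h t ht p q hp hq hpq _ _ _ _ ih =>
    obtain ⟨nb, hst⟩ := h.exists_isStar hG ht hp hq hA
    obtain ⟨F, hF, hFW, hdeg⟩ := h.exists_finset hA.lower
    have hcard : 1 < ((F.erase p).erase q).card := by
      have h1 := Finset.pred_card_le_card_erase (s := F) (a := p)
      have h2 := Finset.pred_card_le_card_erase (s := F.erase p) (a := q)
      omega
    obtain ⟨a, ha, b, hb, hab⟩ := Finset.one_lt_card.1 hcard
    have hexit : ∀ x ∈ (F.erase p).erase q, ∃ y,
        IsExit (G \ bare S (L ⊔ starForkGraph.map t ⊔ edge (t 1) p ⊔ edge (t 2) q)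
          (insert (t 3) C) η) W (x, y) := by
      intro x hx
      obtain ⟨hxq, hx⟩ := Finset.mem_erase.1 hx
      obtain ⟨hxp, hx⟩ := Finset.mem_erase.1 hx
      obtain ⟨a, b, hab⟩ := hdeg x hx
      obtain ⟨y, hy⟩ := exists_sdiff_adj hG
        fun y hy => hab y (bare_of_mem hA ht (hFW hx) hxp hxq hy)
      exact ⟨y, hFW hx, hy⟩
    obtain ⟨a', ha'⟩ := hexit a ha
    obtain ⟨b', hb'⟩ := hexit b hb
    obtain ⟨c', hc', hgood'⟩ := hst.exists_state hc (by
      rcases hgood with hgood | hgood | hgood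
      exacts [Or.inl hgood.exists_isArc, Or.inr hgood, Or.inl hgood.2]) ha' hb'
      (fun h1 => hab (Prod.ext_iff.1 h1).1)
    have hset : (S ∪ (W ∪ Set.range t)) \ Set.range t = S ∪ W := by
      rw [← Set.union_assoc]
      refine Set.union_sdiff_cancel_right ?_
      rintro v ⟨hv | hv, hvt⟩
      · exact Set.disjoint_left.1 hA.disjoint hv (Or.inr hvt)
      · exact Set.disjoint_left.1 ht hvt hv
    rw [h.expose_star ht hA, hset] at hc'
    rw [h.expose_star ht hA] at hgood'
    exact ih hA.lower hc' (hgood'.imp id Or.inl)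

end Tower

/-! ### Disjoint paths from colours -/

section Chain

variable {V : Type u} {A : V → V → Prop}

open Classical in
/-- The successor in a digraph in which each vertex has at most one successor. -/
noncomputable def step (A : V → V → Prop) (v : V) : V := if h : ∃ w, A v w then h.choose else v

theorem adj_step {v : V} (h : ∃ w, A v w) : A v (step A v) := by
  rw [step, dif_pos h]
  exact h.choose_spec

/-- In a finite digraph in which no vertex has two predecessors, one gets from a vertex without a
predecessor to a place where there is no successor. -/
theorem exists_iterate_mem [Finite V] (hin : ∀ v v' w, A v w → A v' w → v = v') {S : Set V}
    (hcont : ∀ u v, A u v → v ∉ S → ∃ w, A v w) {x : V} (hx : ∃ w, A x w)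
    (hsrc : ∀ u, ¬ A u x) :
    ∃ n, (step A)^[n] x ∈ S ∧ ∀ i < n, A ((step A)^[i] x) ((step A)^[i + 1] x) := by
  classical
  have hstep : ∀ n, (∀ i ≤ n, (step A)^[i] x ∉ S) → A ((step A)^[n] x) ((step A)^[n + 1] x) := by
    intro n
    induction n with
    | zero =>
      intro _
      rw [Function.iterate_succ_apply']
      exact adj_step hx
    | succ n ih =>
      intro h
      rw [Function.iterate_succ_apply' _ (n + 1)]
      exact adj_step (hcont _ _ (ih fun i hi => h i (by omega)) (h (n + 1) le_rfl))
  have hex : ∃ n, (step A)^[n] x ∈ S := by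
    by_contra hno
    push Not at hno
    have hall : ∀ n, A ((step A)^[n] x) ((step A)^[n + 1] x) := fun n => hstep n fun i _ => hno i
    have hback : ∀ m k, (step A)^[m] x = (step A)^[m + k] x → (step A)^[k] x = x := by
      intro m
      induction m with
      | zero =>
        intro k h
        simpa using h.symm
      | succ m ih =>
        intro k h
        refine ih k (hin _ _ _ (hall m) ?_)
        have h1 := hall (m + k)
        rwa [show m + k + 1 = m + 1 + k by omega, ← h] at h1
    obtain ⟨m, n, hmn, h⟩ := Finite.exists_ne_map_eq_of_infinite fun n => (step A)^[n] x
    have key : ∀ m n, m < n → (step A)^[m] x ≠ (step A)^[n] x := by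
      intro m n hlt h
      have h1 := hback m (n - m) (by rwa [Nat.add_sub_cancel' hlt.le])
      have h2 := hall (n - m - 1)
      rw [show n - m - 1 + 1 = n - m by omega, h1] at h2
      exact hsrc _ h2
    rcases lt_or_gt_of_ne hmn with hlt | hlt
    exacts [key m n hlt h, key n m hlt h.symm]
  refine ⟨Nat.find hex, Nat.find_spec hex, fun i hi => hstep i fun k hk => ?_⟩
  exact Nat.find_min hex (by omega)

theorem eq_of_iterate_eq (hin : ∀ v v' w, A v w → A v' w → v = v') {x x' : V}
    (hx : ∀ u, ¬ A u x) (hx' : ∀ u, ¬ A u x') {n n' : ℕ}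
    (h : ∀ i < n, A ((step A)^[i] x) ((step A)^[i + 1] x))
    (h' : ∀ i < n', A ((step A)^[i] x') ((step A)^[i + 1] x')) :
    ∀ i ≤ n, ∀ k ≤ n', (step A)^[i] x = (step A)^[k] x' → x = x' := by
  intro i
  induction i with
  | zero =>
    rintro - (_ | k) hk heq
    · exact heq
    · have h1 := h' k (by omega)
      rw [← heq] at h1
      exact absurd h1 (hx _)
  | succ i ih =>
    rintro hi (_ | k) hk heq
    · have h1 := h i (by omega)
      rw [heq] at h1
      exact absurd h1 (hx' _)
    · refine ih (by omega) k (by omega) (hin _ _ _ (h i (by omega)) ?_)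
      rw [heq]
      exact h' k (by omega)

theorem exists_path_of_iterate {H : SimpleGraph V} (hA : ∀ v w, A v w → H.Adj v w) (x : V) :
    ∀ n, (∀ i < n, A ((step A)^[i] x) ((step A)^[i + 1] x)) →
      ∃ p : H.Walk x ((step A)^[n] x), p.IsPath ∧
        ∀ v ∈ p.support, ∃ i ≤ n, v = (step A)^[i] x := by
  classical
  have key : ∀ n, (∀ i < n, A ((step A)^[i] x) ((step A)^[i + 1] x)) →
      ∃ p : H.Walk x ((step A)^[n] x), ∀ v ∈ p.support, ∃ i ≤ n, v = (step A)^[i] x := by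
    intro n
    induction n with
    | zero => exact fun _ => ⟨Walk.nil, by simp⟩
    | succ n ih =>
      intro h
      obtain ⟨p, hp⟩ := ih fun i hi => h i (by omega)
      refine ⟨p.concat (hA _ _ (h n (by omega))), fun v hv => ?_⟩
      rw [Walk.support_concat, List.mem_append, List.mem_singleton] at hv
      rcases hv with hv | rfl
      · obtain ⟨i, hi, rfl⟩ := hp v hv
        exact ⟨i, by omega, rfl⟩
      · exact ⟨n + 1, le_rfl, rfl⟩
  intro n h
  obtain ⟨p, hp⟩ := key n h
  exact ⟨p.bypass, p.bypass_isPath, fun v hv => hp v (p.support_bypass_subset_support hv)⟩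

end Chain

section Paths

variable {V : Type u} {G : SimpleGraph V} {S W : Set V} {c : V → V → ℕ}

/-- The dart from `v` to `w` has a colour in `K`, and the reverse dart has not. -/
def IsTrailArc (O : SimpleGraph V) (c : V → V → ℕ) (K : Set ℕ) (v w : V) : Prop :=
  O.Adj v w ∧ c v w ∈ K ∧ c w v ∉ K

/-- At a vertex with a rotation, at most one arc arrives and at most one arc leaves, and one arrives
if and only if one leaves: these are the ascents and descents in a cyclic sequence of length three.
-/
theorem isTrailArc_rotation {O : SimpleGraph V} {v : V} (hrot : IsRotation G c v)
    (hO : ∀ w, O.Adj v w ↔ G.Adj v w) (K : Set ℕ) :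
    (∀ u u', IsTrailArc O c K u v → IsTrailArc O c K u' v → u = u') ∧
      ∀ u, IsTrailArc O c K u v → ∃ w, IsTrailArc O c K v w := by
  obtain ⟨a, b, d, -, -, -, hadj, e1, e2, e3⟩ := hrot
  have hOv : ∀ w, O.Adj v w ↔ w = a ∨ w = b ∨ w = d := fun w => (hO w).trans (hadj w)
  have ha := (hOv a).2 (by simp)
  have hb := (hOv b).2 (by simp)
  have hd := (hOv d).2 (by simp)
  have hinto : ∀ u, IsTrailArc O c K u v → u = a ∧ c v b ∈ K ∧ c v a ∉ K ∨
      u = b ∧ c v d ∈ K ∧ c v b ∉ K ∨ u = d ∧ c v a ∈ K ∧ c v d ∉ K := by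
    rintro u ⟨h1, h2, h3⟩
    rcases (hOv u).1 h1.symm with rfl | rfl | rfl
    · rw [e1] at h2
      exact Or.inl ⟨rfl, h2, h3⟩
    · rw [e2] at h2
      exact Or.inr (Or.inl ⟨rfl, h2, h3⟩)
    · rw [e3] at h2
      exact Or.inr (Or.inr ⟨rfl, h2, h3⟩)
  constructor
  · intro u u' hu hu'
    have h1 := hinto u hu
    have h2 := hinto u' hu'
    rcases h1 with ⟨rfl, h1, h1'⟩ | ⟨rfl, h1, h1'⟩ | ⟨rfl, h1, h1'⟩ <;>
      rcases h2 with ⟨rfl, h2, h2'⟩ | ⟨rfl, h2, h2'⟩ | ⟨rfl, h2, h2'⟩ <;>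
      first | rfl | contradiction
  · intro u hu
    have h1 := hinto u hu
    by_cases ha' : c v a ∈ K <;> by_cases hb' : c v b ∈ K <;> by_cases hd' : c v d ∈ K <;>
      first
      | exact ⟨a, ha, ha', by rwa [e1]⟩
      | exact ⟨b, hb, hb', by rwa [e2]⟩
      | exact ⟨d, hd, hd', by rwa [e3]⟩
      | tauto

/-- If no trail returns to `W`, the trails from exits at different vertices of `W` to `S` contain
disjoint paths. (The trails themselves may use the same edges in opposite directions. Such edges are
left out.) -/
theorem IsState.hasDisjointPaths [Finite V]
    (hc : IsState G (outside G (S ∪ W)) (S ∪ W) c)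
    (hdeg : ∀ s ∈ S, ∀ w w', (outside G (S ∪ W)).Adj s w → (outside G (S ∪ W)).Adj s w' → w = w')
    (harc : ∀ x y, ¬ IsArc (outside G (S ∪ W)) W c x y) (F : Finset V) (y : V → V)
    (hF : ∀ x ∈ F, IsExit (outside G (S ∪ W)) W (x, y x)) :
    HasDisjointPaths (G.deleteEdges (within G (S ∪ W)).edgeSet) W S F.card := by
  set O := outside G (S ∪ W) with hOdef
  set K : Set ℕ := {κ | ∃ x ∈ F, κ = c x (y x)} with hK
  have hsrc : ∀ w ∈ W, ∀ u, ¬ IsTrailArc O c K u w := by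
    rintro w hw u ⟨h1, ⟨x, hx, h2⟩, -⟩
    exact harc (x, y x) (w, u) ⟨hF x hx, ⟨hw, h1.symm⟩, h2.symm⟩
  have hrot : ∀ v ∉ S ∪ W, ∀ w, O.Adj v w ↔ G.Adj v w := fun v hv w =>
    ⟨fun h => h.1, fun h => ⟨h, fun h' => hv h'.1⟩⟩
  have hin : ∀ v v' w, IsTrailArc O c K v w → IsTrailArc O c K v' w → v = v' := by
    intro v v' w h1 h2
    by_cases hw : w ∈ S ∪ W
    · rcases hw with hw | hw
      · exact hdeg w hw _ _ h1.1.symm h2.1.symm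
      · exact absurd h1 (hsrc w hw v)
    · exact (isTrailArc_rotation (hc.rot w hw) (hrot w hw) K).1 v v' h1 h2
  have hcont : ∀ u v, IsTrailArc O c K u v → v ∉ S → ∃ w, IsTrailArc O c K v w := by
    intro u v h1 hv
    have hv' : v ∉ S ∪ W := by
      rintro (h | h)
      exacts [hv h, hsrc v h u h1]
    exact (isTrailArc_rotation (hc.rot v hv') (hrot v hv') K).2 u h1
  have hmain : ∀ x ∈ F, ∃ n, (step (IsTrailArc O c K))^[n] x ∈ S ∧ ∀ i < n, IsTrailArc O c K
      ((step (IsTrailArc O c K))^[i] x) ((step (IsTrailArc O c K))^[i + 1] x) := by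
    intro x hx
    refine exists_iterate_mem hin hcont ⟨y x, (hF x hx).2, ⟨x, hx, rfl⟩, ?_⟩ (hsrc x (hF x hx).1)
    rintro ⟨x', hx', h⟩
    exact harc (x', y x') (x, y x) ⟨hF x' hx', hF x hx, h.symm⟩
  have hH : ∀ v w, IsTrailArc O c K v w → (G.deleteEdges (within G (S ∪ W)).edgeSet).Adj v w := by
    rintro v w ⟨h, -⟩
    rw [deleteEdges_adj]
    exact ⟨h.1, fun h' => h.2 ((mem_edgeSet _).1 h').2⟩
  choose! n hnS hnA using hmain
  have e := F.equivFin.symm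
  choose p hp hps using fun x (hx : x ∈ F) => exists_path_of_iterate hH x (n x) (hnA x hx)
  refine ⟨fun i => e i, _, fun i => p (e i) (e i).2, fun i => ⟨(hF _ (e i).2).1, hnS _ (e i).2,
    hp _ (e i).2⟩, fun i k hik => ?_⟩
  intro v hv hv'
  obtain ⟨a, ha, rfl⟩ := hps _ (e i).2 v hv
  obtain ⟨b, hb, heq⟩ := hps _ (e k).2 _ hv'
  exact hik (e.injective (Subtype.ext (eq_of_iterate_eq hin (hsrc _ (hF _ (e i).2).1)
    (hsrc _ (hF _ (e k).2).1) (hnA _ (e i).2) (hnA _ (e k).2) a ha b hb heq)))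

end Paths

/-! ### Additions of big-forks -/

section BigFork

variable {V : Type u} {G : SimpleGraph V} {S W C : Set V} {L : SimpleGraph V} {η : V → V} {j : ℕ}
  {c : V → V → ℕ}

theorem IsTwoConnected.exists_two_adj {U : Type u} {H : SimpleGraph U} [Finite U]
    (h : IsTwoConnected H) (v : U) : ∃ a b, a ≠ b ∧ H.Adj v a ∧ H.Adj v b := by
  classical
  have := Fintype.ofFinite U
  obtain ⟨h1, h2, h3⟩ := h
  rw [Nat.card_eq_fintype_card] at h2
  have : Nontrivial U := Fintype.one_lt_card_iff_nontrivial.1 (by omega)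
  obtain ⟨a, ha⟩ := h1.preconnected.exists_adj_of_nontrivial v
  obtain ⟨x, hx⟩ : ∃ x, x ∉ ({v, a} : Finset U) := by
    by_contra hno
    push Not at hno
    have h4 := Finset.card_le_card (fun x _ => hno x : Finset.univ ⊆ ({v, a} : Finset U))
    have h5 := Finset.card_le_two (a := v) (b := a)
    rw [Finset.card_univ] at h4
    omega
  simp only [Finset.mem_insert, Finset.mem_singleton, not_or] at hx
  have : Nontrivial ({a}ᶜ : Set U) :=
    ⟨⟨v, ha.ne⟩, ⟨x, hx.2⟩, fun h => hx.1 (Subtype.ext_iff.1 h).symm⟩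
  obtain ⟨b, hb⟩ := (h3 a).preconnected.exists_adj_of_nontrivial ⟨v, ha.ne⟩
  exact ⟨a, b, fun h => b.2 h.symm, ha, hb⟩

theorem outside_adj_unique [Finite V] (hG : IsCubic G) (hS : IsTwoConnected (G.induce S))
    {T : Set V} (hST : S ⊆ T) {s w w' : V} (hs : s ∈ S) (hw : (outside G T).Adj s w)
    (hw' : (outside G T).Adj s w') : w = w' := by
  classical
  by_contra hne
  obtain ⟨a, b, hab, ha, hb⟩ := hS.exists_two_adj ⟨s, hs⟩
  have hout : ∀ {x}, (outside G T).Adj s x → ∀ y : S, (y : V) ≠ x := by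
    rintro x hx y rfl
    exact hx.2 ⟨hST hs, hST y.2⟩
  have h1 : ({(a : V), (b : V), w, w'} : Finset V) ⊆ (Set.toFinite (G.neighborSet s)).toFinset := by
    intro x hx
    simp only [Finset.mem_insert, Finset.mem_singleton] at hx
    rw [Set.Finite.mem_toFinset]
    rcases hx with rfl | rfl | rfl | rfl
    exacts [ha, hb, hw.1, hw'.1]
  have h2 := Finset.card_le_card h1
  rw [← Set.ncard_eq_toFinset_card, hG s,
    Finset.card_insert_of_notMem (by
      simp only [Finset.mem_insert, Finset.mem_singleton, not_or]
      exact ⟨fun h => hab (Subtype.ext h), hout hw a, hout hw' a⟩),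
    Finset.card_insert_of_notMem (by
      simp only [Finset.mem_insert, Finset.mem_singleton, not_or]
      exact ⟨hout hw b, hout hw' b⟩), Finset.card_pair hne] at h2
  omega

/-- Edges inside `T` can be given new colours, each to a single dart. -/
theorem IsState.exists_fill [Finite V] {T : Set V} (hc : IsState G (outside G T) T c)
    {O : SimpleGraph V} (hO : outside G T ≤ O) (hOG : O ≤ G) :
    ∃ c', IsState G O T c' ∧ (∀ v w, (outside G T).Adj v w → c' v w = c v w) ∧
      ∀ v ∈ T, ∀ w ∈ T, ∀ v' w', O.Adj v' w' → c' v w = c' v' w' → v = v' ∧ w = w' := by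
  classical
  obtain ⟨g, hg⟩ := exists_injective_nat (V × V)
  obtain ⟨M, hM⟩ := (Set.finite_range fun vw : V × V => c vw.1 vw.2).bddAbove
  have hM : ∀ v w, c v w ≤ M := fun v w => hM ⟨(v, w), rfl⟩
  set c' : V → V → ℕ := fun v w => if v ∈ T ∧ w ∈ T then M + 1 + g (v, w) else c v w with hc'
  have hold : ∀ {v w}, ¬ (v ∈ T ∧ w ∈ T) → c' v w = c v w := fun h => if_neg h
  have hnew : ∀ {v w}, v ∈ T → w ∈ T → c' v w = M + 1 + g (v, w) := fun hv hw => if_pos ⟨hv, hw⟩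
  have huniq : ∀ v ∈ T, ∀ w ∈ T, ∀ v' w', c' v w = c' v' w' → v = v' ∧ w = w' := by
    intro v hv w hw v' w' h
    rw [hnew hv hw] at h
    by_cases h' : v' ∈ T ∧ w' ∈ T
    · rw [hnew h'.1 h'.2, Nat.add_left_cancel_iff] at h
      exact Prod.ext_iff.1 (hg h)
    · rw [hold h'] at h
      have := hM v' w'
      omega
  have hout : ∀ {v w}, O.Adj v w → ¬ (v ∈ T ∧ w ∈ T) → (outside G T).Adj v w := fun h h' =>
    ⟨hOG h, h'⟩
  refine ⟨c', ⟨⟨fun v hv w hvw => hO (hc.adj v hv w hvw), fun v w hvw => ?_, fun v hv => ?_⟩,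
    fun v hv v' hv' w w' hvw hvw' h => ?_, fun v hv v' hv' w w' hvw hvw' h => ?_⟩,
    fun v w hvw => hold hvw.2, fun v hv w hw v' w' _ h => huniq v hv w hw v' w' h⟩
  · by_cases h : v ∈ T ∧ w ∈ T
    · exact fun h' => hvw.ne (huniq v h.1 w h.2 _ _ h').1
    · rw [hold h, hold fun h' => h h'.symm]
      exact hc.ne v w (hout hvw h)
  · obtain ⟨a, b, d, hab, hbd, had, hadj, e1, e2, e3⟩ := hc.rot v hv
    have h1 : ∀ w, c' v w = c v w := fun w => hold fun h => hv h.1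
    have h2 : ∀ w, c' w v = c w v := fun w => hold fun h => hv h.2
    exact ⟨a, b, d, hab, hbd, had, hadj, by rw [h1, h2, e1], by rw [h1, h2, e2],
      by rw [h1, h2, e3]⟩
  · by_cases hw : w ∈ T
    · exact huniq v hv w hw _ _ h
    · by_cases hw' : w' ∈ T
      · exact (huniq v' hv' w' hw' _ _ h.symm).imp Eq.symm Eq.symm
      · have h1 : ¬ (v ∈ T ∧ w ∈ T) := fun h => hw h.2
        have h2 : ¬ (v' ∈ T ∧ w' ∈ T) := fun h => hw' h.2
        rw [hold h1, hold h2] at h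
        exact hc.out_inj v hv v' hv' w w' (hout hvw h1) (hout hvw' h2) h
  · by_cases hw : w ∈ T
    · exact (huniq w hw v hv _ _ h).symm
    · by_cases hw' : w' ∈ T
      · exact ((huniq w' hw' v' hv' _ _ h.symm).imp Eq.symm Eq.symm).symm
      · have h1 : ¬ (v ∈ T ∧ w ∈ T) := fun h => hw h.2
        have h2 : ¬ (v' ∈ T ∧ w' ∈ T) := fun h => hw' h.2
        rw [hold fun h => h1 h.symm, hold fun h => h2 h.symm] at h
        exact hc.in_inj v hv v' hv' w w' (hout hvw h1) (hout hvw' h2) h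

/-- A state extends to a big-fork. Without arcs or additional edges there would be too many disjoint
paths for a lean sequence. -/
theorem exists_state_of_bigFork [Finite V] (hG : IsCubic G) (hSW : Disjoint S W)
    (hS : IsTwoConnected (G.induce S)) (hb : IsBold G S W (.bigFork j))
    (hlean : ∀ k, HasDisjointPaths (G.deleteEdges (within G (S ∪ W)).edgeSet) W S k → k ≤ j + 3)
    (hc : IsState G (outside G (S ∪ W)) (S ∪ W) c) : ∃ c', IsState G (outside G S) S c' := by
  classical
  obtain ⟨hj, L, C, hL, hLG, hC, -⟩ := hb
  have hη : ∀ x ∈ C, ∃ y, G.Adj x y ∧ y ∈ S := by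
    intro x hx
    obtain ⟨y, hy⟩ := (Set.ncard_pos (Set.toFinite _)).1 (hC x hx)
    exact ⟨y, hy.1, hy.2⟩
  choose! η hηG hηS using hη
  have hA : IsAttached G S L W C η := ⟨fun v w h => (hLG h).1, hSW, hηS, hηG⟩
  have hOO : outside G (S ∪ W) ≤ G \ bare S L C η := fun v w h =>
    ⟨h.1, fun h' => h.2 (hL.mem_of_bare_adj hA h')⟩
  obtain ⟨c₁, hc₁, hold, huniq⟩ := hc.exists_fill hOO sdiff_le
  obtain ⟨F, hF, hFW, hdeg⟩ := hL.exists_finset hA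
  have hex : ∀ x ∈ F, ∃ y, IsExit (G \ bare S L C η) W (x, y) := by
    intro x hx
    obtain ⟨a, b, hab⟩ := hdeg x hx
    obtain ⟨y, hy⟩ := exists_sdiff_adj hG hab
    exact ⟨y, hFW hx, hy⟩
  choose! y hy using hex
  refine hL.exists_state hG hA hc₁ ?_
  by_cases harc : ∃ x y, IsArc (G \ bare S L C η) W c₁ x y
  · exact Or.inr (Or.inr ⟨hj, harc⟩)
  push Not at harc
  by_cases hextra : ∃ x, IsExit (G \ bare S L C η) W x ∧ x.2 ∈ S ∪ W
  · obtain ⟨x, hx, hx2⟩ := hextra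
    obtain ⟨u, hu, hxu⟩ : ∃ u, IsExit (G \ bare S L C η) W u ∧ x ≠ u := by
      obtain ⟨a, ha, b, hb, hab⟩ := Finset.one_lt_card.1 (by omega : 1 < F.card)
      by_cases hxa : x.1 = a
      · exact ⟨_, hy b hb, fun h => hab (hxa.symm.trans (Prod.ext_iff.1 h).1)⟩
      · exact ⟨_, hy a ha, fun h => hxa (Prod.ext_iff.1 h).1⟩
    refine Or.inr (Or.inl ⟨harc, x, u, hxu, hx, hu, fun v w hvw h1 h2 => hxu ?_⟩)
    obtain ⟨rfl, rfl⟩ := huniq x.1 (Or.inr hx.1) x.2 hx2 v w hvw h1.symm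
    obtain ⟨h3, h4⟩ := huniq x.2 hx2 x.1 (Or.inr hx.1) _ _ hu.2.symm h2
    exact Prod.ext h4 h3
  · exfalso
    push Not at hextra
    have hyO : ∀ x ∈ F, IsExit (outside G (S ∪ W)) W (x, y x) := fun x hx =>
      ⟨hFW hx, ((hy x hx).2).1, fun h => hextra _ (hy x hx) h.2⟩
    have h1 := hlean F.card (hc.hasDisjointPaths
      (fun s hs w w' hw hw' => outside_adj_unique hG hS Set.subset_union_left hs hw hw')
      (fun u v huv => harc u v ⟨⟨huv.1.1, hOO huv.1.2⟩, ⟨huv.2.1.1, hOO huv.2.1.2⟩, by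
        rw [hold _ _ huv.1.2, hold _ _ huv.2.1.2.symm]
        exact huv.2.2⟩) F y hyO)
    omega

end BigFork

/-! ### The number of half-edges, and the addition of the fork -/

section Boundary

variable {V : Type u} {G : SimpleGraph V} {S W : Set V} {c : V → V → ℕ}

/-- The vertices of `S` with a neighbour outside `S`. -/
def boundary (G : SimpleGraph V) (S : Set V) : Set V := {v | v ∈ S ∧ ∃ w, w ∉ S ∧ G.Adj v w}

/-- The vertices of `S` with a neighbour in `W`. -/
def attached (G : SimpleGraph V) (S W : Set V) : Set V := {v | v ∈ S ∧ ∃ w ∈ W, G.Adj v w}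

theorem outside_adj_of_mem {T : Set V} {v w : V} (hv : v ∈ T) :
    (outside G T).Adj v w ↔ w ∉ T ∧ G.Adj v w :=
  ⟨fun h => ⟨fun hw => h.2 ⟨hv, hw⟩, h.1⟩, fun h => ⟨h.2, fun h' => h.1 h'.2⟩⟩

theorem attached_subset (hSW : Disjoint S W) : attached G S W ⊆ boundary G S := by
  rintro v ⟨hv, w, hw, hvw⟩
  exact ⟨hv, w, fun h => Set.disjoint_left.1 hSW h hw, hvw⟩

theorem boundary_union_inter [Finite V] (hG : IsCubic G) (hS : IsTwoConnected (G.induce S))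
    (hSW : Disjoint S W) : boundary G (S ∪ W) ∩ S ⊆ boundary G S \ attached G S W := by
  rintro v ⟨⟨-, w, hw, hvw⟩, hv⟩
  have hwS : w ∉ S := fun h => hw (Or.inl h)
  refine ⟨⟨hv, w, hwS, hvw⟩, ?_⟩
  rintro ⟨-, w', hw', hvw'⟩
  have hw'S : w' ∉ S := fun h => Set.disjoint_left.1 hSW h hw'
  have h1 := outside_adj_unique hG hS le_rfl hv ((outside_adj_of_mem hv).2 ⟨hwS, hvw⟩)
    ((outside_adj_of_mem hv).2 ⟨hw'S, hvw'⟩)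
  exact hw (Or.inr (h1 ▸ hw'))

variable {k n m : ℕ} {f : Fin k → V} {nb : Fin k → Fin 3 → V} {link : Fin k → Fin 3 → Link k n}

theorem eq_of_degIn_eq_one {s w w' : V} (h : degIn G W s = 1) (hw : w ∈ W) (hsw : G.Adj s w)
    (hw' : w' ∈ W) (hsw' : G.Adj s w') : w = w' := by
  obtain ⟨x, hx⟩ := Set.ncard_eq_one.1 h
  have h1 : w ∈ G.neighborSet s ∩ W := ⟨hsw, hw⟩
  have h2 : w' ∈ G.neighborSet s ∩ W := ⟨hsw', hw'⟩
  rw [hx] at h1 h2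
  exact h1.trans h2.symm

theorem IsPiece.le_ncard_attached [Finite V]
    (h : IsPiece G (outside G (S ∪ Set.range f)) (S ∪ Set.range f) f nb link)
    (hatt : ∀ v ∈ S, (∃ w ∈ Set.range f, G.Adj v w) → degIn G (Set.range f) v = 1)
    {D : Fin m → Fin k × Fin 3} (hD : Function.Injective D)
    (hdown : ∀ x, link (D x).1 (D x).2 = .down) : m ≤ (attached G S (Set.range f)).ncard := by
  have hadj : ∀ x, G.Adj (nb (D x).1 (D x).2) (f (D x).1) := fun x =>
    ((h.adj _ _).2 ⟨_, rfl⟩).symm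
  have hmem : ∀ x, nb (D x).1 (D x).2 ∈ S := fun x =>
    (h.down _ _ (hdown x)).1.resolve_right (h.down _ _ (hdown x)).2.1
  have hinj : Function.Injective fun x => nb (D x).1 (D x).2 := by
    intro x y hxy
    have h1 := hadj y
    simp only at hxy
    rw [← hxy] at h1
    have h2 := h.inj (eq_of_degIn_eq_one (hatt _ (hmem x) ⟨_, ⟨_, rfl⟩, hadj x⟩) ⟨_, rfl⟩ (hadj x)
      ⟨_, rfl⟩ h1)
    rw [← h2] at hxy
    exact hD (Prod.ext h2 (h.nb_inj _ hxy))
  have h1 := Set.ncard_le_ncard (s := Set.range fun x => nb (D x).1 (D x).2)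
    (t := attached G S (Set.range f)) (by
      rintro _ ⟨x, rfl⟩
      exact ⟨hmem x, _, ⟨_, rfl⟩, hadj x⟩)
  rwa [← Set.image_univ, Set.ncard_image_of_injective _ hinj, Set.ncard_univ,
    Nat.card_eq_fintype_card, Fintype.card_fin] at h1

theorem IsPiece.ncard_boundary_inter_le [Finite V]
    (h : IsPiece G (outside G (S ∪ Set.range f)) (S ∪ Set.range f) f nb link)
    {U : Fin n → Fin k × Fin 3} (hU : IsUpPort link U) :
    (boundary G (S ∪ Set.range f) ∩ Set.range f).ncard ≤ n := by
  have h1 := Set.ncard_le_ncard (s := boundary G (S ∪ Set.range f) ∩ Set.range f)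
    (t := Set.range fun x => f (U x).1) (by
      rintro _ ⟨⟨-, w, hw, hvw⟩, a, rfl⟩
      obtain ⟨p, rfl⟩ := (h.adj a w).1 hvw
      rcases hl : link a p with ⟨b, q⟩ | x | _
      · exact absurd (Or.inr ⟨b, (h.inner _ _ _ _ hl).1.symm⟩) hw
      · refine ⟨x, ?_⟩
        simp only [hU.2 a p x (isUp_iff.2 hl)]
      · exact absurd (h.down _ _ hl).1 hw)
  refine h1.trans ?_
  rw [← Set.image_univ]
  refine (Set.ncard_image_le (Set.toFinite _)).trans ?_
  rw [Set.ncard_univ, Nat.card_eq_fintype_card, Fintype.card_fin]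

theorem IsBoldCopy.ncard_boundary_le [Finite V] (hG : IsCubic G)
    (hS : IsTwoConnected (G.induce S)) (hSW : Disjoint S W)
    (hatt : ∀ v ∈ S, (∃ w ∈ W, G.Adj v w) → degIn G W v = 1)
    {P : SimpleGraph (Fin k)} {h : Fin k → ℕ} (hb : IsBoldCopy G S W P h)
    {link : Fin k → Fin 3 → Link k n} (hm : IsMatched link) (hs : HasShape link P h)
    {U : Fin n → Fin k × Fin 3} (hU : IsUpPort link U)
    {D : Fin n → Fin k × Fin 3} (hD : Function.Injective D)
    (hdown : ∀ x, isDown link (D x).1 (D x).2 = true) :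
    (boundary G (S ∪ W)).ncard ≤ (boundary G S).ncard := by
  obtain ⟨f, nb, hp, rfl⟩ := hb.exists_isPiece hG hSW hm hs
  have h1 := hp.le_ncard_attached hatt hD fun x => isDown_iff.1 (hdown x)
  have h2 := hp.ncard_boundary_inter_le hU
  have h3 := Set.ncard_le_ncard (boundary_union_inter hG hS hSW)
  have h4 := Set.ncard_sdiff_add_ncard_of_subset (attached_subset (G := G) hSW)
  have h5 : boundary G (S ∪ Set.range f) =
      boundary G (S ∪ Set.range f) ∩ S ∪ boundary G (S ∪ Set.range f) ∩ Set.range f := by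
    rw [← Set.inter_union_distrib_left]
    exact (Set.inter_eq_left.2 fun v hv => hv.1).symm
  have h6 := Set.ncard_union_le (boundary G (S ∪ Set.range f) ∩ S)
    (boundary G (S ∪ Set.range f) ∩ Set.range f)
  rw [← h5] at h6
  omega

theorem IsForkTower.le_ncard_connecting [Finite V] {j : ℕ} {L : SimpleGraph V} {C : Set V}
    (h : IsForkTower j L W C) : j + 3 ≤ C.ncard := by
  induction h with
  | fork f =>
    rw [Set.ncard_insert_of_notMem (by simp), Set.ncard_pair (by simp)]
  | addStar h t ht p q hp hq hpq _ _ _ _ ih =>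
    rw [Set.ncard_insert_of_notMem fun h3 =>
      Set.disjoint_left.1 ht ⟨3, rfl⟩ (h.connecting_subset h3)]
    omega

/-- Before the fork is added, at most three half-edges are available. -/
theorem ncard_boundary_le_three [Finite V] (hG : IsCubic G) (hS : IsTwoConnected (G.induce S))
    {ty : ForkType} (hadd : IsAddition G S W ty) (hty : ty ≠ .fork)
    (h3 : (boundary G S).ncard ≤ 3) : (boundary G (S ∪ W)).ncard ≤ 3 := by
  obtain ⟨hSW, hb, hatt⟩ := hadd
  have hatt' : ∀ v ∈ S, (∃ w ∈ W, G.Adj v w) → degIn G W v = 1 := fun v hv hw => (hatt v hv hw).2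
  cases ty with
  | dot =>
    rcases hb with hb | hb
    · exact (hb.ncard_boundary_le hG hS hSW hatt' (link := dotTwoLink) (by decide)
        hasShape_dotTwo (U := ![(0, 2)]) (by decide) (D := ![(0, 0)]) (by decide)
        (by decide)).trans h3
    · exact (hb.ncard_boundary_le hG hS hSW hatt' (link := dotThreeLink) (by decide)
        hasShape_dotThree (U := ![]) (by decide) (D := ![]) (by decide) (by decide)).trans h3
  | subfork =>
    exact (IsBoldCopy.ncard_boundary_le hG hS hSW hatt' hb (link := subforkLink) (by decide)
      hasShape_subfork (U := ![(0, 2), (1, 2)]) (by decide) (D := ![(0, 1), (1, 1)]) (by decide)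
      (by decide)).trans h3
  | starFork =>
    exact (IsBoldCopy.ncard_boundary_le hG hS hSW hatt' hb (link := starLink id) (by decide +kernel)
      hasShape_starFork (U := ![(1, 2), (2, 2), (3, 2)]) (by decide +kernel)
      (D := ![(1, 1), (2, 1), (3, 1)]) (by decide) (by decide)).trans h3
  | fork => exact absurd rfl hty
  | pFork =>
    exact (IsBoldCopy.ncard_boundary_le hG hS hSW hatt' hb (link := pForkLink) (by decide +kernel)
      hasShape_pFork (U := ![(7, 2), (1, 2), (4, 2)]) (by decide +kernel)
      (D := ![(0, 2), (3, 2), (7, 1)]) (by decide) (by decide)).trans h3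
  | bigFork j =>
    obtain ⟨hj, L, C, hL, -, hC, -⟩ := hb
    have hη : ∀ x ∈ C, ∃ y, G.Adj y x ∧ y ∈ S := by
      intro x hx
      obtain ⟨y, hy⟩ := (Set.ncard_pos (Set.toFinite _)).1 (hC x hx)
      exact ⟨y, SimpleGraph.Adj.symm hy.1, hy.2⟩
    choose! η hηG hηS using hη
    have hCW := hL.connecting_subset
    have hinj : Set.InjOn η C := by
      intro x hx y hy hxy
      have h1 := hηG y hy
      rw [← hxy] at h1
      exact eq_of_degIn_eq_one (hatt' _ (hηS x hx) ⟨x, hCW hx, hηG x hx⟩) (hCW hx) (hηG x hx)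
        (hCW hy) h1
    have h1 := Set.ncard_le_ncard (s := η '' C) (t := boundary G S) (by
      rintro _ ⟨x, hx, rfl⟩
      exact attached_subset hSW ⟨hηS x hx, x, hCW hx, hηG x hx⟩)
    rw [hinj.ncard_image] at h1
    have h2 := hL.le_ncard_connecting
    omega

/-- If each of four outgoing colours is among the incoming colours, there is no directed 3-cycle:
the fourth colour would have to agree with that of the reverse dart. -/
theorem goodFour_of_forall {u w : Fin 4 → ℕ} (hu : Function.Injective u) (hne : ∀ s, u s ≠ w s)
    (h : ∀ s, ∃ t, u s = w t) : GoodFour u w = true := by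
  rw [goodFour_iff]
  refine ⟨⟨0, h 0⟩, fun s t z h1 h2 h3 => ?_⟩
  have hst : s ≠ t := fun e => hne s (by rw [h1, e])
  have htz : t ≠ z := fun e => hne t (by rw [h2, e])
  have hzs : z ≠ s := fun e => hne z (by rw [h3, e])
  obtain ⟨r, hrs, hrt, hrz⟩ : ∃ r, r ≠ s ∧ r ≠ t ∧ r ≠ z := by
    have key : ∀ s t z : Fin 4, ∃ r, r ≠ s ∧ r ≠ t ∧ r ≠ z := by decide
    exact key s t z
  obtain ⟨r', hr'⟩ := h r
  have e1 : r' ≠ t := fun e => hrs (hu (by rw [hr', e, h1]))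
  have e2 : r' ≠ z := fun e => hrt (hu (by rw [hr', e, h2]))
  have e3 : r' ≠ s := fun e => hrz (hu (by rw [hr', e, h3]))
  have e4 : r' ≠ r := fun e => hne r (by rw [hr', e])
  omega

/-- The fork uses all three available half-edges. All trails then stay at the fork itself. -/
theorem exists_state_of_fork [Finite V] (hG : IsCubic G) (hS : IsTwoConnected (G.induce S))
    (hSW : Disjoint S W) (hatt : ∀ v ∈ S, (∃ w ∈ W, G.Adj v w) → degIn G W v = 1)
    (h3 : (boundary G S).ncard ≤ 3) (hb : IsBoldCopy G S W forkGraph ![0, 1, 1, 0, 1])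
    (hc : IsState G (outside G (S ∪ W)) (S ∪ W) c) : ∃ c', IsState G (outside G S) S c' := by
  obtain ⟨f, nb, hp, rfl⟩ := hb.exists_isPiece hG hSW (link := forkLink) (by decide +kernel)
    hasShape_fork
  have h1 := hp.le_ncard_attached hatt (D := ![(1, 1), (2, 1), (4, 1)]) (by decide) (by
    intro x
    fin_cases x <;> rfl)
  have h2 : attached G S (Set.range f) = boundary G S :=
    Set.eq_of_subset_of_ncard_le (attached_subset hSW) (h3.trans h1)
  have hfork : ∀ v ∈ S ∪ Set.range f, ∀ w, (outside G (S ∪ Set.range f)).Adj v w →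
      ∃ z, (v, w) = forkExit f nb z := by
    intro v hv w hvw
    have hvb : v ∈ boundary G (S ∪ Set.range f) := ⟨hv, w, (outside_adj_of_mem hv).1 hvw⟩
    rcases hv with hv | hv
    · have h4 := boundary_union_inter hG hS hSW ⟨hvb, hv⟩
      rw [h2] at h4
      exact absurd h4.1 h4.2
    · exact hp.eq_forkExit (outside_le _ _) ⟨hv, hvw⟩
  have hex := hp.isExit_forkExit
  obtain ⟨c', hc'⟩ := hp.exists_state_of_hasGoodArc (outside_le _ _) hc
    ⟨forkExit f nb, hp.forkExit_injective, hex, goodFour_of_forall (fun x y hxy =>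
      hp.forkExit_injective (Prod.ext_iff.2 (hc.out_inj _ (hp.mem _) _ (hp.mem _) _ _
        (hex x).2 (hex y).2 hxy))) (fun s => hc.ne _ _ (hex s).2) fun s => by
      obtain ⟨v, hv, w, hvw, heq⟩ := (hc.balance (outside_le _ _) _).1
        ⟨_, hp.mem _, _, (hex s).2, rfl⟩
      obtain ⟨z, hz⟩ := hfork v hv w hvw
      refine ⟨z, ?_⟩
      rw [← hz]
      exact heq.symm⟩
  rw [expose_outside G hSW, Set.union_sdiff_cancel_right (Set.disjoint_iff.1 hSW)] at hc'
  exact ⟨c', hc'⟩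

end Boundary

/-! ### Building sequences -/

section Sequence

variable {V : Type u} {G : SimpleGraph V} {c : V → V → ℕ}

theorem outside_empty (G : SimpleGraph V) : outside G ∅ = G := by
  ext v w
  simp [outside]

/-- By balance, every colour that enters a triangle leaves it again, so that it can be coloured. -/
theorem exists_coloring_of_triangle [Finite V] (hG : IsCubic G) {T : Set V} (hT : IsTriangle G T)
    (hc : IsState G (outside G T) T c) : ∃ c', IsFaceColoring G G ∅ c' := by
  obtain ⟨p, q, r, hpq, hqr, hrp, rfl⟩ := hT
  set f : Fin 3 → V := ![p, q, r] with hf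
  have hfi : Function.Injective f := by
    intro a b hab
    fin_cases a <;> fin_cases b <;> first | rfl | skip
    exacts [absurd hab hpq.ne, absurd hab hrp.ne', absurd hab hpq.ne', absurd hab hqr.ne,
      absurd hab hrp.ne, absurd hab hqr.ne']
  have hrange : Set.range f = {p, q, r} := by
    ext v
    simp only [hf, Set.mem_range, Set.mem_insert_iff, Set.mem_singleton_iff]
    constructor
    · rintro ⟨a, rfl⟩
      fin_cases a <;> simp
    · rintro (rfl | rfl | rfl)
      exacts [⟨0, rfl⟩, ⟨1, rfl⟩, ⟨2, rfl⟩]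
  have hadj : ∀ a b, a ≠ b → G.Adj (f a) (f b) := by
    intro a b hab
    fin_cases a <;> fin_cases b <;> first | exact absurd rfl hab | skip
    exacts [hpq, hrp.symm, hpq.symm, hqr, hrp, hqr.symm]
  have hm : IsMatched triangleLink := by decide +kernel
  have hnd : ∀ a k, triangleLink a k ≠ .down := by
    have key : ∀ a k, isDown triangleLink a k = false := by decide
    intro a k hl
    rw [← isDown_iff, key] at hl
    cases hl
  have hin : ∀ a b, a ≠ b ↔ ∃ k l, triangleLink a k = .inner b l := by
    have key : ∀ a b, a ≠ b ↔ ∃ k l, isInner triangleLink a k b l = true := by decide +kernel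
    intro a b
    rw [key]
    simp only [isInner_iff]
  have hU : IsUpPort triangleLink ![(0, 2), (1, 2), (2, 2)] := by decide +kernel
  rw [← hrange] at hc
  obtain ⟨nb, hp, -⟩ := ForkGraph.exists_isPiece (O := outside G (Set.range f)) (S := Set.range f)
    (f := f) (link := triangleLink) hG (fun a _ => f a) hfi (fun a => ⟨a, rfl⟩)
    (fun a p b q hl => isInner_iff.1 (hm.1 a p b q (isInner_iff.2 hl)))
    (fun a p p' b q q' hl hl' => hm.2 a p p' b q q' (isInner_iff.2 hl) (isInner_iff.2 hl'))
    (fun a k hl => absurd hl (hnd a k)) (fun a k k' hl => absurd hl (hnd a k))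
    (fun a w => by
      rw [outside_adj_of_mem (Set.mem_range_self a)]
      constructor
      · rintro ⟨h1, h2⟩
        have hw : w ∈ Set.range f := by
          by_contra hw
          exact h2 ⟨hw, h1⟩
        obtain ⟨b, rfl⟩ := hw
        obtain ⟨k, l, hl⟩ := (hin a b).1 fun hab => h1.ne (congrArg f hab)
        exact Or.inl ⟨k, b, l, hl, rfl⟩
      · rintro (⟨k, b, l, hl, rfl⟩ | ⟨k, hl, -⟩)
        · exact ⟨hadj a b ((hin a b).2 ⟨k, l, hl⟩), fun h => h.1 ⟨b, rfl⟩⟩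
        · exact absurd hl (hnd a k))
  obtain ⟨c', hc'⟩ := hp.exists_state hc (fun x => isUp_iff.1 (hU.1 x))
    (fun a p x hl => hU.2 a p x (isUp_iff.2 hl)) (fun e he hpat => by
      refine exists_of_search triangle_search he (List.all_eq_true.2 fun x _ => ?_)
      rw [Nat.blt_eq, hpat]
      have hO := fun x => hp.up _ _ x (isUp_iff.1 (hU.1 x))
      obtain ⟨_, ⟨a, rfl⟩, w, hvw, heq⟩ := (hc.balance (outside_le _ _) _).2
        ⟨_, ⟨_, rfl⟩, _, hO x, rfl⟩
      refine (patternOf_lt_iff (fun y y' hy => ?_)).2 ?_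
      · have h1 := hp.inj (hc.out_inj _ ⟨_, rfl⟩ _ ⟨_, rfl⟩ _ _ (hO y) (hO y') hy).1
        have h2 : ∀ y y' : Fin 3, ((![(0, 2), (1, 2), (2, 2)] : Fin 3 → Fin 3 × Fin 3) y).1 =
            ((![(0, 2), (1, 2), (2, 2)] : Fin 3 → Fin 3 × Fin 3) y').1 → y = y' := by decide
        exact h2 y y' h1
      · obtain ⟨k, rfl⟩ := (hp.adj a w).1 hvw.1
        rcases hl : triangleLink a k with ⟨b, l⟩ | y | _
        · exact absurd hvw (hp.inner _ _ _ _ hl).2.2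
        · have h1 := hU.2 a k y (isUp_iff.2 hl)
          refine ⟨y, ?_⟩
          simp only [h1]
          exact heq
        · exact absurd hl (hnd a k))
  have h1 := expose_outside G (Set.empty_disjoint (Set.range f))
  rw [Set.empty_union, outside_empty] at h1
  rw [h1, Set.sdiff_self] at hc'
  exact ⟨c', hc'.toIsFaceColoring⟩

variable (s : BuildingSequence G)

theorem BuildingSequence.ncard_boundary_le [Finite V] (hG : IsCubic G) :
    ∀ i ≤ s.n, (∀ k < i, s.type k ≠ .fork) → (boundary G (s.verts i)).ncard ≤ 3 := by
  intro i
  induction i with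
  | zero =>
    intro _ _
    obtain ⟨p, q, r, -, -, -, h⟩ := s.start
    refine (Set.ncard_le_ncard (t := {p, q, r}) fun v hv => h ▸ hv.1).trans ?_
    have h1 := Set.ncard_insert_le p {q, r}
    have h2 := Set.ncard_insert_le q {r}
    rw [Set.ncard_singleton] at h2
    omega
  | succ i ih =>
    intro hi hty
    have h1 := ncard_boundary_le_three hG (s.twoConnected i (by omega)) (s.addition i (by omega))
      (hty i (by omega)) (ih (by omega) fun k hk => hty k (by omega))
    rwa [Set.union_sdiff_cancel (s.mono i (by omega))] at h1

/-- The colouring is found from the end of the building sequence to its beginning. -/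
theorem BuildingSequence.exists_state [Finite V] (hG : IsCubic G) (hs : s.IsLeanSequence) (i : ℕ)
    (hi : i ≤ s.n) : ∃ c, IsState G (outside G (s.verts i)) (s.verts i) c := by
  induction hi using Nat.decreasingInduction with
  | self =>
    have h1 : ∀ v w, ¬ (outside G (s.verts s.n)).Adj v w := fun v w h =>
      h.2 ⟨s.finish ▸ trivial, s.finish ▸ trivial⟩
    have h2 : ∀ v, v ∈ s.verts s.n := fun v => s.finish ▸ trivial
    exact ⟨fun _ _ => 0, ⟨fun v hv => absurd (h2 v) hv, fun v w h => absurd h (h1 v w),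
      fun v hv => absurd (h2 v) hv⟩, fun v _ _ _ w _ h => absurd h (h1 v w),
      fun v _ _ _ w _ h => absurd h (h1 v w)⟩
  | @of_succ i hi ih =>
    obtain ⟨c, hc⟩ := ih
    have hU := Set.union_sdiff_cancel (s.mono i hi)
    have h2 := s.twoConnected i hi.le
    obtain ⟨hSW, hb, hatt⟩ := s.addition i hi
    rw [← hU] at hc
    cases hty : s.type i with
    | dot =>
      rw [hty] at hb
      rcases hb with hb | hb
      · exact exists_state_of_dotTwo hG hSW hb hc
      · exact exists_state_of_dotThree hG hSW hb hc
    | subfork =>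
      rw [hty] at hb
      exact exists_state_of_subfork hG hSW hb hc
    | starFork =>
      rw [hty] at hb
      exact exists_state_of_starFork hG hSW hb hc
    | fork =>
      rw [hty] at hb
      exact exists_state_of_fork hG h2 hSW (fun v hv hw => (hatt v hv hw).2)
        (s.ncard_boundary_le hG i hi.le fun k hk hk' => by
          have := s.fork_once i hi k (by omega) hty hk'
          omega) hb hc
    | pFork =>
      rw [hty] at hb
      exact exists_state_of_pFork hG hSW hb hc
    | bigFork j =>
      rw [hty] at hb
      refine exists_state_of_bigFork hG hSW h2 hb (fun k hk => ?_) hc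
      rw [hU] at hk
      exact hs i hi j hty k hk

theorem BuildingSequence.exists_coloring [Finite V] (hG : IsCubic G) (hs : s.IsLeanSequence) :
    ∃ c, IsFaceColoring G G ∅ c := by
  obtain ⟨c, hc⟩ := s.exists_state hG hs 0 (Nat.zero_le _)
  exact exists_coloring_of_triangle hG s.start hc

end Sequence

/-! ### Y–Δ and Δ–Y transformations -/

section Transformation

variable {V W : Type u} {G : SimpleGraph V} {H : SimpleGraph W}

theorem IsCubic.finite_neighborSet (hG : IsCubic G) (v : V) : (G.neighborSet v).Finite :=
  Set.finite_of_ncard_pos (by rw [hG v]; omega)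

/-- Three different neighbours are all neighbours. -/
theorem IsCubic.adj_iff (hG : IsCubic G) {v a b d : V} (hab : a ≠ b) (hbd : b ≠ d) (had : a ≠ d)
    (ha : G.Adj v a) (hb : G.Adj v b) (hd : G.Adj v d) (w : V) :
    G.Adj v w ↔ w = a ∨ w = b ∨ w = d := by
  have h1 : ({a, b, d} : Set V) = G.neighborSet v := by
    refine Set.eq_of_subset_of_ncard_le ?_ ?_ (hG.finite_neighborSet v)
    · rintro x (rfl | rfl | rfl) <;> assumption
    · rw [hG v, Set.ncard_insert_of_notMem (by simp [hab, had]), Set.ncard_pair hbd]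
  rw [← mem_neighborSet, ← h1]
  rfl

theorem IsCubic.exists_adj_iff (hG : IsCubic G) {v a b : V} (hab : a ≠ b)
    (ha : G.Adj v a) (hb : G.Adj v b) : ∃ d, d ≠ a ∧ d ≠ b ∧ G.Adj v d ∧
      ∀ w, G.Adj v w ↔ w = a ∨ w = b ∨ w = d := by
  obtain ⟨d, hd, hn⟩ := Set.exists_mem_notMem_of_ncard_lt_ncard (s := {a, b})
    (t := G.neighborSet v) (by
      rw [hG v, Set.ncard_pair hab]
      omega)
  simp only [Set.mem_insert_iff, Set.mem_singleton_iff, not_or] at hn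
  exact ⟨d, hn.1, hn.2, hd, hG.adj_iff hab (Ne.symm hn.2) (Ne.symm hn.1) ha hb hd⟩

theorem IsRotation.cases {c : V → V → ℕ} {v x y z : V} (h : IsRotation G c v) (hxy : x ≠ y)
    (hyz : y ≠ z) (hxz : x ≠ z) (hadj : ∀ w, G.Adj v w ↔ w = x ∨ w = y ∨ w = z) :
    (c x v = c v y ∧ c y v = c v z ∧ c z v = c v x) ∨
      (c x v = c v z ∧ c z v = c v y ∧ c y v = c v x) := by
  obtain ⟨a, b, d, -, -, -, hadj', e1, e2, e3⟩ := h
  have hx := (hadj' x).1 ((hadj x).2 (by simp))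
  have hy := (hadj' y).1 ((hadj y).2 (by simp))
  have hz := (hadj' z).1 ((hadj z).2 (by simp))
  rcases hx with rfl | rfl | rfl <;> rcases hy with rfl | rfl | rfl <;>
    rcases hz with rfl | rfl | rfl <;>
    first
    | exact absurd rfl hxy
    | exact absurd rfl hyz
    | exact absurd rfl hxz
    | exact Or.inl ⟨e1, e2, e3⟩
    | exact Or.inl ⟨e2, e3, e1⟩
    | exact Or.inl ⟨e3, e1, e2⟩
    | exact Or.inr ⟨e1, e2, e3⟩
    | exact Or.inr ⟨e2, e3, e1⟩
    | exact Or.inr ⟨e3, e1, e2⟩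

theorem IsRotation.out_injective {c : V → V → ℕ} {v : V} (h : IsRotation G c v)
    (hne : ∀ w, G.Adj v w → c v w ≠ c w v) {x y : V} (hx : G.Adj v x) (hy : G.Adj v y)
    (hxy : c v x = c v y) : x = y := by
  obtain ⟨a, b, d, -, -, -, hadj, e1, e2, e3⟩ := h
  have ha := hne a ((hadj a).2 (by simp))
  have hb := hne b ((hadj b).2 (by simp))
  have hd := hne d ((hadj d).2 (by simp))
  rw [e1] at ha
  rw [e2] at hb
  rw [e3] at hd
  rcases (hadj x).1 hx with rfl | rfl | rfl <;> rcases (hadj y).1 hy with rfl | rfl | rfl <;>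
    first | rfl | exact absurd hxy ‹_› | exact absurd hxy.symm ‹_›

theorem IsRotation.in_injective {c : V → V → ℕ} {v : V} (h : IsRotation G c v)
    (hne : ∀ w, G.Adj v w → c v w ≠ c w v) {x y : V} (hx : G.Adj v x) (hy : G.Adj v y)
    (hxy : c x v = c y v) : x = y := by
  obtain ⟨a, b, d, -, -, -, hadj, e1, e2, e3⟩ := h
  have ha := hne a ((hadj a).2 (by simp))
  have hb := hne b ((hadj b).2 (by simp))
  have hd := hne d ((hadj d).2 (by simp))
  rw [← e3] at ha
  rw [← e1] at hb
  rw [← e2] at hd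
  rcases (hadj x).1 hx with rfl | rfl | rfl <;> rcases (hadj y).1 hy with rfl | rfl | rfl <;>
    first | rfl | exact absurd hxy ‹_› | exact absurd hxy.symm ‹_›

/-- The triangle `T` of the cubic graph `G` is contracted by `f` to the vertex `t` of the cubic
graph `H`. -/
structure IsContraction (G : SimpleGraph V) (H : SimpleGraph W) (T : Set V) (f : V → W) (t : W) :
    Prop where
  cubic : IsCubic G
  cubic' : IsCubic H
  triangle : IsTriangle G T
  surj : Function.Surjective f
  eq_iff : ∀ v, f v = t ↔ v ∈ T
  injOn : Set.InjOn f Tᶜ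
  adj : ∀ x y, H.Adj x y ↔ x ≠ y ∧ ∃ a b, f a = x ∧ f b = y ∧ G.Adj a b

namespace IsContraction

variable {T : Set V} {f : V → W} {t : W} {c : V → V → ℕ} {c' : W → W → ℕ}

theorem eq_of_eq (h : IsContraction G H T f t) {v v' : V} (hv : v ∉ T) (hvv : f v' = f v) :
    v' = v :=
  h.injOn (fun h' => hv ((h.eq_iff v).1 (hvv ▸ (h.eq_iff v').2 h'))) hv hvv

theorem ne (h : IsContraction G H T f t) {v w : V} (hvw : G.Adj v w) (hT : ¬ (v ∈ T ∧ w ∈ T)) :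
    f v ≠ f w := by
  intro heq
  by_cases hv : v ∈ T
  · exact hT ⟨hv, (h.eq_iff w).1 (heq ▸ (h.eq_iff v).2 hv)⟩
  · exact hvw.ne (h.eq_of_eq hv heq.symm).symm

theorem map_adj (h : IsContraction G H T f t) {v w : V} (hvw : G.Adj v w)
    (hT : ¬ (v ∈ T ∧ w ∈ T)) : H.Adj (f v) (f w) :=
  (h.adj _ _).2 ⟨h.ne hvw hT, v, w, rfl, rfl, hvw⟩

theorem exists_adj (h : IsContraction G H T f t) {v : V} (hv : v ∉ T) {y : W}
    (hy : H.Adj (f v) y) : ∃ w, f w = y ∧ G.Adj v w := by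
  obtain ⟨-, a, w, ha, hw, haw⟩ := (h.adj _ _).1 hy
  rw [h.eq_of_eq hv ha] at haw
  exact ⟨w, hw, haw⟩

/-- The neighbours of a vertex that is not in the triangle remain different. -/
theorem injOn_neighborSet (h : IsContraction G H T f t) {v : V} (hv : v ∉ T) :
    Set.InjOn f (G.neighborSet v) := by
  have h1 : f '' G.neighborSet v = H.neighborSet (f v) := by
    ext y
    constructor
    · rintro ⟨w, hw, rfl⟩
      exact h.map_adj hw fun h' => hv h'.1
    · intro hy
      obtain ⟨w, hw, hvw⟩ := h.exists_adj hv hy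
      exact ⟨w, hvw, hw⟩
  refine Set.injOn_of_ncard_image_eq ?_ (h.cubic.finite_neighborSet v)
  rw [h1, h.cubic v, h.cubic' (f v)]

theorem exists_coloring_of_contracted [Finite V] (h : IsContraction G H T f t)
    (hc : IsFaceColoring H H ∅ c') : ∃ c, IsFaceColoring G G ∅ c := by
  have hrot := fun x => hc.rot x (Set.notMem_empty x)
  have hne : ∀ x y, H.Adj x y → c' x y ≠ c' y x := hc.ne
  have hout : ∀ {v w}, v ∈ T → (outside G T).Adj v w → w ∉ T ∧ H.Adj t (f w) := by
    intro v w hv hvw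
    refine ⟨fun hw => hvw.2 ⟨hv, hw⟩, ?_⟩
    rw [← (h.eq_iff v).2 hv]
    exact h.map_adj hvw.1 hvw.2
  have hsame : ∀ {v v' w w'}, v ∈ T → v' ∈ T → (outside G T).Adj v w → (outside G T).Adj v' w' →
      f w = f w' → v = v' ∧ w = w' := by
    intro v v' w w' hv hv' hvw hvw' heq
    obtain ⟨hw, -⟩ := hout hv hvw
    obtain ⟨hw', -⟩ := hout hv' hvw'
    obtain rfl := h.injOn hw hw' heq
    exact ⟨h.injOn_neighborSet hw hvw.1.symm hvw'.1.symm
      (((h.eq_iff v).2 hv).trans ((h.eq_iff v').2 hv').symm), rfl⟩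
  refine exists_coloring_of_triangle h.cubic h.triangle (c := fun v w => c' (f v) (f w))
    ⟨⟨fun v hv w hvw => ⟨hvw, fun h' => hv h'.1⟩, fun v w hvw => hne _ _ (h.map_adj hvw.1 hvw.2),
      fun v hv => ?_⟩, fun v hv v' hv' w w' hvw hvw' heq => ?_,
      fun v hv v' hv' w w' hvw hvw' heq => ?_⟩
  · obtain ⟨a, b, d, hab, hbd, had, hadj, e1, e2, e3⟩ := hrot (f v)
    obtain ⟨a, rfl, ha⟩ := h.exists_adj hv ((hadj a).2 (by simp))
    obtain ⟨b, rfl, hb⟩ := h.exists_adj hv ((hadj b).2 (by simp))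
    obtain ⟨d, rfl, hd⟩ := h.exists_adj hv ((hadj d).2 (by simp))
    have hab' : a ≠ b := fun h => hab (congrArg f h)
    have hbd' : b ≠ d := fun h => hbd (congrArg f h)
    have had' : a ≠ d := fun h => had (congrArg f h)
    exact ⟨a, b, d, hab', hbd', had', h.cubic.adj_iff hab' hbd' had' ha hb hd, e1, e2, e3⟩
  · simp only [(h.eq_iff v).2 hv, (h.eq_iff v').2 hv'] at heq
    exact hsame hv hv' hvw hvw' ((hrot t).out_injective (hne t) (hout hv hvw).2
      (hout hv' hvw').2 heq)
  · simp only [(h.eq_iff v).2 hv, (h.eq_iff v').2 hv'] at heq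
    exact hsame hv hv' hvw hvw' ((hrot t).in_injective (hne t) (hout hv hvw).2
      (hout hv' hvw').2 heq)

open Classical in
/-- The colours of the edges that are not contracted. -/
noncomputable def pullback (G : SimpleGraph V) (f : V → W) (c : V → V → ℕ) (x y : W) : ℕ :=
  if h : ∃ ab : V × V, f ab.1 = x ∧ f ab.2 = y ∧ G.Adj ab.1 ab.2 then c h.choose.1 h.choose.2 else 0

theorem eq_of_adj (h : IsContraction G H T f t) {a b a' b' : V} (hab : G.Adj a b)
    (hab' : G.Adj a' b') (ha : f a = f a') (hb : f b = f b') (hne : f a ≠ f b) :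
    a = a' ∧ b = b' := by
  by_cases hT : a' ∈ T
  · have hbT : b' ∉ T := fun h' => hne (by
      rw [ha, hb, (h.eq_iff a').2 hT, (h.eq_iff b').2 h'])
    obtain rfl := h.eq_of_eq hbT hb
    exact ⟨h.injOn_neighborSet hbT hab.symm hab'.symm ha, rfl⟩
  · obtain rfl := h.eq_of_eq hT ha
    exact ⟨rfl, h.injOn_neighborSet hT hab hab' hb⟩

theorem pullback_eq (h : IsContraction G H T f t) {a b : V} (hab : G.Adj a b) (hne : f a ≠ f b) :
    pullback G f c (f a) (f b) = c a b := by
  have hex : ∃ ab : V × V, f ab.1 = f a ∧ f ab.2 = f b ∧ G.Adj ab.1 ab.2 :=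
    ⟨(a, b), rfl, rfl, hab⟩
  rw [pullback, dif_pos hex]
  obtain ⟨h1, h2, h3⟩ := hex.choose_spec
  obtain ⟨h4, h5⟩ := h.eq_of_adj hab h3 h1.symm h2.symm hne
  rw [← h4, ← h5]

/-- The rotations at the vertices of a triangle are all clockwise or all anticlockwise, as the two
directions of each edge have different colours. So the trails at its outer edges form a rotation. -/
theorem exists_coloring_of_contraction (h : IsContraction G H T f t)
    (hc : IsFaceColoring G G ∅ c) : ∃ c', IsFaceColoring H H ∅ c' := by
  have hrot := fun x => hc.rot x (Set.notMem_empty x)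
  have hne : ∀ x y, G.Adj x y → c x y ≠ c y x := hc.ne
  refine ⟨pullback G f c, fun _ _ _ h => h, fun x y hxy => ?_, fun x _ => ?_⟩
  · obtain ⟨hne', a, b, rfl, rfl, hab⟩ := (h.adj _ _).1 hxy
    rw [h.pullback_eq hab hne', h.pullback_eq hab.symm hne'.symm]
    exact hne a b hab
  · obtain ⟨v, rfl⟩ := h.surj x
    by_cases hv : v ∈ T
    · obtain ⟨p, q, r, hpq, hqr, hrp, hT⟩ := h.triangle
      obtain ⟨p', hp1, hp2, hpp, hpadj⟩ := h.cubic.exists_adj_iff hqr.ne hpq hrp.symm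
      obtain ⟨q', hq1, hq2, hqq, hqadj⟩ := h.cubic.exists_adj_iff hrp.ne hqr hpq.symm
      obtain ⟨r', hr1, hr2, hrr, hradj⟩ := h.cubic.exists_adj_iff hpq.ne hrp hqr.symm
      have hmem : ∀ x, x ∈ T ↔ x = p ∨ x = q ∨ x = r := by
        intro x
        rw [hT]
        rfl
      have hpT : p ∈ T := (hmem p).2 (by simp)
      have hqT : q ∈ T := (hmem q).2 (by simp)
      have hrT : r ∈ T := (hmem r).2 (by simp)
      have hp' : p' ∉ T := by
        rw [hmem]
        rintro (h' | h' | h')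
        exacts [hpp.ne h'.symm, hp1 h', hp2 h']
      have hq' : q' ∉ T := by
        rw [hmem]
        rintro (h' | h' | h')
        exacts [hq2 h', hqq.ne h'.symm, hq1 h']
      have hr' : r' ∉ T := by
        rw [hmem]
        rintro (h' | h' | h')
        exacts [hr1 h', hr2 h', hrr.ne h'.symm]
      have hfv := (h.eq_iff v).2 hv
      have hfp := (h.eq_iff p).2 hpT
      have hfq := (h.eq_iff q).2 hqT
      have hfr := (h.eq_iff r).2 hrT
      have hdist : ∀ {a b a' b'}, a ∈ T → b ∈ T → a ≠ b → G.Adj a a' → G.Adj b b' → a' ∉ T →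
          f a' ≠ f b' := by
        intro a b a' b' ha hb hab haa hbb ha' heq
        have hft : f a = f b := ((h.eq_iff a).2 ha).trans ((h.eq_iff b).2 hb).symm
        exact hab (h.eq_of_adj haa hbb hft heq (h.ne haa fun h' => ha' h'.2)).1
      have d1 := hdist hpT hqT hpq.ne hpp hqq hp'
      have d2 := hdist hqT hrT hqr.ne hqq hrr hq'
      have d3 := hdist hpT hrT hrp.ne' hpp hrr hp'
      have a1 : H.Adj t (f p') := hfp ▸ h.map_adj hpp fun h' => hp' h'.2
      have a2 : H.Adj t (f q') := hfq ▸ h.map_adj hqq fun h' => hq' h'.2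
      have a3 : H.Adj t (f r') := hfr ▸ h.map_adj hrr fun h' => hr' h'.2
      have hadj := h.cubic'.adj_iff d1 d2 d3 a1 a2 a3
      have hcol : ∀ {a a'}, a ∈ T → G.Adj a a' → a' ∉ T →
          pullback G f c t (f a') = c a a' ∧ pullback G f c (f a') t = c a' a := by
        intro a a' ha haa ha'
        have hne' := h.ne haa fun h' => ha' h'.2
        have h1 := h.pullback_eq (c := c) haa hne'
        have h2 := h.pullback_eq (c := c) haa.symm hne'.symm
        rw [(h.eq_iff a).2 ha] at h1 h2
        exact ⟨h1, h2⟩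
      obtain ⟨op, ip⟩ := hcol hpT hpp hp'
      obtain ⟨oq, iq⟩ := hcol hqT hqq hq'
      obtain ⟨or, ir⟩ := hcol hrT hrr hr'
      have np := hne p p' hpp
      have nq := hne q q' hqq
      have nr := hne r r' hrr
      rw [hfv]
      -- The two cyclic orders of the outer edges correspond to the two possible orientations.
      have key : (c p' p = c q q' ∧ c q' q = c r r' ∧ c r' r = c p p') ∨
          (c p' p = c r r' ∧ c r' r = c q q' ∧ c q' q = c p p') := by
        rcases (hrot p).cases hqr.ne (Ne.symm hp2) (Ne.symm hp1) hpadj with hp | hp <;>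
          rcases (hrot q).cases hrp.ne (Ne.symm hq2) (Ne.symm hq1) hqadj with hq | hq <;>
          rcases (hrot r).cases hpq.ne (Ne.symm hr2) (Ne.symm hr1) hradj with hr | hr <;>
          grind
      rcases key with ⟨e1, e2, e3⟩ | ⟨e1, e2, e3⟩
      · exact ⟨f p', f q', f r', d1, d2, d3, hadj, by rw [ip, oq, e1], by rw [iq, or, e2],
          by rw [ir, op, e3]⟩
      · exact ⟨f p', f r', f q', d3, d2.symm, d1, fun w => (hadj w).trans (by tauto),
          by rw [ip, or, e1], by rw [ir, oq, e2], by rw [iq, op, e3]⟩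
    · obtain ⟨a, b, d, hab, hbd, had, hadj, e1, e2, e3⟩ := hrot v
      have ha := (hadj a).2 (by simp)
      have hb := (hadj b).2 (by simp)
      have hd := (hadj d).2 (by simp)
      have hi := h.injOn_neighborSet hv
      have hcol : ∀ w, G.Adj v w → pullback G f c (f v) (f w) = c v w ∧
          pullback G f c (f w) (f v) = c w v := by
        intro w hw
        have hne' := h.ne hw fun h' => hv h'.1
        exact ⟨h.pullback_eq hw hne', h.pullback_eq hw.symm hne'.symm⟩
      refine ⟨f a, f b, f d, fun h => hab (hi ha hb h), fun h => hbd (hi hb hd h),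
        fun h => had (hi ha hd h), fun w => ⟨fun hw => ?_, ?_⟩, ?_, ?_, ?_⟩
      · obtain ⟨w, rfl, hvw⟩ := h.exists_adj hv hw
        rcases (hadj w).1 hvw with rfl | rfl | rfl <;> simp
      · rintro (rfl | rfl | rfl)
        exacts [h.map_adj ha fun h' => hv h'.1, h.map_adj hb fun h' => hv h'.1,
          h.map_adj hd fun h' => hv h'.1]
      · rw [(hcol a ha).2, (hcol b hb).1, e1]
      · rw [(hcol b hb).2, (hcol d hd).1, e2]
      · rw [(hcol d hd).2, (hcol a ha).1, e3]

end IsContraction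

theorem IsTriangleContraction.exists_isContraction (h : IsTriangleContraction G H) :
    ∃ T f t, IsContraction G H T f t := by
  obtain ⟨hG, hH, T, f, t, hT, hs, hft, hi, hadj⟩ := h
  exact ⟨T, f, t, hG, hH, hT, hs, hft, hi, hadj⟩

theorem IsLeanForkGraph.exists_coloring (h : IsLeanForkGraph G) :
    Finite V ∧ IsCubic G ∧ ∃ c, IsFaceColoring G G ∅ c := by
  induction h with
  | build hG s hs => exact ⟨inferInstance, hG, s.exists_coloring hG hs⟩
  | deltaY hG h ih =>
    obtain ⟨hfin, -, c, hc⟩ := ih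
    obtain ⟨T, f, t, h⟩ := h.exists_isContraction
    exact ⟨Finite.of_surjective f h.surj, h.cubic', h.exists_coloring_of_contraction hc⟩
  | yDelta hG h ih =>
    obtain ⟨hfin, -, c, hc⟩ := ih
    obtain ⟨T, f, t, h⟩ := h.exists_isContraction
    have hT : T.Finite := by
      obtain ⟨p, q, r, -, -, -, rfl⟩ := h.triangle
      exact Set.toFinite _
    have hV := Set.finite_univ_iff.1 (Set.union_compl_self T ▸
      hT.union (Set.Finite.of_finite_image (Set.toFinite (f '' Tᶜ)) h.injOn))
    exact ⟨hV, h.cubic, h.exists_coloring_of_contracted hc⟩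

end Transformation

/-! ### From a colouring to a directed cycle double cover -/

section Cover

variable {V : Type u} {G : SimpleGraph V} {c : V → V → ℕ}

/-- In a colouring of a cubic graph the darts are permuted such that each dart is followed by one
that has the same colour and starts where it ends. -/
theorem IsFaceColoring.exists_perm [Finite V] (hc : IsFaceColoring G G ∅ c) :
    ∃ φ : Equiv.Perm G.Dart, ∀ d, (φ d).fst = d.snd ∧ c (φ d).fst (φ d).snd = c d.fst d.snd := by
  have hrot := fun x => hc.rot x (Set.notMem_empty x)
  have hnext : ∀ d : G.Dart, ∃ d' : G.Dart, d'.fst = d.snd ∧ c d'.fst d'.snd = c d.fst d.snd := by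
    rintro ⟨⟨u, v⟩, huv⟩
    obtain ⟨a, b, e, -, -, -, hadj, e1, e2, e3⟩ := hrot v
    rcases (hadj u).1 huv.symm with rfl | rfl | rfl
    · exact ⟨⟨(v, b), (hadj b).2 (by simp)⟩, rfl, e1.symm⟩
    · exact ⟨⟨(v, e), (hadj e).2 (by simp)⟩, rfl, e2.symm⟩
    · exact ⟨⟨(v, a), (hadj a).2 (by simp)⟩, rfl, e3.symm⟩
  choose φ hφ1 hφ2 using hnext
  have hinj : Function.Injective φ := by
    intro d d' h
    have h1 : d.snd = d'.snd := by rw [← hφ1, ← hφ1, h]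
    have h2 : c d.fst d.snd = c d'.fst d'.snd := by rw [← hφ2 d, ← hφ2 d', h]
    rw [← h1] at h2
    have h3 := (hrot d.snd).in_injective (hc.ne d.snd) d.adj.symm (h1 ▸ d'.adj.symm) h2
    exact Dart.ext _ _ (Prod.ext h3 h1)
  have : Finite G.Dart := Finite.of_injective _ (Dart.toProd_injective (G := G))
  exact ⟨Equiv.ofBijective φ (Finite.injective_iff_bijective.1 hinj), fun d => ⟨hφ1 d, hφ2 d⟩⟩

theorem exists_walk_of_perm {φ : Equiv.Perm G.Dart} (hφ : ∀ d, (φ d).fst = d.snd) (d : G.Dart) :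
    ∀ n, ∃ p : G.Walk d.fst (φ^[n] d).fst, p.darts = (List.range n).map fun i => φ^[i] d := by
  intro n
  induction n with
  | zero => exact ⟨Walk.nil, rfl⟩
  | succ n ih =>
    obtain ⟨p, hp⟩ := ih
    have h1 : (φ^[n + 1] d).fst = (φ^[n] d).snd := by
      rw [Function.iterate_succ_apply', hφ]
    rw [h1]
    refine ⟨p.concat (φ^[n] d).adj, ?_⟩
    rw [Walk.darts_concat, hp, List.range_succ, List.map_append]
    simp

/-- An orbit of the permutation is a cycle: at each vertex it has only one outgoing and one incoming
dart, and it does not contain both darts of an edge. -/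
theorem IsFaceColoring.exists_isCycle [Finite V] (hc : IsFaceColoring G G ∅ c)
    {φ : Equiv.Perm G.Dart}
    (hφ : ∀ d, (φ d).fst = d.snd ∧ c (φ d).fst (φ d).snd = c d.fst d.snd) (d : G.Dart) :
    ∃ p : G.Walk d.fst d.fst, p.IsCycle ∧ ∀ e, e ∈ p.darts ↔ φ.SameCycle d e := by
  have hrot := fun x => hc.rot x (Set.notMem_empty x)
  have : Finite G.Dart := Finite.of_injective _ (Dart.toProd_injective (G := G))
  set m := Function.minimalPeriod φ d with hm
  have hmpos : 0 < m := by
    rw [hm, Function.minimalPeriod_pos_iff_mem_periodicPts]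
    exact Function.Injective.mem_periodicPts φ.injective d
  have hper : φ^[m] d = d := Function.iterate_minimalPeriod
  obtain ⟨p, hp⟩ : ∃ p : G.Walk d.fst d.fst, p.darts = (List.range m).map fun i => φ^[i] d := by
    have h1 := exists_walk_of_perm (fun d => (hφ d).1) d m
    rwa [hper] at h1
  have hcol : ∀ i, c (φ^[i] d).fst (φ^[i] d).snd = c d.fst d.snd := by
    intro i
    induction i with
    | zero => rfl
    | succ i ih => rw [Function.iterate_succ_apply', (hφ _).2, ih]
  have hinj : ∀ i ∈ List.range m, ∀ k ∈ List.range m, φ^[i] d = φ^[k] d → i = k := by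
    intro i hi k hk h
    exact (Function.iterate_eq_iterate_iff_of_lt_minimalPeriod (List.mem_range.1 hi)
      (List.mem_range.1 hk)).1 h
  have hsnd : ∀ i k, (φ^[i] d).snd = (φ^[k] d).snd → φ^[i] d = φ^[k] d := by
    intro i k h
    have h1 := (hcol i).trans (hcol k).symm
    rw [← h] at h1
    exact Dart.ext _ _ (Prod.ext ((hrot _).in_injective (hc.ne _) (φ^[i] d).adj.symm
      (h ▸ (φ^[k] d).adj.symm) h1) h)
  refine ⟨p, (Walk.isCycle_def p).2 ⟨⟨?_⟩, ?_, ?_⟩, fun e => ?_⟩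
  · rw [Walk.edges, hp, List.map_map]
    refine List.Nodup.map_on (fun i hi k hk h => hinj i hi k hk ?_) List.nodup_range
    rcases dart_edge_eq_iff _ _ |>.1 h with h1 | h1
    · exact h1
    · refine absurd ?_ (hc.ne _ _ (φ^[k] d).adj)
      beta_reduce at h1
      rw [hcol k, ← hcol i, h1]
      rfl
  · rintro rfl
    have h1 := congrArg List.length hp
    simp only [Walk.darts_nil, List.length_nil, List.length_map, List.length_range] at h1
    omega
  · rw [← Walk.map_snd_darts, hp, List.map_map]
    exact List.Nodup.map_on (fun i hi k hk h => hinj i hi k hk (hsnd i k h)) List.nodup_range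
  · rw [hp, List.mem_map]
    constructor
    · rintro ⟨i, -, rfl⟩
      exact ⟨i, by rw [zpow_natCast, Equiv.Perm.iterate_eq_pow]⟩
    · intro h
      obtain ⟨i, rfl⟩ := h.exists_nat_pow_eq
      refine ⟨i % m, List.mem_range.2 (Nat.mod_lt _ hmpos), ?_⟩
      rw [Function.iterate_mod_minimalPeriod_eq, Equiv.Perm.iterate_eq_pow]

theorem IsFaceColoring.hasDirectedCycleDoubleCover [Finite V] (hc : IsFaceColoring G G ∅ c) :
    HasDirectedCycleDoubleCover G := by
  classical
  obtain ⟨φ, hφ⟩ := hc.exists_perm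
  have : Finite G.Dart := Finite.of_injective _ (Dart.toProd_injective (G := G))
  let Q := Quotient (Equiv.Perm.SameCycle.setoid φ)
  obtain ⟨k, ⟨e⟩⟩ := Finite.exists_equiv_fin Q
  choose p hp hmem using fun d => hc.exists_isCycle hφ d
  refine ⟨k, fun i => (e.symm i).out.fst, fun i => p (e.symm i).out, fun i => hp _, fun d => ?_⟩
  have key : ∀ i, d ∈ (p (e.symm i).out).darts ↔ i = e ⟦d⟧ := by
    intro i
    rw [hmem, ← e.symm_apply_eq]
    constructor
    · intro h
      rw [← (e.symm i).out_eq]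
      exact Quotient.sound h
    · intro h
      have h1 := Quotient.exact ((e.symm i).out_eq.trans h)
      exact h1
  exact ⟨e ⟦d⟧, (key _).2 rfl, fun i hi => (key i).1 hi⟩

end Cover

end ForkGraph

theorem theorem2p2 {V : Type*} (G : SimpleGraph V) (hG : ForkGraph.IsLeanForkGraph G) :
    ForkGraph.HasDirectedCycleDoubleCover G := by
  obtain ⟨hfin, -, c, hc⟩ := hG.exists_coloring
  exact hc.hasDirectedCycleDoubleCover
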